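/- Let $\overline X^{n+1}$ and $\overline Y^{k+1}$ be compact smooth manifolds with boundary, with interiors $X$ and $Y$, $M=\partial\overline X$ and $\partial\overline Y\neq\emptyset$. A (smooth) defining function for the boundary is a function $r\ge 0$ on the closed manifold with $r>0$ in the interior, $r=0$ and $dr\neq0$ on the boundary. Let $g_+$ be an asymptotically hyperbolic metric on $X$: for some defining function $r$ of $M$ the metric $r^2g_+$ extends to a Riemannian metric of class $C^3$ (for instance $C^{3,\alpha}$) on $\overline X$, and the sectional curvatures of $g_+$ tend to $-1$ uniformly at $M$. Let $\iota:\overline Y\to\overline X$ be an immersion of class $C^2$ (for instance $C^{2,\alpha}$) with $\iota(Y)\subset X$ and $\iota(\partial\overline Y)\subset M$ that meets $M$ transversely and whose induced metric $\iota^*g_+$ on $Y$ is conformally compact (that is, $\rho^2\iota^*g_+$ extends to a $C^1$ Riemannian metric on $\overline Y$ for some defining function $\rho$ of $\partial\overline Y$). Suppose that $Y$ is asymptotically CMC with asymptotic mean curvature $C\in[0,\infty)$: its mean curvature vector $H=\operatorname{tr}_{\iota^*g_+}\mathrm{II}$ satisfies $g_+(H,H)=C^2+O(r)$ at $\partial\overline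 Y$, for any defining function $r$ of $M$. Let $1<p<\infty$. With respect to $\iota^*g_+$, put $$\lambda_{1,p}(\Omega)=\inf_{0\ne f\in W^{1,p}_0(\Omega)}\frac{\int_\Omega|\nabla f|^p\,dv}{\int_\Omega|f|^p\,dv},\qquad \lambda_{1,p}(Y)=\inf_\Omega\lambda_{1,p}(\Omega),$$ where $\Omega$ runs over the bounded domains of $Y$ with smooth boundary and $W^{1,p}_0(\Omega)$ is the completion of $C_c^\infty(\Omega)$ in the Sobolev norm. Then $C<k+1$ and $$\lambda_{1,p}(Y)\le\left(\frac kp\right)^p\left(1-\frac{C^2}{(k+1)^2}\right)^{p/2}.$$ In particular, if $Y$ is asymptotically minimal ($C=0$), then $\lambda_{1,p}(Y)\le\left(\frac kp\right)^p$. -/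

import Mathlib

open Set Filter Topology MeasureTheory
open scoped Manifold ContDiff Matrix

noncomputable section

namespace AHSub

/-! ### Metrics on (the interior of) a manifold with boundary -/

section Metric

variable {d : ℕ} [NeZero d] {M : Type*} [TopologicalSpace M]
  [ChartedSpace (EuclideanHalfSpace d) M]

variable (d M) in
/-- A field of bilinear forms on the tangent spaces of `M`. A Riemannian metric on the interior of
`M` is such a field, of which only the values at interior points are ever used. -/
abbrev MetricField : Type _ := ∀ x : M, LinearMap.BilinForm ℝ (TangentSpace (𝓡∂ d) x)

/-- The interior of the manifold with boundary `M`. -/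
abbrev interiorSet (d : ℕ) [NeZero d] (M : Type*) [TopologicalSpace M]
    [ChartedSpace (EuclideanHalfSpace d) M] : Set M := (𝓡∂ d).interior M

/-- The boundary of the manifold with boundary `M`. -/
abbrev boundarySet (d : ℕ) [NeZero d] (M : Type*) [TopologicalSpace M]
    [ChartedSpace (EuclideanHalfSpace d) M] : Set M := (𝓡∂ d).boundary M

/-- The filter of interior points approaching the boundary. -/
def nearBoundary (d : ℕ) [NeZero d] (M : Type*) [TopologicalSpace M]
    [ChartedSpace (EuclideanHalfSpace d) M] : Filter M := 𝓝ˢ (boundarySet d M) ⊓ 𝓟 (interiorSet d M)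

/-- The `i`-th standard basis vector of the tangent space at `x`: the coordinate vector `∂/∂zᵢ` of
the preferred chart at `x`. -/
def basisVec (x : M) (i : Fin d) : TangentSpace (𝓡∂ d) x :=
  (EuclideanSpace.single i (1 : ℝ) : EuclideanSpace ℝ (Fin d))

/-- The matrix of the bilinear form `g x` in the basis `basisVec x`. -/
def gram (g : MetricField d M) (x : M) : Matrix (Fin d) (Fin d) ℝ :=
  Matrix.of fun i j => g x (basisVec x i) (basisVec x j)

/-- The components `g(∂ᵢ, ∂ⱼ)` of `g` in the chart at `x₀`, as functions of the coordinates `z`. -/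
def metricInChart (g : MetricField d M) (x₀ : M) (z : EuclideanSpace ℝ (Fin d)) :
    Matrix (Fin d) (Fin d) ℝ :=
  Matrix.of fun i j =>
    g ((extChartAt (𝓡∂ d) x₀).symm z)
      (mfderivWithin 𝓘(ℝ, EuclideanSpace ℝ (Fin d)) (𝓡∂ d) (extChartAt (𝓡∂ d) x₀).symm
        (range (𝓡∂ d)) z (EuclideanSpace.single i (1 : ℝ) : EuclideanSpace ℝ (Fin d)))
      (mfderivWithin 𝓘(ℝ, EuclideanSpace ℝ (Fin d)) (𝓡∂ d) (extChartAt (𝓡∂ d) x₀).symm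
        (range (𝓡∂ d)) z (EuclideanSpace.single j (1 : ℝ) : EuclideanSpace ℝ (Fin d)))

end Metric

/-! ### Curvature in coordinates -/

section Coordinates

variable {d : ℕ}

/-- The partial derivative `∂ᵢ f`. -/
def pd (i : Fin d) (f : EuclideanSpace ℝ (Fin d) → ℝ) (z : EuclideanSpace ℝ (Fin d)) : ℝ :=
  fderiv ℝ f z (EuclideanSpace.single i 1)

/-- The Christoffel symbol `Γˡᵢⱼ` of the metric with components `G`. -/
def christoffel (G : EuclideanSpace ℝ (Fin d) → Matrix (Fin d) (Fin d) ℝ) (l i j : Fin d)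
    (z : EuclideanSpace ℝ (Fin d)) : ℝ :=
  (1 / 2 : ℝ) * ∑ m, (G z)⁻¹ l m *
    (pd i (fun w => G w j m) z + pd j (fun w => G w i m) z - pd m (fun w => G w i j) z)

/-- The component `Rˡₖᵢⱼ` of the Riemann tensor: `R(∂ᵢ, ∂ⱼ) ∂ₖ = ∑ₗ Rˡₖᵢⱼ ∂ₗ`, where
`R(V, W) = ∇_V ∇_W - ∇_W ∇_V - ∇_[V, W]`. -/
def riemann (G : EuclideanSpace ℝ (Fin d) → Matrix (Fin d) (Fin d) ℝ) (l k i j : Fin d)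
    (z : EuclideanSpace ℝ (Fin d)) : ℝ :=
  pd i (christoffel G l j k) z - pd j (christoffel G l i k) z
    + ∑ m, (christoffel G l i m z * christoffel G m j k z
      - christoffel G l j m z * christoffel G m i k z)

end Coordinates

section Curvature

variable {d : ℕ} [NeZero d] {M : Type*} [TopologicalSpace M]
  [ChartedSpace (EuclideanHalfSpace d) M]

/-- The `i`-th component of a tangent vector in the basis `basisVec x`. -/
def comp (x : M) (v : TangentSpace (𝓡∂ d) x) (i : Fin d) : ℝ :=
  (show EuclideanSpace ℝ (Fin d) from v) i

/-- The sectional curvature of `g` at `x` of the plane spanned by `v` and `w`: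
`g(R(v, w)w, v) / (g(v, v) g(w, w) - g(v, w)²)`. -/
def sectionalCurvature (g : MetricField d M) (x : M) (v w : TangentSpace (𝓡∂ d) x) : ℝ :=
  (∑ i, ∑ j, ∑ k, ∑ l, ∑ m,
    comp x v i * comp x w j * comp x w k * comp x v m * gram g x l m *
      riemann (metricInChart g x) l k i j (extChartAt (𝓡∂ d) x x))
    / (g x v v * g x w w - g x v w ^ 2)

/-- The sectional curvatures of `g` tend to the constant `c` at the boundary, uniformly. -/
def HasAsymptoticSectionalCurvature (g : MetricField d M) (c : ℝ) : Prop :=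
  ∀ ε > 0, ∀ᶠ x in nearBoundary d M, ∀ v w : TangentSpace (𝓡∂ d) x,
    LinearIndependent ℝ ![v, w] → |sectionalCurvature g x v w - c| < ε

end Curvature

/-! ### Conformally compact and asymptotically hyperbolic metrics -/

section ConformallyCompact

variable {d : ℕ} [NeZero d] {M : Type*} [TopologicalSpace M]
  [ChartedSpace (EuclideanHalfSpace d) M] [IsManifold (𝓡∂ d) ∞ M]

/-- `r` is a smooth defining function for the boundary of `M`. -/
structure IsDefiningFunction (d : ℕ) [NeZero d] {M : Type*} [TopologicalSpace M]
    [ChartedSpace (EuclideanHalfSpace d) M] (r : M → ℝ) : Prop where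
  smooth : ContMDiff (𝓡∂ d) 𝓘(ℝ, ℝ) ∞ r
  pos : ∀ x ∈ interiorSet d M, 0 < r x
  zero : ∀ x ∈ boundarySet d M, r x = 0
  deriv_ne : ∀ x ∈ boundarySet d M, mfderiv (𝓡∂ d) 𝓘(ℝ, ℝ) r x ≠ 0

/-- `g` is a conformally compact metric of order `C^m` on the interior of `M`: for some defining
function `r`, the metric `r² g` extends to a `C^m` Riemannian metric on all of `M`. (For compact
`M` such a `g` is automatically a complete `C^m` Riemannian metric on the interior.) -/
def IsConformallyCompact (m : ℕ) (g : MetricField d M) : Prop :=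
  ∃ (r : M → ℝ) (gbar : Bundle.ContMDiffRiemannianMetric (𝓡∂ d) (m : WithTop ℕ∞)
      (EuclideanSpace ℝ (Fin d)) (fun x : M => TangentSpace (𝓡∂ d) x)),
    IsDefiningFunction d r ∧
      ∀ x ∈ interiorSet d M, ∀ v w : TangentSpace (𝓡∂ d) x, gbar.inner x v w = r x ^ 2 * g x v w

/-- `g` is asymptotically hyperbolic: conformally compact (of order `C³`), with sectional curvatures
tending to `-1` at the boundary. -/
structure IsAsymptoticallyHyperbolic (g : MetricField d M) : Prop where
  conformallyCompact : IsConformallyCompact 3 g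
  curvature : HasAsymptoticSectionalCurvature g (-1)

end ConformallyCompact

/-! ### Immersed submanifolds and their mean curvature -/

section Submanifold

variable {d e : ℕ} [NeZero d] [NeZero e]
  {X : Type*} [TopologicalSpace X] [ChartedSpace (EuclideanHalfSpace d) X]
  {Y : Type*} [TopologicalSpace Y] [ChartedSpace (EuclideanHalfSpace e) Y]

/-- The differential of `ι : Y → X` at `y`. -/
def tangentMap (d e : ℕ) [NeZero d] [NeZero e]
    {X : Type*} [TopologicalSpace X] [ChartedSpace (EuclideanHalfSpace d) X]
    {Y : Type*} [TopologicalSpace Y] [ChartedSpace (EuclideanHalfSpace e) Y] (ι : Y → X) (y : Y) :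
    TangentSpace (𝓡∂ e) y →ₗ[ℝ] TangentSpace (𝓡∂ d) (ι y) :=
  (mfderiv (𝓡∂ e) (𝓡∂ d) ι y).toLinearMap

/-- The induced metric `ι^* g`. -/
def pullback (ι : Y → X) (g : MetricField d X) : MetricField e Y :=
  fun y => (g (ι y)).compl₁₂ (tangentMap d e ι y) (tangentMap d e ι y)

/-- The coordinate expression of `ι` in the charts at `y` and `ι y`. -/
def coordMap (d e : ℕ) [NeZero d] [NeZero e]
    {X : Type*} [TopologicalSpace X] [ChartedSpace (EuclideanHalfSpace d) X]
    {Y : Type*} [TopologicalSpace Y] [ChartedSpace (EuclideanHalfSpace e) Y] (ι : Y → X) (y : Y) :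
    EuclideanSpace ℝ (Fin e) → EuclideanSpace ℝ (Fin d) :=
  writtenInExtChartAt (𝓡∂ e) (𝓡∂ d) y ι

/-- The vector `(∇ dι)(∂_α, ∂_β) = ∇_{∂_α} ∂_β` at `ι y` (the ambient covariant derivative of the
coordinate vector fields of `Y` along `ι`). Its component normal to `Y` is the second fundamental
form `II(∂_α, ∂_β)`. -/
def ambientHessian (g : MetricField d X) (ι : Y → X) (y : Y) (α β : Fin e) :
    TangentSpace (𝓡∂ d) (ι y) :=
  (WithLp.toLp 2 fun a : Fin d =>
    pd α (pd β (fun z => coordMap d e ι y z a)) (extChartAt (𝓡∂ e) y y)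
      + ∑ b, ∑ c, christoffel (metricInChart g (ι y)) a b c (extChartAt (𝓡∂ d) (ι y) (ι y))
          * pd α (fun z => coordMap d e ι y z b) (extChartAt (𝓡∂ e) y y)
          * pd β (fun z => coordMap d e ι y z c) (extChartAt (𝓡∂ e) y y) :
    EuclideanSpace ℝ (Fin d))

/-- The `g`-orthogonal projection of `T_{ι y} X` onto the normal space of the immersion at `y`:
`v ↦ v - ∑ h^{αβ} g(v, dι ∂_α) dι ∂_β`, where `h = ι^* g`. -/
def normalProj (g : MetricField d X) (ι : Y → X) (y : Y) (v : TangentSpace (𝓡∂ d) (ι y)) :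
    TangentSpace (𝓡∂ d) (ι y) :=
  v - ∑ α, ∑ β, ((gram (pullback ι g : MetricField e Y) y)⁻¹ α β *
    g (ι y) v (tangentMap d e ι y (basisVec y α))) • tangentMap d e ι y (basisVec y β)

/-- The mean curvature vector `H = tr_h II = ∑ h^{αβ} II(∂_α, ∂_β)` (the trace is not divided by
the dimension). -/
def meanCurvature (g : MetricField d X) (ι : Y → X) (y : Y) : TangentSpace (𝓡∂ d) (ι y) :=
  ∑ α, ∑ β, (gram (pullback ι g : MetricField e Y) y)⁻¹ α β •
    normalProj (e := e) g ι y (ambientHessian (e := e) g ι y α β)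

/-- The tangent space `T_x ∂X` of the boundary at a boundary point `x`, as a subspace of `T_x X`:
the vectors whose zeroth component in the (half-space) chart at `x` vanishes. -/
def boundaryTangent (x : X) : Submodule ℝ (TangentSpace (𝓡∂ d) x) where
  carrier := {v | comp x v 0 = 0}
  zero_mem' := by simp [comp]; rfl
  add_mem' := by
    intro a b ha hb
    have : comp x (a + b) 0 = comp x a 0 + comp x b 0 := rfl
    simp_all
  smul_mem' := by
    intro c a ha
    have : comp x (c • a) 0 = c * comp x a 0 := rfl
    simp_all

variable [IsManifold (𝓡∂ e) ∞ Y]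

/-- `ι : Y → X` makes the interior of `Y` a conformally compact submanifold of the interior of `X`
with its metric `g`: `ι` is a `C²` immersion that maps interior to interior and boundary to boundary,
meets `∂X` transversely, and induces a conformally compact metric. (The restriction of `ι` to `∂Y`
is then an immersion into `∂X`. The metric induced by a `C²` immersion is of class `C¹`.) -/
structure IsConformallyCompactSubmanifold (g : MetricField d X) (ι : Y → X) : Prop where
  contMDiff : ContMDiff (𝓡∂ e) (𝓡∂ d) 2 ι
  immersion : ∀ y, Function.Injective (tangentMap d e ι y)
  mapsTo_interior : MapsTo ι (interiorSet e Y) (interiorSet d X)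
  mapsTo_boundary : MapsTo ι (boundarySet e Y) (boundarySet d X)
  transverse : ∀ y, ι y ∈ boundarySet d X →
    LinearMap.range (tangentMap d e ι y) ⊔ boundaryTangent (ι y) = ⊤
  conformallyCompact : IsConformallyCompact 1 (pullback ι g : MetricField e Y)

/-- `ι : Y → X` is an asymptotically CMC submanifold with asymptotic mean curvature `C`:
`g(H, H) = C² + O(r)` at the boundary, for any defining function `r` of `∂X`. -/
structure IsAsymptoticallyCMC (g : MetricField d X) (ι : Y → X) (C : ℝ) : Prop where
  submanifold : IsConformallyCompactSubmanifold (e := e) g ι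
  nonneg : 0 ≤ C
  meanCurvature : ∀ r : X → ℝ, IsDefiningFunction d r →
    (fun y => g (ι y) (meanCurvature (e := e) g ι y) (meanCurvature (e := e) g ι y) - C ^ 2)
      =O[nearBoundary e Y] fun y => r (ι y)

end Submanifold

/-! ### The first Dirichlet eigenvalue of the `p`-Laplacian -/

section Eigenvalue

variable {d : ℕ} [NeZero d] {M : Type*} [TopologicalSpace M]
  [ChartedSpace (EuclideanHalfSpace d) M]

/-- The Riemannian volume measure of the metric `h` on the interior of `M`: the measure which on the
domain of every chart is `√(det h) dz`. The measures `√(det h) dz` of the different charts agree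
where the charts overlap, hence the measure is their supremum. -/
def volumeMeasure [MeasurableSpace M] (h : MetricField d M) : Measure M :=
  ⨆ x₀ : M, Measure.map (extChartAt (𝓡∂ d) x₀).symm
    ((volume.restrict ((extChartAt (𝓡∂ d) x₀).target ∩ interior (range (𝓡∂ d)))).withDensity
      fun z => ENNReal.ofReal (Real.sqrt (metricInChart h x₀ z).det))

/-- The norm `|η|_h = (∑ h^{ij} ηᵢ ηⱼ)^{1/2}` of a covector at `x`. -/
def covectorNorm (h : MetricField d M) (x : M) (η : TangentSpace (𝓡∂ d) x →L[ℝ] ℝ) : ℝ :=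
  Real.sqrt (∑ i, ∑ j, (gram h x)⁻¹ i j * η (basisVec x i) * η (basisVec x j))

/-- The differential of a real function. Its `h`-norm is the norm `|∇f|` of the gradient. -/
def differential (f : M → ℝ) (x : M) : TangentSpace (𝓡∂ d) x →L[ℝ] ℝ :=
  mfderiv (𝓡∂ d) 𝓘(ℝ, ℝ) f x

variable (d) in
/-- `φ ∈ C_c^∞(Ω)`. -/
structure IsTestFunction (Ω : Set M) (φ : M → ℝ) : Prop where
  smooth : ContMDiff (𝓡∂ d) 𝓘(ℝ, ℝ) ∞ φ
  compact : HasCompactSupport φ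
  support : tsupport φ ⊆ Ω

/-- `f` is an element of `W_0^{1,p}(Ω)` with weak differential `η`: the pair `(f, η)` is the limit, in
the Sobolev norm of the metric `h`, of pairs `(φ, dφ)` with `φ ∈ C_c^∞(Ω)`. -/
def MemSobolevZero [MeasurableSpace M] (h : MetricField d M) (p : ℝ) (Ω : Set M) (f : M → ℝ)
    (η : ∀ x : M, TangentSpace (𝓡∂ d) x →L[ℝ] ℝ) : Prop :=
  ∃ φ : ℕ → M → ℝ, (∀ j, IsTestFunction d Ω (φ j)) ∧
    (∀ j, MemLp (fun x => φ j x - f x) (ENNReal.ofReal p) ((volumeMeasure h).restrict Ω)) ∧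
    (∀ j, MemLp (fun x => covectorNorm h x (differential (φ j) x - η x)) (ENNReal.ofReal p)
      ((volumeMeasure h).restrict Ω)) ∧
    Tendsto (fun j => eLpNorm (fun x => φ j x - f x) (ENNReal.ofReal p)
      ((volumeMeasure h).restrict Ω)) atTop (𝓝 0) ∧
    Tendsto (fun j => eLpNorm (fun x => covectorNorm h x (differential (φ j) x - η x))
      (ENNReal.ofReal p) ((volumeMeasure h).restrict Ω)) atTop (𝓝 0)

/-- The first Dirichlet eigenvalue `λ_{1,p}(Ω)`: the infimum of the Rayleigh quotients
`∫_Ω |∇f|^p / ∫_Ω |f|^p` over `0 ≠ f ∈ W_0^{1,p}(Ω)`. -/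
def domainEigenvalue [MeasurableSpace M] (h : MetricField d M) (p : ℝ) (Ω : Set M) : ENNReal :=
  ⨅ (f : M → ℝ) (η : ∀ x : M, TangentSpace (𝓡∂ d) x →L[ℝ] ℝ) (_ : MemSobolevZero h p Ω f η)
    (_ : ¬ f =ᵐ[(volumeMeasure h).restrict Ω] 0),
    (∫⁻ x in Ω, ENNReal.ofReal (covectorNorm h x (η x) ^ p) ∂(volumeMeasure h))
      / ∫⁻ x in Ω, ENNReal.ofReal (|f x| ^ p) ∂(volumeMeasure h)

variable (d) in
/-- `Ω` is a bounded domain with smooth boundary in the interior of `M`. Bounded means relatively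
compact, which for a complete metric is the same as metrically bounded. The boundary is smooth if
`Ω` is locally the sublevel set `{u < 0}` of a smooth function with `du ≠ 0`. -/
structure IsBoundedSmoothDomain (Ω : Set M) : Prop where
  isOpen : IsOpen Ω
  isConnected : IsConnected Ω
  isCompact_closure : IsCompact (closure Ω)
  closure_subset : closure Ω ⊆ interiorSet d M
  smooth_boundary : ∀ q ∈ frontier Ω, ∃ u : M → ℝ, ContMDiff (𝓡∂ d) 𝓘(ℝ, ℝ) ∞ u ∧
    mfderiv (𝓡∂ d) 𝓘(ℝ, ℝ) u q ≠ 0 ∧ ∀ᶠ x in 𝓝 q, (x ∈ Ω ↔ u x < 0)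

/-- The first Dirichlet eigenvalue `λ_{1,p}` of the interior of `M` with the metric `h`: the infimum
of `λ_{1,p}(Ω)` over all bounded domains `Ω` with smooth boundary. It takes values in `[0, ∞]`, so an
upper bound by a real number includes that the infimum is not over an empty set. -/
def firstEigenvalue [MeasurableSpace M] (h : MetricField d M) (p : ℝ) : ENNReal :=
  ⨅ (Ω : Set M) (_ : IsBoundedSmoothDomain d Ω), domainEigenvalue h p Ω

end Eigenvalue

end AHSub

end

/-!
# The first eigenvalue of an asymptotically CMC submanifold of an asymptotically hyperbolic manifold

Write `g = r⁻² ḡ` near the boundary, with `ḡ` smooth enough up to the boundary, and let `y₀` be a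
boundary point of the submanifold. Everything happens in the charts at `y₀` and `ι y₀`, where a metric
is a function with values in bilinear forms (`chartBil`) and the Levi-Civita connection is given by its
Christoffel symbols (`chr`).

The connection of `r⁻² ḡ` is that of `ḡ` minus `r⁻¹` times an explicit tensor (`chr_conformal`). Two
consequences are read off from the leading terms as `r → 0`:

* the sectional curvatures of `g` tend to `-|dr|²`, the length being that of `ḡ`
  (`tendsto_sectional_conformal`), so that `|dr| = 1` on the boundary if the dimension of the ambient
  manifold is at least two (`inner_grad_of_hyperbolic`);
* the squared mean curvature of the submanifold tends to `(k + 1)²` times the squared length of the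
  normal part of the gradient of `r` (`tendsto_mcSq_conformal`). Hence
  `C² = (k + 1)² (|dr|² - a²)`, where `a` is the length of the restriction of `dr` to the submanifold
  (`sq_asymptotic_meanCurvature`).

Transversality says that `a > 0` (`normal_derivative_pos`), which gives `C < k + 1` and
`a² = 1 - C² / (k + 1)²`. In ambient dimension one the submanifold is open in the ambient manifold, so
that `k = 0` and `C = 0`, and the bound is zero.

It remains to show that the eigenvalue is at most `(k a / p)^p`. In the chart at `y₀`, with the
coordinate `w₀` vanishing on the boundary, the function `r ∘ ι` is asymptotic to a multiple of `w₀`,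
and so the induced metric is asymptotic to `w₀⁻² A` for a constant inner product `A` in which the
length of `dw₀` is `a` (`tendsto_metricInChart_pullback`). This is a hyperbolic metric, and its volume
density is a multiple of `w₀^(-k-1)`. Put `κ = k / p`. The function `w₀^κ` satisfies
`|∇ w₀^κ| = κ a w₀^κ`, while `∫ w₀^(κ p) dv = ∫ w₀⁻¹ dw` diverges logarithmically. Cutting it off at
distance of order `Λ` in `log w₀`, and horizontally at a distance that is `Λ` times the largest height,
changes the gradient by `O(Λ⁻¹) w₀^κ` only, and the box that supports the cut-off has a mass
comparable to that of the smaller box where the cut-off is one (`exists_test_function`). Such boxes can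
be placed as near to `y₀` as desired inside a Euclidean ball, which serves as the domain
(`exists_ball_boxSet`, `isBoundedSmoothDomain_ball`). Comparing the volume measure with its density in
one chart (`lintegral_volumeMeasure_le`, `le_lintegral_volumeMeasure`) gives the bound
(`firstEigenvalue_le`).
-/

set_option maxSynthPendingDepth 3

noncomputable section

namespace AHSub

/-! ### The Levi-Civita connection of a metric on an open subset of a vector space -/

section Connection

variable {E : Type*} [NormedAddCommGroup E] [NormedSpace ℝ E]
  {E' : Type*} [NormedAddCommGroup E'] [NormedSpace ℝ E']

/-- Continuous bilinear forms on `E`. -/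
abbrev Bil (E : Type*) [NormedAddCommGroup E] [NormedSpace ℝ E] : Type _ := E →L[ℝ] E →L[ℝ] ℝ

/-- `G` is an inner product. -/
structure IsInner (G : Bil E) : Prop where
  symm : ∀ v w, G v w = G w v
  pos : ∀ v, v ≠ 0 → 0 < G v v

/-- The right-hand side of Koszul's formula, as a function of the derivative `D` of the metric
(the first argument of `D` is the direction of differentiation). -/
def koszul (D : E →L[ℝ] Bil E) : E →L[ℝ] E →L[ℝ] E →L[ℝ] ℝ :=
  (1 / 2 : ℝ) • (D + D.flip -
    ((ContinuousLinearMap.flipₗᵢ ℝ E E ℝ).toContinuousLinearEquiv : Bil E →L[ℝ] Bil E).comp D.flip)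

lemma koszul_apply (D : E →L[ℝ] Bil E) (v w u : E) :
    koszul D v w u = 1 / 2 * (D v w u + D w v u - D u v w) := by
  simp [koszul]

/-- The Christoffel symbols, as a bilinear map, of a metric with value `G` and derivative `D`. -/
def chr (G : Bil E) (D : E →L[ℝ] Bil E) : E →L[ℝ] E →L[ℝ] E :=
  (ContinuousLinearMap.compL ℝ E (E →L[ℝ] ℝ) E (ContinuousLinearMap.inverse G)).comp (koszul D)

lemma chr_apply (G : Bil E) (D : E →L[ℝ] Bil E) (v w : E) :
    chr G D v w = ContinuousLinearMap.inverse G (koszul D v w) := rfl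

lemma IsInner.injective {G : Bil E} (hG : IsInner G) : Function.Injective G := by
  refine (injective_iff_map_eq_zero G).2 fun v hv => ?_
  by_contra h
  have := hG.pos v h
  simp [hv] at this

lemma IsInner.eq_of_forall {G : Bil E} (hG : IsInner G) {x y : E} (h : ∀ u, G x u = G y u) :
    x = y :=
  hG.injective (ContinuousLinearMap.ext h)

variable [FiniteDimensional ℝ E]

lemma IsInner.isInvertible {G : Bil E} (hG : IsInner G) :
    ContinuousLinearMap.IsInvertible (G : E →L[ℝ] (E →L[ℝ] ℝ)) := by
  have hfin : Module.finrank ℝ E = Module.finrank ℝ (E →L[ℝ] ℝ) := by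
    rw [← (LinearMap.toContinuousLinearMap : (E →ₗ[ℝ] ℝ) ≃ₗ[ℝ] _).finrank_eq]
    exact (Subspace.dual_finrank_eq (K := ℝ) (V := E)).symm
  refine ⟨(LinearEquiv.ofInjectiveOfFinrankEq (G : E →ₗ[ℝ] (E →L[ℝ] ℝ)) hG.injective
    hfin).toContinuousLinearEquiv, ?_⟩
  ext v w
  rfl

lemma IsInner.apply_inverse {G : Bil E} (hG : IsInner G) (η : E →L[ℝ] ℝ) :
    G (ContinuousLinearMap.inverse G η) = η := by
  obtain ⟨e, he⟩ := hG.isInvertible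
  rw [← he]
  simp

lemma IsInner.chr_spec {G : Bil E} (hG : IsInner G) (D : E →L[ℝ] Bil E) (v w u : E) :
    G (chr G D v w) u = 1 / 2 * (D v w u + D w v u - D u v w) := by
  rw [chr_apply, hG.apply_inverse, koszul_apply]

lemma IsInner.chr_eq {G : Bil E} (hG : IsInner G) (D : E →L[ℝ] Bil E) {v w x : E}
    (h : ∀ u, G x u = 1 / 2 * (D v w u + D w v u - D u v w)) : chr G D v w = x :=
  hG.eq_of_forall fun u => by rw [hG.chr_spec, h]

lemma ContDiffWithinAt.chr {m : WithTop ℕ∞} {s : Set E'} {z : E'} {G : E' → Bil E}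
    {D : E' → E →L[ℝ] Bil E} (hG : ContDiffWithinAt ℝ m G s z) (hD : ContDiffWithinAt ℝ m D s z)
    (hi : IsInner (G z)) : ContDiffWithinAt ℝ m (fun x => AHSub.chr (G x) (D x)) s z := by
  have h1 : ContDiffWithinAt ℝ m (fun x => ContinuousLinearMap.inverse (G x)) s z :=
    ContDiffAt.comp_contDiffWithinAt z hi.isInvertible.contDiffAt_map_inverse hG
  have h2 : ContDiffWithinAt ℝ m (fun x => koszul (D x)) s z := by
    unfold koszul
    refine ContDiffWithinAt.const_smul _ ((hD.add ?_).sub ?_)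
    · exact (ContinuousLinearMap.flipₗᵢ ℝ E E (E →L[ℝ] ℝ)).contDiff.contDiffAt.comp_contDiffWithinAt
        z hD
    · exact contDiffWithinAt_const.clm_comp
        ((ContinuousLinearMap.flipₗᵢ ℝ E E (E →L[ℝ] ℝ)).contDiff.contDiffAt.comp_contDiffWithinAt
          z hD)
  exact ((ContinuousLinearMap.compL ℝ E (E →L[ℝ] ℝ) E).contDiff.contDiffAt.comp_contDiffWithinAt
    z h1).clm_comp h2

/-- The curvature `R(u, v) w` of the connection with Christoffel symbols `Γ`. -/
def riemC (Γ : E → E →L[ℝ] E →L[ℝ] E) (z u v w : E) : E :=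
  fderiv ℝ Γ z u v w - fderiv ℝ Γ z v u w + Γ z u (Γ z v w) - Γ z v (Γ z u w)

end Connection

/-! ### Behaviour under a change of coordinates -/

section ChangeOfCoordinates

variable {E : Type*} [NormedAddCommGroup E] [NormedSpace ℝ E]
  {E' : Type*} [NormedAddCommGroup E'] [NormedSpace ℝ E']

/-- Pull-back of a bilinear form by a linear map. -/
abbrev pullBil (G : Bil E') (L : E →L[ℝ] E') : Bil E := G.bilinearComp L L

lemma fderiv_fderiv_symm {φ : E → E'} {z : E} {n : WithTop ℕ∞} (hφ : ContDiffAt ℝ n φ z)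
    (hn : 2 ≤ n) (u v : E) :
    fderiv ℝ (fderiv ℝ φ) z u v = fderiv ℝ (fderiv ℝ φ) z v u :=
  (hφ.isSymmSndFDerivAt (by simpa using hn)) u v

lemma fderiv_clm_apply_apply {F : Type*} [NormedAddCommGroup F] [NormedSpace ℝ F]
    {T : E → E →L[ℝ] F} {z : E} (hT : DifferentiableAt ℝ T z) (u v : E) :
    fderiv ℝ (fun x => T x v) z u = fderiv ℝ T z u v := by
  rw [(hT.hasFDerivAt.clm_apply (hasFDerivAt_const v z)).fderiv]
  simp

lemma fderiv_bil_apply {F F₁ F₂ : Type*} [NormedAddCommGroup F] [NormedSpace ℝ F]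
    [NormedAddCommGroup F₁] [NormedSpace ℝ F₁] [NormedAddCommGroup F₂] [NormedSpace ℝ F₂]
    {T : E → F₁ →L[ℝ] F₂ →L[ℝ] F} {a : E → F₁} {b : E → F₂}
    {z : E} (hT : DifferentiableAt ℝ T z) (ha : DifferentiableAt ℝ a z)
    (hb : DifferentiableAt ℝ b z) (u : E) :
    fderiv ℝ (fun x => T x (a x) (b x)) z u
      = fderiv ℝ T z u (a z) (b z) + T z (fderiv ℝ a z u) (b z) + T z (a z) (fderiv ℝ b z u) := by
  rw [((hT.hasFDerivAt.clm_apply ha.hasFDerivAt).clm_apply hb.hasFDerivAt).fderiv]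
  simp
  abel

lemma fderiv_bil_apply_const {F F₁ F₂ : Type*} [NormedAddCommGroup F] [NormedSpace ℝ F]
    [NormedAddCommGroup F₁] [NormedSpace ℝ F₁] [NormedAddCommGroup F₂] [NormedSpace ℝ F₂]
    {T : E → F₁ →L[ℝ] F₂ →L[ℝ] F} {z : E} (hT : DifferentiableAt ℝ T z) (u : E) (a : F₁) (b : F₂) :
    fderiv ℝ (fun x => T x a b) z u = fderiv ℝ T z u a b := by
  rw [fderiv_bil_apply hT (differentiableAt_const a) (differentiableAt_const b)]
  simp

lemma fderiv_pullBil {φ : E → E'} {z : E} {G : E' → Bil E'} {G' : E → Bil E}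
    (hφ : ContDiffAt ℝ 2 φ z) (hG : DifferentiableAt ℝ G (φ z))
    (hG' : G' =ᶠ[𝓝 z] fun x => pullBil (G (φ x)) (fderiv ℝ φ x)) (hd : DifferentiableAt ℝ G' z)
    (u v w : E) :
    fderiv ℝ G' z u v w
      = fderiv ℝ G (φ z) (fderiv ℝ φ z u) (fderiv ℝ φ z v) (fderiv ℝ φ z w)
        + G (φ z) (fderiv ℝ (fderiv ℝ φ) z u v) (fderiv ℝ φ z w)
        + G (φ z) (fderiv ℝ φ z v) (fderiv ℝ (fderiv ℝ φ) z u w) := by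
  have hdφ : DifferentiableAt ℝ (fderiv ℝ φ) z :=
    (hφ.fderiv_right (m := 1) (by norm_num)).differentiableAt (by norm_num)
  have hφ1 : DifferentiableAt ℝ φ z := hφ.differentiableAt (by norm_num)
  have h1 := (fderiv_bil_apply_const hd u v w).symm
  have h2 : (fun x => G' x v w) =ᶠ[𝓝 z]
      fun x => G (φ x) (fderiv ℝ φ x v) (fderiv ℝ φ x w) := by
    filter_upwards [hG'] with x hx
    rw [hx]; rfl
  have hGφ : DifferentiableAt ℝ (fun x => G (φ x)) z := hG.comp z hφ1
  rw [h1, h2.fderiv_eq, fderiv_bil_apply hGφ (hdφ.clm_apply (differentiableAt_const v))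
    (hdφ.clm_apply (differentiableAt_const w)), fderiv_clm_apply_apply hdφ,
    fderiv_clm_apply_apply hdφ]
  have h3 : fderiv ℝ (fun x => G (φ x)) z = (fderiv ℝ G (φ z)).comp (fderiv ℝ φ z) :=
    fderiv_comp z hG hφ1
  rw [h3]
  rfl

variable [FiniteDimensional ℝ E] [FiniteDimensional ℝ E']

/-- The transformation law of the Christoffel symbols. -/
lemma chr_change {φ : E → E'} {z : E} {G : E' → Bil E'} {G' : E → Bil E}
    (hφ : ContDiffAt ℝ 2 φ z) (hsurj : Function.Surjective (fderiv ℝ φ z))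
    (hG : DifferentiableAt ℝ G (φ z)) (hi : IsInner (G (φ z))) (hi' : IsInner (G' z))
    (hG' : G' =ᶠ[𝓝 z] fun x => pullBil (G (φ x)) (fderiv ℝ φ x)) (hd : DifferentiableAt ℝ G' z)
    (v w : E) :
    fderiv ℝ φ z (chr (G' z) (fderiv ℝ G' z) v w)
      = fderiv ℝ (fderiv ℝ φ) z v w
        + chr (G (φ z)) (fderiv ℝ G (φ z)) (fderiv ℝ φ z v) (fderiv ℝ φ z w) := by
  refine hi.eq_of_forall fun y => ?_
  obtain ⟨u, rfl⟩ := hsurj y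
  have h1 := hi'.chr_spec (fderiv ℝ G' z) v w u
  have h2 := hi.chr_spec (fderiv ℝ G (φ z)) (fderiv ℝ φ z v) (fderiv ℝ φ z w) (fderiv ℝ φ z u)
  rw [fderiv_pullBil hφ hG hG' hd, fderiv_pullBil hφ hG hG' hd, fderiv_pullBil hφ hG hG' hd] at h1
  have h3 : G' z (chr (G' z) (fderiv ℝ G' z) v w) u = G (φ z)
      (fderiv ℝ φ z (chr (G' z) (fderiv ℝ G' z) v w)) (fderiv ℝ φ z u) := by
    exact congrArg (fun T : Bil E => T (chr (G' z) (fderiv ℝ G' z) v w) u) hG'.self_of_nhds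
  rw [← h3, h1, map_add, add_apply, h2]
  have e1 := fderiv_fderiv_symm hφ le_rfl v w
  have e2 := fderiv_fderiv_symm hφ le_rfl u v
  have e3 := fderiv_fderiv_symm hφ le_rfl u w
  rw [e1, e2, e3, hi.symm (fderiv ℝ (fderiv ℝ φ) z v u) (fderiv ℝ φ z w),
    hi.symm (fderiv ℝ φ z v)]
  ring

omit [FiniteDimensional ℝ E] [FiniteDimensional ℝ E'] in
/-- The curvature tensor of a connection is a tensor. -/
lemma riemC_change {φ : E → E'} {z : E} {Γ : E' → E' →L[ℝ] E' →L[ℝ] E'}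
    {Γ' : E → E →L[ℝ] E →L[ℝ] E} (hφ : ContDiffAt ℝ 3 φ z)
    (hΓ : DifferentiableAt ℝ Γ (φ z)) (hΓ' : DifferentiableAt ℝ Γ' z)
    (h : ∀ᶠ x in 𝓝 z, ∀ v w, fderiv ℝ φ x (Γ' x v w)
      = fderiv ℝ (fderiv ℝ φ) x v w + Γ (φ x) (fderiv ℝ φ x v) (fderiv ℝ φ x w)) (u v w : E) :
    fderiv ℝ φ z (riemC Γ' z u v w)
      = riemC Γ (φ z) (fderiv ℝ φ z u) (fderiv ℝ φ z v) (fderiv ℝ φ z w) := by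
  have hφ1 : DifferentiableAt ℝ φ z := hφ.differentiableAt (by norm_num)
  have hdφ2 : ContDiffAt ℝ 2 (fderiv ℝ φ) z := hφ.fderiv_right (m := 2) (by norm_num)
  have hdφ : DifferentiableAt ℝ (fderiv ℝ φ) z := hdφ2.differentiableAt (by norm_num)
  have hddφ : DifferentiableAt ℝ (fderiv ℝ (fderiv ℝ φ)) z :=
    (hdφ2.fderiv_right (m := 1) (by norm_num)).differentiableAt (by norm_num)
  have hΓφ : DifferentiableAt ℝ (fun x => Γ (φ x)) z := hΓ.comp z hφ1
  -- the derivative of the transformation law in the direction `u`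
  have key : ∀ u v w : E, fderiv ℝ (fderiv ℝ φ) z u (Γ' z v w)
        + fderiv ℝ φ z (fderiv ℝ Γ' z u v w)
      = fderiv ℝ (fderiv ℝ (fderiv ℝ φ)) z u v w
        + fderiv ℝ Γ (φ z) (fderiv ℝ φ z u) (fderiv ℝ φ z v) (fderiv ℝ φ z w)
        + Γ (φ z) (fderiv ℝ (fderiv ℝ φ) z u v) (fderiv ℝ φ z w)
        + Γ (φ z) (fderiv ℝ φ z v) (fderiv ℝ (fderiv ℝ φ) z u w) := by
    intro u v w
    have h0 : (fun x => fderiv ℝ φ x (Γ' x v w)) =ᶠ[𝓝 z] fun x => fderiv ℝ (fderiv ℝ φ) x v w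
        + Γ (φ x) (fderiv ℝ φ x v) (fderiv ℝ φ x w) := h.mono fun x hx => hx v w
    have h1 := DFunLike.congr_fun (h0.fderiv_eq (𝕜 := ℝ)) u
    have c1 : DifferentiableAt ℝ (fun x => Γ' x v w) z :=
      (hΓ'.clm_apply (differentiableAt_const v)).clm_apply (differentiableAt_const w)
    have c2 : DifferentiableAt ℝ (fun x => fderiv ℝ (fderiv ℝ φ) x v w) z :=
      (hddφ.clm_apply (differentiableAt_const v)).clm_apply (differentiableAt_const w)
    have c3 : DifferentiableAt ℝ (fun x => fderiv ℝ φ x v) z :=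
      hdφ.clm_apply (differentiableAt_const v)
    have c4 : DifferentiableAt ℝ (fun x => fderiv ℝ φ x w) z :=
      hdφ.clm_apply (differentiableAt_const w)
    have e1 : fderiv ℝ (fun x => fderiv ℝ φ x (Γ' x v w)) z u
        = fderiv ℝ (fderiv ℝ φ) z u (Γ' z v w) + fderiv ℝ φ z (fderiv ℝ Γ' z u v w) := by
      rw [(hdφ.hasFDerivAt.clm_apply c1.hasFDerivAt).fderiv]
      have := fderiv_bil_apply_const hΓ' u v w
      simp [this, add_comm]
    have e2 : fderiv ℝ (fun x => fderiv ℝ (fderiv ℝ φ) x v w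
        + Γ (φ x) (fderiv ℝ φ x v) (fderiv ℝ φ x w)) z u
        = fderiv ℝ (fderiv ℝ (fderiv ℝ φ)) z u v w
        + (fderiv ℝ Γ (φ z) (fderiv ℝ φ z u) (fderiv ℝ φ z v) (fderiv ℝ φ z w)
        + Γ (φ z) (fderiv ℝ (fderiv ℝ φ) z u v) (fderiv ℝ φ z w)
        + Γ (φ z) (fderiv ℝ φ z v) (fderiv ℝ (fderiv ℝ φ) z u w)) := by
      rw [fderiv_fun_add c2 ((hΓφ.clm_apply c3).clm_apply c4), add_apply,
        fderiv_bil_apply hΓφ c3 c4, fderiv_clm_apply_apply hdφ, fderiv_clm_apply_apply hdφ]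
      have h3 : fderiv ℝ (fun x => Γ (φ x)) z = (fderiv ℝ Γ (φ z)).comp (fderiv ℝ φ z) :=
        fderiv_comp z hΓ hφ1
      rw [h3, fderiv_bil_apply_const hddφ]
      simp only [ContinuousLinearMap.comp_apply]
    rw [e1, e2] at h1
    rw [h1]; abel
  have k1 := key u v w
  have k2 := key v u w
  have s3 : fderiv ℝ (fderiv ℝ (fderiv ℝ φ)) z u v w = fderiv ℝ (fderiv ℝ (fderiv ℝ φ)) z v u w := by
    rw [fderiv_fderiv_symm hdφ2 le_rfl]
  have s2 := fderiv_fderiv_symm hφ (by norm_num) u v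
  have t := h.self_of_nhds
  unfold riemC
  rw [map_sub, map_add, map_sub, t u (Γ' z v w), t v (Γ' z u w), t v w, t u w, map_add,
    map_add]
  rw [← eq_sub_iff_add_eq'] at k1 k2
  rw [k1, k2, s3, s2]
  abel

end ChangeOfCoordinates

/-! ### Traces with respect to a Gram matrix -/

section Trace

variable {e : ℕ} {W : Type*} [AddCommGroup W] [Module ℝ W]

/-- The trace `∑ b^{αβ} Q_{αβ}` with respect to the inner product with Gram matrix `b`. -/
def traceM (b : Matrix (Fin e) (Fin e) ℝ) (Q : Fin e → Fin e → W) : W :=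
  ∑ α, ∑ β, b⁻¹ α β • Q α β

/-- The trace does not depend on the basis. -/
lemma traceM_change (b : Matrix (Fin e) (Fin e) ℝ) (Q : Fin e → Fin e → W)
    {J : Matrix (Fin e) (Fin e) ℝ} (hJ : IsUnit J.det) :
    traceM (Jᵀ * b * J) (fun α β => ∑ i, ∑ j, (J i α * J j β) • Q i j) = traceM b Q := by
  have hJt : IsUnit (Jᵀ).det := by rwa [Matrix.det_transpose]
  have h1 : J * (Jᵀ * b * J)⁻¹ * Jᵀ = b⁻¹ := by
    rw [Matrix.mul_inv_rev, Matrix.mul_inv_rev, ← Matrix.mul_assoc, ← Matrix.mul_assoc,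
      Matrix.mul_nonsing_inv _ hJ, Matrix.one_mul, Matrix.mul_assoc,
      Matrix.nonsing_inv_mul _ hJt, Matrix.mul_one]
  unfold traceM
  rw [← h1]
  simp only [Finset.smul_sum, smul_smul, Matrix.mul_apply, Matrix.transpose_apply,
    Finset.sum_mul, Finset.sum_smul]
  -- both sides are sums over the same four indices
  calc _ = ∑ α, ∑ i, ∑ β, ∑ j, ((Jᵀ * b * J)⁻¹ α β * (J i α * J j β)) • Q i j := by
        refine Finset.sum_congr rfl fun α _ => ?_
        rw [Finset.sum_comm]
    _ = ∑ i, ∑ α, ∑ j, ∑ β, ((Jᵀ * b * J)⁻¹ α β * (J i α * J j β)) • Q i j := by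
        rw [Finset.sum_comm]
        exact Finset.sum_congr rfl fun i _ => Finset.sum_congr rfl fun α _ => Finset.sum_comm
    _ = ∑ i, ∑ j, ∑ β, ∑ α, ((Jᵀ * b * J)⁻¹ α β * (J i α * J j β)) • Q i j := by
        refine Finset.sum_congr rfl fun i _ => ?_
        rw [Finset.sum_comm]
        exact Finset.sum_congr rfl fun j _ => Finset.sum_comm
    _ = _ := by
        refine Finset.sum_congr rfl fun i _ => Finset.sum_congr rfl fun j _ =>
          Finset.sum_congr rfl fun β _ => Finset.sum_congr rfl fun α _ => ?_
        congr 1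
        ring

lemma Matrix.inv_smul_of_ne_zero (b : Matrix (Fin e) (Fin e) ℝ) {c : ℝ} (hc : c ≠ 0) :
    (c • b)⁻¹ = c⁻¹ • b⁻¹ := by
  by_cases hb : IsUnit b.det
  · have := Matrix.inv_smul' b (Units.mk0 c hc) hb
    simpa [Units.smul_def] using this
  · rw [Matrix.nonsing_inv_apply_not_isUnit b hb, smul_zero]
    refine Matrix.nonsing_inv_apply_not_isUnit _ ?_
    rw [Matrix.det_smul]
    exact fun h => hb (isUnit_of_mul_isUnit_right h)

lemma traceM_smul_matrix (b : Matrix (Fin e) (Fin e) ℝ) (Q : Fin e → Fin e → W) {c : ℝ}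
    (hc : c ≠ 0) : traceM (c • b) Q = c⁻¹ • traceM b Q := by
  simp [traceM, Matrix.inv_smul_of_ne_zero b hc, Finset.smul_sum, smul_smul]

lemma traceM_add (b : Matrix (Fin e) (Fin e) ℝ) (Q Q' : Fin e → Fin e → W) :
    traceM b (fun α β => Q α β + Q' α β) = traceM b Q + traceM b Q' := by
  simp [traceM, smul_add, Finset.sum_add_distrib]

lemma traceM_smul (b : Matrix (Fin e) (Fin e) ℝ) (Q : Fin e → Fin e → W) (c : ℝ) :
    traceM b (fun α β => c • Q α β) = c • traceM b Q := by
  simp only [traceM, Finset.smul_sum, smul_comm c]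

lemma map_traceM {W' F : Type*} [AddCommGroup W'] [Module ℝ W'] [FunLike F W W']
    [LinearMapClass F ℝ W W'] (f : F) (b : Matrix (Fin e) (Fin e) ℝ) (Q : Fin e → Fin e → W) :
    f (traceM b Q) = traceM b fun α β => f (Q α β) := by
  simp [traceM, map_sum]

lemma traceM_self_smul {b : Matrix (Fin e) (Fin e) ℝ} (hb : IsUnit b.det) (hs : bᵀ = b) (x : W) :
    traceM b (fun α β => b α β • x) = (e : ℝ) • x := by
  have h : ∑ α, ∑ β, b⁻¹ α β * b α β = (e : ℝ) := by
    have : (b⁻¹ * b).trace = e := by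
      rw [Matrix.nonsing_inv_mul _ hb]; simp
    rw [← this]
    simp only [Matrix.trace, Matrix.diag, Matrix.mul_apply]
    refine Finset.sum_congr rfl fun α _ => Finset.sum_congr rfl fun β _ => ?_
    rw [← Matrix.transpose_apply b, hs]
  simp only [traceM, smul_smul, ← Finset.sum_smul, h]

lemma Matrix.tendsto_inv {ι : Type*} {l : Filter ι} {b : ι → Matrix (Fin e) (Fin e) ℝ}
    {b₀ : Matrix (Fin e) (Fin e) ℝ} (hb : Tendsto b l (𝓝 b₀)) (h0 : IsUnit b₀.det) :
    Tendsto (fun t => (b t)⁻¹) l (𝓝 b₀⁻¹) := by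
  simp only [Matrix.inv_def, Ring.inverse_eq_inv']
  have h1 : Tendsto (fun t => (b t).det) l (𝓝 b₀.det) :=
    ((continuous_id.matrix_det).tendsto b₀).comp hb
  have h2 : Tendsto (fun t => (b t).adjugate) l (𝓝 b₀.adjugate) :=
    ((continuous_id.matrix_adjugate).tendsto b₀).comp hb
  exact (h1.inv₀ h0.ne_zero).smul h2

lemma tendsto_traceM [TopologicalSpace W] [ContinuousAdd W] [ContinuousSMul ℝ W]
    {ι : Type*} {l : Filter ι} {b : ι → Matrix (Fin e) (Fin e) ℝ}
    {b₀ : Matrix (Fin e) (Fin e) ℝ} (hb : Tendsto b l (𝓝 b₀)) (h0 : IsUnit b₀.det)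
    {Q : ι → Fin e → Fin e → W} {Q₀ : Fin e → Fin e → W}
    (hQ : ∀ α β, Tendsto (fun t => Q t α β) l (𝓝 (Q₀ α β))) :
    Tendsto (fun t => traceM (b t) (Q t)) l (𝓝 (traceM b₀ Q₀)) := by
  refine tendsto_finsetSum _ fun α _ => tendsto_finsetSum _ fun β _ => ?_
  have h := Matrix.tendsto_inv hb h0
  have h' : Tendsto (fun t => (b t)⁻¹ α β) l (𝓝 (b₀⁻¹ α β)) :=
    (tendsto_pi_nhds.1 ((tendsto_pi_nhds.1 h) α)) β
  exact h'.smul (hQ α β)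

end Trace

/-! ### Normal projection and mean curvature vector in coordinates -/

section Normal

variable {e : ℕ} {E : Type*} [NormedAddCommGroup E] [NormedSpace ℝ E]

/-- The standard basis vectors of `ℝᵉ`. -/
abbrev ev (α : Fin e) : EuclideanSpace ℝ (Fin e) := EuclideanSpace.single α (1 : ℝ)

/-- The Gram matrix, in the standard basis, of the inner product pulled back by `L`. -/
def gramOf (G : Bil E) (L : EuclideanSpace ℝ (Fin e) →L[ℝ] E) : Matrix (Fin e) (Fin e) ℝ :=
  Matrix.of fun α β => G (L (ev α)) (L (ev β))

/-- The projection to the orthogonal complement of the range of `L`. -/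
def nproj (G : Bil E) (L : EuclideanSpace ℝ (Fin e) →L[ℝ] E) (x : E) : E :=
  x - traceM (gramOf G L) fun α β => G x (L (ev α)) • L (ev β)

/-- The trace of the normal part of the bilinear map `Q`. With `Q` the ambient Hessian of an
immersion with differential `L` this is the mean curvature vector. -/
def mcv (G : Bil E) (L : EuclideanSpace ℝ (Fin e) →L[ℝ] E)
    (Q : EuclideanSpace ℝ (Fin e) → EuclideanSpace ℝ (Fin e) → E) : E :=
  traceM (gramOf G L) fun α β => nproj G L (Q (ev α) (ev β))

/-- The matrix of an endomorphism of `ℝᵉ`. -/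
def matOf (J : EuclideanSpace ℝ (Fin e) →L[ℝ] EuclideanSpace ℝ (Fin e)) :
    Matrix (Fin e) (Fin e) ℝ :=
  Matrix.of fun i α => J (ev α) i

lemma euclid_expand (v : EuclideanSpace ℝ (Fin e)) : v = ∑ i, v i • ev i := by
  ext j
  simp [ev, Finset.sum_apply, Pi.single_apply]

lemma apply_ev_eq_sum (J : EuclideanSpace ℝ (Fin e) →L[ℝ] EuclideanSpace ℝ (Fin e)) (α : Fin e) :
    J (ev α) = ∑ i, matOf J i α • ev i := euclid_expand _

lemma matOf_comp (J J' : EuclideanSpace ℝ (Fin e) →L[ℝ] EuclideanSpace ℝ (Fin e)) :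
    matOf (J.comp J') = matOf J * matOf J' := by
  ext i α
  simp only [matOf, Matrix.of_apply, ContinuousLinearMap.comp_apply, Matrix.mul_apply]
  conv_lhs => rw [euclid_expand (J' (ev α))]
  simp [map_sum, mul_comm]

lemma matOf_id : matOf (ContinuousLinearMap.id ℝ (EuclideanSpace ℝ (Fin e))) = 1 := by
  ext i α
  simp [matOf, Matrix.one_apply, ev]

lemma isUnit_det_matOf {J J' : EuclideanSpace ℝ (Fin e) →L[ℝ] EuclideanSpace ℝ (Fin e)}
    (h : J.comp J' = ContinuousLinearMap.id ℝ _) : IsUnit (matOf J).det := by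
  have := congrArg Matrix.det (congrArg matOf h)
  rw [matOf_comp, matOf_id, Matrix.det_mul, Matrix.det_one] at this
  exact IsUnit.of_mul_eq_one _ this

lemma bilin_expand {W : Type*} [AddCommGroup W] [Module ℝ W]
    (J : EuclideanSpace ℝ (Fin e) →L[ℝ] EuclideanSpace ℝ (Fin e))
    (Q : EuclideanSpace ℝ (Fin e) →ₗ[ℝ] EuclideanSpace ℝ (Fin e) →ₗ[ℝ] W) (α β : Fin e) :
    Q (J (ev α)) (J (ev β)) = ∑ i, ∑ j, (matOf J i α * matOf J j β) • Q (ev i) (ev j) := by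
  rw [apply_ev_eq_sum J α, apply_ev_eq_sum J β]
  simp only [map_sum, LinearMap.sum_apply, map_smul, LinearMap.smul_apply, Finset.smul_sum,
    smul_smul]
  rw [Finset.sum_comm]
  simp only [mul_comm]

/-- The trace of a bilinear map with respect to an inner product, computed in the image under `J`
of the standard basis. -/
lemma traceM_comp {W : Type*} [AddCommGroup W] [Module ℝ W]
    {J : EuclideanSpace ℝ (Fin e) →L[ℝ] EuclideanSpace ℝ (Fin e)} (hJ : IsUnit (matOf J).det)
    (b : EuclideanSpace ℝ (Fin e) →ₗ[ℝ] EuclideanSpace ℝ (Fin e) →ₗ[ℝ] ℝ)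
    (Q : EuclideanSpace ℝ (Fin e) →ₗ[ℝ] EuclideanSpace ℝ (Fin e) →ₗ[ℝ] W) :
    traceM (Matrix.of fun α β => b (J (ev α)) (J (ev β))) (fun α β => Q (J (ev α)) (J (ev β)))
      = traceM (Matrix.of fun α β => b (ev α) (ev β)) fun α β => Q (ev α) (ev β) := by
  rw [← traceM_change (Matrix.of fun α β => b (ev α) (ev β)) (fun α β => Q (ev α) (ev β)) hJ]
  congr 1
  · ext α β
    simp only [Matrix.of_apply, bilin_expand J b, Matrix.mul_apply, Matrix.transpose_apply,
      Finset.sum_mul, smul_eq_mul]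
    rw [Finset.sum_comm]
    refine Finset.sum_congr rfl fun i _ => Finset.sum_congr rfl fun j _ => ?_
    ring
  · ext α β
    exact bilin_expand J Q α β

/-- A continuous bilinear map as a bilinear map. -/
def toLin₂ {F F' W : Type*} [NormedAddCommGroup F] [NormedSpace ℝ F] [NormedAddCommGroup F']
    [NormedSpace ℝ F'] [NormedAddCommGroup W] [NormedSpace ℝ W] (Q : F →L[ℝ] F' →L[ℝ] W) :
    F →ₗ[ℝ] F' →ₗ[ℝ] W :=
  LinearMap.mk₂ ℝ (fun v w => Q v w) (by simp) (by simp) (by simp) (by simp)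

lemma toLin₂_apply {F F' W : Type*} [NormedAddCommGroup F] [NormedSpace ℝ F] [NormedAddCommGroup F']
    [NormedSpace ℝ F'] [NormedAddCommGroup W] [NormedSpace ℝ W] (Q : F →L[ℝ] F' →L[ℝ] W) (v : F)
    (w : F') : toLin₂ Q v w = Q v w := rfl

/-- The normal projection as a linear map. -/
def nprojₗ (G : Bil E) (L : EuclideanSpace ℝ (Fin e) →L[ℝ] E) : E →ₗ[ℝ] E where
  toFun := nproj G L
  map_add' x y := by
    simp only [nproj, map_add, add_apply, add_smul, traceM_add]
    abel
  map_smul' c x := by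
    simp only [nproj, map_smul, smul_apply, smul_eq_mul, mul_smul, RingHom.id_apply, smul_sub]
    rw [traceM_smul]

lemma nproj_add (G : Bil E) (L : EuclideanSpace ℝ (Fin e) →L[ℝ] E) (x y : E) :
    nproj G L (x + y) = nproj G L x + nproj G L y := (nprojₗ G L).map_add x y

lemma nproj_smul (G : Bil E) (L : EuclideanSpace ℝ (Fin e) →L[ℝ] E) (c : ℝ) (x : E) :
    nproj G L (c • x) = c • nproj G L x := (nprojₗ G L).map_smul c x

lemma nproj_sub (G : Bil E) (L : EuclideanSpace ℝ (Fin e) →L[ℝ] E) (x y : E) :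
    nproj G L (x - y) = nproj G L x - nproj G L y := (nprojₗ G L).map_sub x y

lemma nproj_comp (G : Bil E) (L : EuclideanSpace ℝ (Fin e) →L[ℝ] E)
    {J : EuclideanSpace ℝ (Fin e) →L[ℝ] EuclideanSpace ℝ (Fin e)} (hJ : IsUnit (matOf J).det)
    (x : E) : nproj G (L.comp J) x = nproj G L x := by
  have h := traceM_comp hJ (toLin₂ (pullBil G L))
    (toLin₂ (((G x).comp L).smulRight L : EuclideanSpace ℝ (Fin e) →L[ℝ] _ →L[ℝ] E))
  exact congrArg (fun y => x - y) h

lemma mcv_comp (G : Bil E) (L : EuclideanSpace ℝ (Fin e) →L[ℝ] E)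
    {J : EuclideanSpace ℝ (Fin e) →L[ℝ] EuclideanSpace ℝ (Fin e)} (hJ : IsUnit (matOf J).det)
    (Q : EuclideanSpace ℝ (Fin e) →L[ℝ] EuclideanSpace ℝ (Fin e) →L[ℝ] E) :
    mcv G (L.comp J) (fun u v => Q (J u) (J v)) = mcv G L fun u v => Q u v := by
  have h := traceM_comp hJ (toLin₂ (pullBil G L)) ((toLin₂ Q).compr₂ (nprojₗ G L))
  simp only [mcv, nproj_comp G L hJ]
  exact h

lemma mcv_congr_of_nproj {G : Bil E} {L : EuclideanSpace ℝ (Fin e) →L[ℝ] E}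
    {Q Q' : EuclideanSpace ℝ (Fin e) → EuclideanSpace ℝ (Fin e) → E}
    (h : ∀ u v, nproj G L (Q u v) = nproj G L (Q' u v)) : mcv G L Q = mcv G L Q' := by
  simp only [mcv, h]

variable {E' : Type*} [NormedAddCommGroup E'] [NormedSpace ℝ E']

lemma map_nproj (G : Bil E') (ψ : E →L[ℝ] E') (L : EuclideanSpace ℝ (Fin e) →L[ℝ] E) (x : E) :
    ψ (nproj (pullBil G ψ) L x) = nproj G (ψ.comp L) (ψ x) := by
  simp only [nproj, map_sub, map_traceM, map_smul]
  rfl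

lemma map_mcv (G : Bil E') (ψ : E →L[ℝ] E') (L : EuclideanSpace ℝ (Fin e) →L[ℝ] E)
    (Q : EuclideanSpace ℝ (Fin e) → EuclideanSpace ℝ (Fin e) → E) :
    ψ (mcv (pullBil G ψ) L Q) = mcv G (ψ.comp L) fun u v => ψ (Q u v) := by
  simp only [mcv, map_traceM, map_nproj]
  rfl

lemma gramOf_transpose {G : Bil E} (hG : IsInner G) (L : EuclideanSpace ℝ (Fin e) →L[ℝ] E) :
    (gramOf G L)ᵀ = gramOf G L := by
  ext α β
  exact hG.symm _ _

lemma gramOf_mulVec (G : Bil E) (L : EuclideanSpace ℝ (Fin e) →L[ℝ] E) (v : Fin e → ℝ) :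
    v ⬝ᵥ (gramOf G L *ᵥ v) = G (L (WithLp.toLp 2 v)) (L (WithLp.toLp 2 v)) := by
  conv_rhs => rw [euclid_expand (WithLp.toLp 2 v)]
  simp only [map_sum, map_smul, FunLike.coe_sum, Finset.sum_apply,
    smul_apply, smul_eq_mul, dotProduct, Matrix.mulVec, gramOf, Matrix.of_apply]
  simp only [Finset.mul_sum]
  rw [Finset.sum_comm]
  refine Finset.sum_congr rfl fun i _ => Finset.sum_congr rfl fun j _ => ?_
  ring

lemma isUnit_det_gramOf {G : Bil E} (hG : IsInner G) {L : EuclideanSpace ℝ (Fin e) →L[ℝ] E}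
    (hL : Function.Injective L) : IsUnit (gramOf G L).det := by
  rw [isUnit_iff_ne_zero]
  intro h
  obtain ⟨v, hv, hv'⟩ := Matrix.exists_mulVec_eq_zero_iff.2 h
  have h1 := gramOf_mulVec G L v
  rw [hv', dotProduct_zero] at h1
  refine (hG.pos (L (WithLp.toLp 2 v)) fun h0 => hv ?_).ne h1
  have := hL (h0.trans (map_zero L).symm)
  simpa using congrArg WithLp.ofLp this

lemma nproj_range {G : Bil E} (hG : IsInner G) {L : EuclideanSpace ℝ (Fin e) →L[ℝ] E}
    (hL : Function.Injective L) (u : EuclideanSpace ℝ (Fin e)) : nproj G L (L u) = 0 := by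
  have h : (nprojₗ G L).comp (L : EuclideanSpace ℝ (Fin e) →ₗ[ℝ] E) = 0 := by
    refine (EuclideanSpace.basisFun (Fin e) ℝ).toBasis.ext fun γ => ?_
    have h1 := Matrix.mul_nonsing_inv _ (isUnit_det_gramOf hG hL)
    have h2 : traceM (gramOf G L) (fun α β => G (L (ev γ)) (L (ev α)) • L (ev β)) = L (ev γ) := by
      simp only [traceM, smul_smul]
      rw [Finset.sum_comm]
      simp only [← Finset.sum_smul]
      have h3 : ∀ β, ∑ α, (gramOf G L)⁻¹ α β * G (L (ev γ)) (L (ev α))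
          = (1 : Matrix (Fin e) (Fin e) ℝ) γ β := fun β => by
        rw [← h1, Matrix.mul_apply]
        exact Finset.sum_congr rfl fun α _ => mul_comm _ _
      simp [h3, Matrix.one_apply]
    simp only [OrthonormalBasis.coe_toBasis, EuclideanSpace.basisFun_apply, LinearMap.comp_apply,
      LinearMap.zero_apply]
    change L (ev γ) - _ = 0
    rw [sub_eq_zero]
    exact h2.symm
  exact LinearMap.congr_fun h u

lemma nproj_orthogonal {G : Bil E} (hG : IsInner G) {L : EuclideanSpace ℝ (Fin e) →L[ℝ] E}
    (hL : Function.Injective L) (x : E) (u : EuclideanSpace ℝ (Fin e)) :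
    G (nproj G L x) (L u) = 0 := by
  have h : ((G (nproj G L x)).comp L : EuclideanSpace ℝ (Fin e) →L[ℝ] ℝ).toLinearMap = 0 := by
    refine (EuclideanSpace.basisFun (Fin e) ℝ).toBasis.ext fun γ => ?_
    have h1 := Matrix.nonsing_inv_mul _ (isUnit_det_gramOf hG hL)
    have h2 : G (traceM (gramOf G L) (fun α β => G x (L (ev α)) • L (ev β))) (L (ev γ))
        = G x (L (ev γ)) := by
      rw [map_traceM]
      simp only [traceM, FunLike.coe_sum, Finset.sum_apply, map_smul,
        smul_apply, smul_eq_mul]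
      have h3 : ∀ α, ∑ β, (gramOf G L)⁻¹ α β * (G x (L (ev α)) * G (L (ev β)) (L (ev γ)))
          = (1 : Matrix (Fin e) (Fin e) ℝ) α γ * G x (L (ev α)) := fun α => by
        rw [← h1, Matrix.mul_apply, Finset.sum_mul]
        refine Finset.sum_congr rfl fun β _ => ?_
        simp only [gramOf, Matrix.of_apply]
        ring
      simp [h3, Matrix.one_apply]
    simp only [OrthonormalBasis.coe_toBasis, EuclideanSpace.basisFun_apply,
      ContinuousLinearMap.coe_coe, LinearMap.zero_apply, ContinuousLinearMap.comp_apply]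
    unfold nproj
    rw [map_sub, sub_apply]
    exact sub_eq_zero.2 h2.symm
  exact LinearMap.congr_fun h u

/-- The squared length of the normal part of the `G`-gradient `N` of a covector `η` is the squared
length of `η` minus that of its restriction to the range of `L`. -/
lemma inner_nproj_self {G : Bil E} (hG : IsInner G) {L : EuclideanSpace ℝ (Fin e) →L[ℝ] E}
    (hL : Function.Injective L) (N : E) :
    G (nproj G L N) (nproj G L N) = G N N -
      traceM (gramOf G L) fun α β => G N (L (ev α)) * G N (L (ev β)) := by
  have h0 : G (nproj G L N) (traceM (gramOf G L) fun α β => G N (L (ev α)) • L (ev β)) = 0 := by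
    rw [map_traceM]
    simp only [map_smul, nproj_orthogonal hG hL, smul_zero]
    simp [traceM]
  conv_lhs => arg 2; rw [nproj]
  rw [map_sub, h0, sub_zero, hG.symm, nproj, map_sub, map_traceM]
  simp

lemma gramOf_smul (c : ℝ) (G : Bil E) (L : EuclideanSpace ℝ (Fin e) →L[ℝ] E) :
    gramOf (c • G) L = c • gramOf G L := by
  ext α β
  simp [gramOf]

lemma nproj_smul_metric {c : ℝ} (hc : c ≠ 0) (G : Bil E) (L : EuclideanSpace ℝ (Fin e) →L[ℝ] E)
    (x : E) : nproj (c • G) L x = nproj G L x := by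
  simp only [nproj, gramOf_smul, traceM_smul_matrix _ _ hc]
  simp only [smul_apply, smul_eq_mul, mul_smul, traceM_smul]
  rw [smul_smul, inv_mul_cancel₀ hc, one_smul]

lemma mcv_smul_metric {c : ℝ} (hc : c ≠ 0) (G : Bil E) (L : EuclideanSpace ℝ (Fin e) →L[ℝ] E)
    (Q : EuclideanSpace ℝ (Fin e) → EuclideanSpace ℝ (Fin e) → E) :
    mcv (c • G) L Q = c⁻¹ • mcv G L Q := by
  simp only [mcv, gramOf_smul, traceM_smul_matrix _ _ hc, nproj_smul_metric hc]

lemma mcv_add (G : Bil E) (L : EuclideanSpace ℝ (Fin e) →L[ℝ] E)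
    (Q Q' : EuclideanSpace ℝ (Fin e) → EuclideanSpace ℝ (Fin e) → E) :
    mcv G L (fun u v => Q u v + Q' u v) = mcv G L Q + mcv G L Q' := by
  simp only [mcv, nproj_add, traceM_add]

section Limits

lemma tendsto_clm_apply {F F' : Type*} [NormedAddCommGroup F] [NormedSpace ℝ F]
    [NormedAddCommGroup F'] [NormedSpace ℝ F'] {ι : Type*} {l : Filter ι} {T : ι → F →L[ℝ] F'}
    {T₀ : F →L[ℝ] F'} {x : ι → F} {x₀ : F} (hT : Tendsto T l (𝓝 T₀)) (hx : Tendsto x l (𝓝 x₀)) :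
    Tendsto (fun t => T t (x t)) l (𝓝 (T₀ x₀)) :=
  (isBoundedBilinearMap_apply.continuous.tendsto (T₀, x₀)).comp (hT.prodMk_nhds hx)

variable {ι : Type*} {l : Filter ι} {G : ι → Bil E} {G₀ : Bil E}
  {L : ι → EuclideanSpace ℝ (Fin e) →L[ℝ] E} {L₀ : EuclideanSpace ℝ (Fin e) →L[ℝ] E}

lemma tendsto_gramOf (hG : Tendsto G l (𝓝 G₀)) (hL : Tendsto L l (𝓝 L₀)) :
    Tendsto (fun t => gramOf (G t) (L t)) l (𝓝 (gramOf G₀ L₀)) := by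
  refine tendsto_pi_nhds.2 fun α => tendsto_pi_nhds.2 fun β => ?_
  exact tendsto_clm_apply (tendsto_clm_apply hG (tendsto_clm_apply hL tendsto_const_nhds))
    (tendsto_clm_apply hL tendsto_const_nhds)

lemma tendsto_nproj (hG : Tendsto G l (𝓝 G₀)) (hL : Tendsto L l (𝓝 L₀))
    (h0 : IsUnit (gramOf G₀ L₀).det) {x : ι → E} {x₀ : E} (hx : Tendsto x l (𝓝 x₀)) :
    Tendsto (fun t => nproj (G t) (L t) (x t)) l (𝓝 (nproj G₀ L₀ x₀)) := by
  refine hx.sub (tendsto_traceM (tendsto_gramOf hG hL) h0 fun α β => ?_)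
  exact (tendsto_clm_apply (tendsto_clm_apply hG hx)
    (tendsto_clm_apply hL tendsto_const_nhds)).smul (tendsto_clm_apply hL tendsto_const_nhds)

lemma tendsto_mcv (hG : Tendsto G l (𝓝 G₀)) (hL : Tendsto L l (𝓝 L₀))
    (h0 : IsUnit (gramOf G₀ L₀).det)
    {Q : ι → EuclideanSpace ℝ (Fin e) → EuclideanSpace ℝ (Fin e) → E}
    {Q₀ : EuclideanSpace ℝ (Fin e) → EuclideanSpace ℝ (Fin e) → E}
    (hQ : ∀ u v, Tendsto (fun t => Q t u v) l (𝓝 (Q₀ u v))) :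
    Tendsto (fun t => mcv (G t) (L t) (Q t)) l (𝓝 (mcv G₀ L₀ Q₀)) :=
  tendsto_traceM (tendsto_gramOf hG hL) h0 fun _ _ => tendsto_nproj hG hL h0 (hQ _ _)

end Limits

end Normal

/-! ### Functions that are differentiable up to the boundary -/

section UpToBoundary

variable {E F : Type*} [NormedAddCommGroup E] [NormedSpace ℝ E] [NormedAddCommGroup F]
  [NormedSpace ℝ F] {s : Set E} {z₀ : E} {f : E → F}

lemma _root_.ContDiffWithinAt.eventually_contDiffAt {n : ℕ} (hf : ContDiffWithinAt ℝ n f s z₀)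
    (hz : z₀ ∈ s) : ∀ᶠ z in 𝓝[interior s] z₀, ContDiffAt ℝ n f z := by
  have h := hf.eventually (by simp)
  rw [insert_eq_of_mem hz] at h
  filter_upwards [nhdsWithin_mono _ interior_subset h, self_mem_nhdsWithin] with z hz hzi
  exact hz.contDiffAt (mem_interior_iff_mem_nhds.1 hzi)

lemma _root_.ContDiffWithinAt.tendsto_interior {n : WithTop ℕ∞} (hf : ContDiffWithinAt ℝ n f s z₀) :
    Tendsto f (𝓝[interior s] z₀) (𝓝 (f z₀)) :=
  hf.continuousWithinAt.mono_left (nhdsWithin_mono _ interior_subset)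

lemma fderivWithin_of_mem_interior {z : E} (hz : z ∈ interior s) :
    fderivWithin ℝ f s z = fderiv ℝ f z :=
  fderivWithin_of_mem_nhds (mem_interior_iff_mem_nhds.1 hz)

lemma fderivWithin_eventuallyEq {z : E} (hz : z ∈ interior s) :
    fderivWithin ℝ f s =ᶠ[𝓝 z] fderiv ℝ f := by
  filter_upwards [isOpen_interior.mem_nhds hz] with x hx using fderivWithin_of_mem_interior hx

lemma _root_.ContDiffWithinAt.tendsto_fderiv (hf : ContDiffWithinAt ℝ 1 f s z₀)
    (hs : UniqueDiffOn ℝ s) (hz : z₀ ∈ s) :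
    Tendsto (fderiv ℝ f) (𝓝[interior s] z₀) (𝓝 (fderivWithin ℝ f s z₀)) := by
  have h := (hf.fderivWithin_right (m := 0) hs (by simp) hz).tendsto_interior
  refine h.congr' ?_
  filter_upwards [self_mem_nhdsWithin] with x hx using fderivWithin_of_mem_interior hx

end UpToBoundary

/-! ### Conformal change of the metric -/

section Conformal

variable {E : Type*} [NormedAddCommGroup E] [NormedSpace ℝ E]

/-- The gradient of a covector. -/
def grad (G : Bil E) (η : E →L[ℝ] ℝ) : E := ContinuousLinearMap.inverse G η

/-- With `η = dr` the Christoffel symbols of `r⁻² G` are those of `G` minus `r⁻¹ confS G η`. -/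
def confS (G : Bil E) (η : E →L[ℝ] ℝ) : E →L[ℝ] E →L[ℝ] E :=
  η.smulRight (ContinuousLinearMap.id ℝ E) + (η.smulRight (ContinuousLinearMap.id ℝ E)).flip
    - ((ContinuousLinearMap.smulRightL ℝ E E).flip (grad G η)).comp G

lemma confS_apply (G : Bil E) (η : E →L[ℝ] ℝ) (v w : E) :
    confS G η v w = η v • w + η w • v - G v w • grad G η := by
  simp [confS]

/-- The leading part of the curvature of `r⁻² G` at a zero of `r`, with `η = dr`. -/
def confQ (G : Bil E) (η : E →L[ℝ] ℝ) (u v w : E) : E :=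
  η u • confS G η v w - η v • confS G η u w + confS G η u (confS G η v w)
    - confS G η v (confS G η u w)

/-- Derivative of a connection of the form `Γ - r⁻¹ S`. -/
lemma riemC_conformal {Γ Γ' S : E → E →L[ℝ] E →L[ℝ] E} {r : E → ℝ} {z : E}
    (hΓ : DifferentiableAt ℝ Γ z) (hS : DifferentiableAt ℝ S z) (hr : DifferentiableAt ℝ r z)
    (h0 : r z ≠ 0) (h : Γ' =ᶠ[𝓝 z] fun x => Γ x - (r x)⁻¹ • S x) (u v w : E) :
    r z ^ 2 • riemC Γ' z u v w
      = (fderiv ℝ r z u • S z v w - fderiv ℝ r z v • S z u w + S z u (S z v w) - S z v (S z u w))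
        + r z • (fderiv ℝ S z v u w - fderiv ℝ S z u v w - Γ z u (S z v w) - S z u (Γ z v w)
          + Γ z v (S z u w) + S z v (Γ z u w))
        + r z ^ 2 • riemC Γ z u v w := by
  have hd : fderiv ℝ Γ' z = fderiv ℝ Γ z - ((r z)⁻¹ • fderiv ℝ S z
      + (-((r z ^ 2)⁻¹ • fderiv ℝ r z)).smulRight (S z)) := by
    have hi : HasFDerivAt (fun x => (r x)⁻¹) (-((r z ^ 2)⁻¹ • fderiv ℝ r z)) z := by
      exact ((hasDerivAt_inv h0).comp_hasFDerivAt z hr.hasFDerivAt).congr_fderiv (by simp)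
    have hs : HasFDerivAt (fun x => Γ x - (r x)⁻¹ • S x) _ z :=
      hΓ.hasFDerivAt.sub (hi.smul hS.hasFDerivAt)
    rw [h.fderiv_eq, hs.fderiv]
  have hz : Γ' z = Γ z - (r z)⁻¹ • S z := h.self_of_nhds
  unfold riemC
  rw [hd, hz]
  simp only [sub_apply, add_apply, smul_apply, ContinuousLinearMap.smulRight_apply, neg_apply,
    map_sub, map_smul, smul_sub, smul_add, smul_smul, smul_eq_mul]
  match_scalars <;> field_simp

variable [FiniteDimensional ℝ E]

lemma IsInner.grad_spec {G : Bil E} (hG : IsInner G) (η : E →L[ℝ] ℝ) (v : E) :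
    G (grad G η) v = η v := by
  rw [grad, hG.apply_inverse]

omit [FiniteDimensional ℝ E] in
lemma IsInner.smul {G : Bil E} (hG : IsInner G) {c : ℝ} (hc : 0 < c) : IsInner (c • G) where
  symm v w := by simp [hG.symm v w]
  pos v hv := by simpa using mul_pos hc (hG.pos v hv)

lemma chr_conformal {G : Bil E} (hG : IsInner G) {D D' : E →L[ℝ] Bil E} {η : E →L[ℝ] ℝ} {ρ : ℝ}
    (hρ : ρ ≠ 0) (h : ∀ u v w, D' u v w = (ρ ^ 2)⁻¹ * D u v w - 2 * (ρ ^ 3)⁻¹ * η u * G v w) :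
    chr ((ρ ^ 2)⁻¹ • G) D' = chr G D - ρ⁻¹ • confS G η := by
  ext1 v
  ext1 w
  refine (hG.smul (by positivity : 0 < (ρ ^ 2)⁻¹)).chr_eq _ fun u => ?_
  simp only [sub_apply, smul_apply, confS_apply, map_sub, map_add, map_smul, smul_eq_mul, add_apply,
    hG.grad_spec, hG.chr_spec, h]
  field_simp
  ring

lemma chr_conformal_eventuallyEq {B Bb : E → Bil E} {r : E → ℝ} {z : E}
    (hB : B =ᶠ[𝓝 z] fun x => (r x ^ 2)⁻¹ • Bb x) (hd : DifferentiableAt ℝ Bb z)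
    (hr : DifferentiableAt ℝ r z) (hi : IsInner (Bb z)) (h0 : r z ≠ 0) :
    chr (B z) (fderiv ℝ B z)
      = chr (Bb z) (fderiv ℝ Bb z) - (r z)⁻¹ • confS (Bb z) (fderiv ℝ r z) := by
  have hz : B z = (r z ^ 2)⁻¹ • Bb z := hB.self_of_nhds
  rw [hz]
  refine chr_conformal hi h0 fun u v w => ?_
  have hi : HasFDerivAt (fun x => (r x ^ 2)⁻¹) (-((2 * (r z ^ 3)⁻¹) • fderiv ℝ r z)) z := by
    have h1 := ((hasDerivAt_pow 2 (r z)).inv (pow_ne_zero 2 h0)).comp_hasFDerivAt z hr.hasFDerivAt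
    refine h1.congr_fderiv ?_
    rw [← neg_smul]
    congr 1
    field_simp
    norm_num
    ring
  have hs : HasFDerivAt (fun x => (r x ^ 2)⁻¹ • Bb x) _ z := hi.smul hd.hasFDerivAt
  rw [hB.fderiv_eq, hs.fderiv]
  simp only [add_apply, smul_apply, ContinuousLinearMap.smulRight_apply, neg_apply, smul_eq_mul]
  ring

lemma inner_confQ {G : Bil E} (hG : IsInner G) (η : E →L[ℝ] ℝ) (v w : E) :
    G (confQ G η v w w) v
      = -(G (grad G η) (grad G η)) * (G v v * G w w - G v w ^ 2) := by
  rw [hG.grad_spec η (grad G η)]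
  have h2 : ∀ x, G x (grad G η) = η x := fun x => by rw [hG.symm, hG.grad_spec]
  simp only [confQ, confS_apply, map_add, map_sub, map_smul, add_apply, sub_apply, smul_apply,
    smul_eq_mul, hG.grad_spec, h2]
  rw [hG.symm w v]
  ring

variable {F : Type*} [NormedAddCommGroup F] [NormedSpace ℝ F]

lemma contDiffWithinAt_grad {m : WithTop ℕ∞} {s : Set F} {z : F} {G : F → Bil E}
    {η : F → E →L[ℝ] ℝ} (hG : ContDiffWithinAt ℝ m G s z) (hη : ContDiffWithinAt ℝ m η s z)
    (hi : IsInner (G z)) : ContDiffWithinAt ℝ m (fun x => grad (G x) (η x)) s z :=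
  (ContDiffAt.comp_contDiffWithinAt z hi.isInvertible.contDiffAt_map_inverse hG).clm_apply hη

lemma contDiffWithinAt_confS {m : WithTop ℕ∞} {s : Set F} {z : F} {G : F → Bil E}
    {η : F → E →L[ℝ] ℝ} (hG : ContDiffWithinAt ℝ m G s z) (hη : ContDiffWithinAt ℝ m η s z)
    (hi : IsInner (G z)) : ContDiffWithinAt ℝ m (fun x => confS (G x) (η x)) s z := by
  unfold confS
  have h1 : ContDiffWithinAt ℝ m (fun x => (η x).smulRight (ContinuousLinearMap.id ℝ E)) s z :=
    hη.smulRight contDiffWithinAt_const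
  refine (h1.add ?_).sub ?_
  · exact (ContinuousLinearMap.flipₗᵢ ℝ E E E).contDiff.contDiffAt.comp_contDiffWithinAt z h1
  · refine ContDiffWithinAt.clm_comp ?_ hG
    exact ((ContinuousLinearMap.smulRightL ℝ E E).flip.contDiff.contDiffAt.comp_contDiffWithinAt z
      (contDiffWithinAt_grad hG hη hi))

/-- The sectional curvature of `r⁻² G` tends to `-|dr|²` at a boundary point where `r` vanishes. -/
lemma tendsto_sectional_conformal {s : Set E} (hs : UniqueDiffOn ℝ s) {z₀ : E} (hz₀ : z₀ ∈ s)
    {B Bb : E → Bil E} {r : E → ℝ} (hBb : ContDiffWithinAt ℝ 2 Bb s z₀)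
    (hr : ContDiffWithinAt ℝ 2 r s z₀) (hi : ∀ᶠ z in 𝓝[s] z₀, IsInner (Bb z)) (hr0 : r z₀ = 0)
    (hB : ∀ᶠ z in 𝓝[interior s] z₀, 0 < r z ∧ B =ᶠ[𝓝 z] fun x => (r x ^ 2)⁻¹ • Bb x)
    {v w : E} (hvw : LinearIndependent ℝ ![v, w]) :
    Tendsto (fun z => B z (riemC (fun x => chr (B x) (fderiv ℝ B x)) z v w w) v
        / (B z v v * B z w w - B z v w ^ 2)) (𝓝[interior s] z₀)
      (𝓝 (-(Bb z₀ (grad (Bb z₀) (fderivWithin ℝ r s z₀))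
        (grad (Bb z₀) (fderivWithin ℝ r s z₀))))) := by
  have hi0 : IsInner (Bb z₀) := hi.self_of_nhdsWithin hz₀
  have hBb1 : ContDiffWithinAt ℝ 1 (fderivWithin ℝ Bb s) s z₀ :=
    hBb.fderivWithin_right hs (by norm_num) hz₀
  have hr1 : ContDiffWithinAt ℝ 1 (fderivWithin ℝ r s) s z₀ :=
    hr.fderivWithin_right hs (by norm_num) hz₀
  set Γb : E → E →L[ℝ] E →L[ℝ] E := fun z => chr (Bb z) (fderivWithin ℝ Bb s z) with hΓb
  set S : E → E →L[ℝ] E →L[ℝ] E := fun z => confS (Bb z) (fderivWithin ℝ r s z) with hS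
  have cΓ : ContDiffWithinAt ℝ 1 Γb s z₀ := ContDiffWithinAt.chr (hBb.of_le (by norm_num)) hBb1 hi0
  have cS : ContDiffWithinAt ℝ 1 S s z₀ := contDiffWithinAt_confS (hBb.of_le (by norm_num)) hr1 hi0
  have tΓ := cΓ.tendsto_interior
  have tS := cS.tendsto_interior
  have tdΓ := cΓ.tendsto_fderiv hs hz₀
  have tdS := cS.tendsto_fderiv hs hz₀
  have tB := hBb.tendsto_interior
  have tr := hr.tendsto_interior
  have tdr := (hr.of_le (by norm_num : (1 : WithTop ℕ∞) ≤ 2)).tendsto_fderiv hs hz₀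
  rw [hr0] at tr
  -- the curvature, rescaled by `r²`, converges
  have tRb : Tendsto (fun z => riemC Γb z v w w) (𝓝[interior s] z₀)
      (𝓝 (fderivWithin ℝ Γb s z₀ v w w - fderivWithin ℝ Γb s z₀ w v w + Γb z₀ v (Γb z₀ w w)
        - Γb z₀ w (Γb z₀ v w))) := by
    have c {T : E → E →L[ℝ] E →L[ℝ] E} {T₀} (h : Tendsto T (𝓝[interior s] z₀) (𝓝 T₀)) {a : E → E}
        {a₀} (ha : Tendsto a (𝓝[interior s] z₀) (𝓝 a₀)) (x : E) :
        Tendsto (fun z => T z x (a z)) (𝓝[interior s] z₀) (𝓝 (T₀ x a₀)) :=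
      tendsto_clm_apply (tendsto_clm_apply h tendsto_const_nhds) ha
    exact (((c (tendsto_clm_apply tdΓ tendsto_const_nhds) tendsto_const_nhds w).sub
      (c (tendsto_clm_apply tdΓ tendsto_const_nhds) tendsto_const_nhds v)).add
      (c tΓ (c tΓ tendsto_const_nhds w) v)).sub (c tΓ (c tΓ tendsto_const_nhds v) w)
  have tR : Tendsto (fun z => r z ^ 2 • riemC (fun x => chr (B x) (fderiv ℝ B x)) z v w w)
      (𝓝[interior s] z₀) (𝓝 (confQ (Bb z₀) (fderivWithin ℝ r s z₀) v w w)) := by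
    have c {T : E → E →L[ℝ] E →L[ℝ] E} {T₀} (h : Tendsto T (𝓝[interior s] z₀) (𝓝 T₀)) {a : E → E}
        {a₀} (ha : Tendsto a (𝓝[interior s] z₀) (𝓝 a₀)) (x : E) :
        Tendsto (fun z => T z x (a z)) (𝓝[interior s] z₀) (𝓝 (T₀ x a₀)) :=
      tendsto_clm_apply (tendsto_clm_apply h tendsto_const_nhds) ha
    have k := tendsto_const_nhds (x := w) (f := 𝓝[interior s] z₀)
    have lim := (((((tendsto_clm_apply tdr (tendsto_const_nhds (x := v))).smul (c tS k w)).sub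
      ((tendsto_clm_apply tdr (tendsto_const_nhds (x := w))).smul (c tS k v))).add
      (c tS (c tS k w) v)).sub (c tS (c tS k v) w)).add
      (tr.smul ((((((c (tendsto_clm_apply tdS (tendsto_const_nhds (x := w))) k v).sub
        (c (tendsto_clm_apply tdS (tendsto_const_nhds (x := v))) k w)).sub
        (c tΓ (c tS k w) v)).sub (c tS (c tΓ k w) v)).add (c tΓ (c tS k v) w)).add
        (c tS (c tΓ k v) w))) |>.add ((tr.pow 2).smul tRb)
    simp only [zero_smul, add_zero, ne_eq, OfNat.ofNat_ne_zero, not_false_eq_true, zero_pow] at lim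
    refine Tendsto.congr' ?_ lim
    have e1 := cΓ.eventually_contDiffAt (n := 1) hz₀
    have e2 := cS.eventually_contDiffAt (n := 1) hz₀
    have e3 := hBb.eventually_contDiffAt (n := 2) hz₀
    have e4 := hr.eventually_contDiffAt (n := 2) hz₀
    have e5 : ∀ᶠ z in 𝓝[interior s] z₀, ∀ᶠ x in 𝓝[interior s] z, IsInner (Bb x) :=
      eventually_eventually_nhdsWithin.2 (nhdsWithin_mono _ interior_subset hi)
    filter_upwards [e1, e2, e3, e4, hB, e5, self_mem_nhdsWithin] with z h1 h2 h3 h4 h5 h6 hzi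
    rw [isOpen_interior.nhdsWithin_eq hzi] at h6
    refine (riemC_conformal (h1.differentiableAt (by norm_num)) (h2.differentiableAt (by norm_num))
      (h4.differentiableAt (by norm_num)) h5.1.ne' ?_ v w w).symm
    have h7 : ∀ᶠ x in 𝓝 z, 0 < r x := h4.continuousAt.eventually (lt_mem_nhds h5.1)
    filter_upwards [h6, h7, (h3.eventually (by simp)), (h4.eventually (by simp)),
      h5.2.eventuallyEq_nhds, isOpen_interior.mem_nhds hzi] with x a1 a2 a3 a4 a5 a6
    rw [chr_conformal_eventuallyEq a5 (a3.differentiableAt (by norm_num))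
      (a4.differentiableAt (by norm_num)) a1 a2.ne', hΓb, hS]
    simp only [fderivWithin_of_mem_interior a6]
  have hden : 0 < Bb z₀ v v * Bb z₀ w w - Bb z₀ v w ^ 2 := by
    have hw : w ≠ 0 := hvw.ne_zero 1
    have hne : v - (Bb z₀ v w / Bb z₀ w w) • w ≠ 0 := fun h => by
      have := LinearIndependent.pair_iff.1 hvw 1 (-(Bb z₀ v w / Bb z₀ w w)) (by
        rw [one_smul, neg_smul, ← sub_eq_add_neg, h])
      exact one_ne_zero this.1
    have h1 := hi0.pos _ hne
    have h2 := hi0.pos w hw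
    simp only [map_sub, map_smul, sub_apply, smul_apply, smul_eq_mul, hi0.symm w v] at h1
    have h3 := mul_pos h2 h1
    field_simp at h3
    nlinarith [h3]
  have tev {x y : E} : Tendsto (fun z => Bb z x y) (𝓝[interior s] z₀) (𝓝 (Bb z₀ x y)) :=
    tendsto_clm_apply (tendsto_clm_apply tB tendsto_const_nhds) tendsto_const_nhds
  have lim := (tendsto_clm_apply (tendsto_clm_apply tB tR) (tendsto_const_nhds (x := v))).div
    ((tev (x := v) (y := v)).mul (tev (x := w) (y := w)) |>.sub ((tev (x := v) (y := w)).pow 2))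
    hden.ne'
  rw [inner_confQ hi0, mul_div_assoc, div_self hden.ne', mul_one] at lim
  refine lim.congr' ?_
  filter_upwards [hB] with z hz
  have h0 : r z ≠ 0 := hz.1.ne'
  rw [hz.2.self_of_nhds]
  simp only [smul_apply, map_smul, smul_eq_mul, Pi.div_apply]
  generalize Bb z (riemC (fun x => chr (B x) (fderiv ℝ B x)) z v w w) v = a
  have : (r z ^ 2)⁻¹ * Bb z v v * ((r z ^ 2)⁻¹ * Bb z w w) - ((r z ^ 2)⁻¹ * Bb z v w) ^ 2
      = (r z ^ 4)⁻¹ * (Bb z v v * Bb z w w - Bb z v w ^ 2) := by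
    field_simp
  rw [this]
  by_cases hd : Bb z v v * Bb z w w - Bb z v w ^ 2 = 0
  · simp [hd]
  · field_simp

end Conformal

/-! ### The mean curvature of a submanifold that meets the boundary -/

section MeanCurvature

variable {E : Type*} [NormedAddCommGroup E] [NormedSpace ℝ E] {e : ℕ}

/-- The coordinate expression `∇dF` of the ambient Hessian of `F`, for the metric `B`. -/
def hessMap (B : E → Bil E) (F : EuclideanSpace ℝ (Fin e) → E) (z : EuclideanSpace ℝ (Fin e)) :
    EuclideanSpace ℝ (Fin e) →L[ℝ] EuclideanSpace ℝ (Fin e) →L[ℝ] E :=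
  fderiv ℝ (fderiv ℝ F) z
    + (chr (B (F z)) (fderiv ℝ B (F z))).bilinearComp (fderiv ℝ F z) (fderiv ℝ F z)

lemma hessMap_apply (B : E → Bil E) (F : EuclideanSpace ℝ (Fin e) → E)
    (z u v : EuclideanSpace ℝ (Fin e)) :
    hessMap B F z u v = fderiv ℝ (fderiv ℝ F) z u v
      + chr (B (F z)) (fderiv ℝ B (F z)) (fderiv ℝ F z u) (fderiv ℝ F z v) := rfl

/-- The squared length `g(H, H)` of the mean curvature vector, in coordinates. -/
def mcSq (B : E → Bil E) (F : EuclideanSpace ℝ (Fin e) → E) (z : EuclideanSpace ℝ (Fin e)) : ℝ :=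
  B (F z) (mcv (B (F z)) (fderiv ℝ F z) fun u v => hessMap B F z u v)
    (mcv (B (F z)) (fderiv ℝ F z) fun u v => hessMap B F z u v)

variable {E' : Type*} [NormedAddCommGroup E'] [NormedSpace ℝ E']

lemma fderiv_comp_bilin {F₁ F₂ F₃ : Type*} [NormedAddCommGroup F₁] [NormedSpace ℝ F₁]
    [NormedAddCommGroup F₂] [NormedSpace ℝ F₂] [NormedAddCommGroup F₃] [NormedSpace ℝ F₃]
    {f : F₂ → F₃} {h : F₁ → F₂} {z : F₁} (hf : ContDiffAt ℝ 2 f (h z)) (hh : ContDiffAt ℝ 2 h z)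
    (u v : F₁) :
    fderiv ℝ (fderiv ℝ (f ∘ h)) z u v
      = fderiv ℝ (fderiv ℝ f) (h z) (fderiv ℝ h z u) (fderiv ℝ h z v)
        + fderiv ℝ f (h z) (fderiv ℝ (fderiv ℝ h) z u v) := by
  have hf1 : ContDiffAt ℝ 1 (fderiv ℝ f) (h z) := hf.fderiv_right (by norm_num)
  have hh1 : ContDiffAt ℝ 1 (fderiv ℝ h) z := hh.fderiv_right (by norm_num)
  have hhd : DifferentiableAt ℝ h z := hh.differentiableAt (by norm_num)
  have e1 : fderiv ℝ (f ∘ h) =ᶠ[𝓝 z] fun x => (fderiv ℝ f (h x)).comp (fderiv ℝ h x) := by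
    filter_upwards [hh.continuousAt.eventually (hf.eventually (by simp)), hh.eventually (by simp)]
      with x h1 h2
    exact fderiv_comp x (h1.differentiableAt (by norm_num)) (h2.differentiableAt (by norm_num))
  have d1 : DifferentiableAt ℝ (fun x => fderiv ℝ f (h x)) z :=
    (hf1.differentiableAt (by norm_num)).comp z hhd
  have d2 := hh1.differentiableAt (by norm_num)
  have e2 : fderiv ℝ (fun x => fderiv ℝ f (h x)) z
      = (fderiv ℝ (fderiv ℝ f) (h z)).comp (fderiv ℝ h z) :=
    fderiv_comp z (hf1.differentiableAt (by norm_num)) hhd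
  rw [e1.fderiv_eq, (d1.hasFDerivAt.clm_comp d2.hasFDerivAt).fderiv, e2]
  simp [add_comm]

variable [FiniteDimensional ℝ E] [FiniteDimensional ℝ E']

/-- `g(H, H)` does not depend on the coordinates of the submanifold and of the ambient space. -/
lemma mcSq_change {ψ : E' → E} {φ : EuclideanSpace ℝ (Fin e) → EuclideanSpace ℝ (Fin e)}
    {F : EuclideanSpace ℝ (Fin e) → E} {F' : EuclideanSpace ℝ (Fin e) → E'}
    {z : EuclideanSpace ℝ (Fin e)} {B : E → Bil E} {B' : E' → Bil E'}
    (hψ : ContDiffAt ℝ 2 ψ (F' z)) (hφ : ContDiffAt ℝ 2 φ z) (hF : ContDiffAt ℝ 2 F (φ z))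
    (hF' : ContDiffAt ℝ 2 F' z) (hψs : Function.Surjective (fderiv ℝ ψ (F' z)))
    (hJ : IsUnit (matOf (fderiv ℝ φ z)).det) (hcomm : ψ ∘ F' =ᶠ[𝓝 z] F ∘ φ)
    (hB : DifferentiableAt ℝ B (ψ (F' z))) (hd : DifferentiableAt ℝ B' (F' z))
    (hi : IsInner (B (ψ (F' z)))) (hi' : IsInner (B' (F' z)))
    (hB' : B' =ᶠ[𝓝 (F' z)] fun x => pullBil (B (ψ x)) (fderiv ℝ ψ x))
    (hinj : Function.Injective (fderiv ℝ F (φ z))) :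
    mcSq B' F' z = mcSq B F (φ z) := by
  have hp : ψ (F' z) = F (φ z) := hcomm.self_of_nhds
  set T := fderiv ℝ ψ (F' z) with hT
  have hL : T.comp (fderiv ℝ F' z) = (fderiv ℝ F (φ z)).comp (fderiv ℝ φ z) := by
    rw [hT, ← fderiv_comp z (hψ.differentiableAt (by norm_num)) (hF'.differentiableAt (by norm_num)),
      hcomm.fderiv_eq,
      fderiv_comp z (hF.differentiableAt (by norm_num)) (hφ.differentiableAt (by norm_num))]
  have hL' : ∀ u, T (fderiv ℝ F' z u) = fderiv ℝ F (φ z) (fderiv ℝ φ z u) := fun u =>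
    DFunLike.congr_fun hL u
  have hess : ∀ u v, T (hessMap B' F' z u v)
      = hessMap B F (φ z) (fderiv ℝ φ z u) (fderiv ℝ φ z v)
        + fderiv ℝ F (φ z) (fderiv ℝ (fderiv ℝ φ) z u v) := fun u v => by
    have h1 := fderiv_comp_bilin hψ hF' u v
    rw [hcomm.fderiv.fderiv_eq, fderiv_comp_bilin hF hφ] at h1
    have h2 := chr_change hψ hψs hB hi hi' hB' hd (fderiv ℝ F' z u) (fderiv ℝ F' z v)
    rw [hessMap_apply, map_add, h2, hessMap_apply, ← hT, hL', hL', ← hp]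
    rw [← hT] at h1
    rw [add_right_comm, h1]
    abel
  have hB0 : B' (F' z) = pullBil (B (F (φ z))) T := by rw [← hp]; exact hB'.self_of_nhds
  rw [hp] at hi
  have key : T (mcv (B' (F' z)) (fderiv ℝ F' z) fun u v => hessMap B' F' z u v)
      = mcv (B (F (φ z))) (fderiv ℝ F (φ z)) fun u v => hessMap B F (φ z) u v := by
    rw [hB0, map_mcv, hL, ← mcv_comp _ _ hJ]
    refine mcv_congr_of_nproj fun u v => ?_
    simp only [hess, nproj_comp _ _ hJ, nproj_add, nproj_range hi hinj, add_zero]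
  unfold mcSq
  rw [← key]
  conv_lhs => arg 1; arg 1; rw [hB0]
  rfl

section

variable {ι : Type*} {l : Filter ι} {G : ι → Bil E} {G₀ : Bil E}

omit [FiniteDimensional ℝ E']

lemma tendsto_inverse (hi : IsInner G₀) (hG : Tendsto G l (𝓝 G₀)) :
    Tendsto (fun t => ContinuousLinearMap.inverse (G t)) l (𝓝 (ContinuousLinearMap.inverse G₀)) :=
  Tendsto.comp (hi.isInvertible.contDiffAt_map_inverse (n := 0)).continuousAt hG

lemma tendsto_grad (hi : IsInner G₀) (hG : Tendsto G l (𝓝 G₀)) {η : ι → E →L[ℝ] ℝ}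
    {η₀ : E →L[ℝ] ℝ} (hη : Tendsto η l (𝓝 η₀)) :
    Tendsto (fun t => grad (G t) (η t)) l (𝓝 (grad G₀ η₀)) :=
  tendsto_clm_apply (tendsto_inverse hi hG) hη

lemma tendsto_chr (hi : IsInner G₀) (hG : Tendsto G l (𝓝 G₀)) {D : ι → E →L[ℝ] Bil E}
    {D₀ : E →L[ℝ] Bil E} (hD : Tendsto D l (𝓝 D₀)) :
    Tendsto (fun t => chr (G t) (D t)) l (𝓝 (chr G₀ D₀)) := by
  have h : ContDiffWithinAt ℝ 0 (fun q : Bil E × (E →L[ℝ] Bil E) => chr q.1 q.2) univ (G₀, D₀) :=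
    ContDiffWithinAt.chr contDiffWithinAt_fst contDiffWithinAt_snd hi
  rw [contDiffWithinAt_univ] at h
  exact Tendsto.comp (f := fun t => (G t, D t)) h.continuousAt (hG.prodMk_nhds hD)

end

omit [FiniteDimensional ℝ E] [FiniteDimensional ℝ E'] in
/-- The mean curvature vector of `r⁻² G`, with `ρ` the value of `r` and `η = dr`: the terms of
`confS` that are tangential drop out under the normal projection, and the trace of the remaining one
contributes `e` times the normal part of the gradient of `r`. -/
lemma mcv_conformal {G : Bil E} (hG : IsInner G) {L : EuclideanSpace ℝ (Fin e) →L[ℝ] E}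
    (hL : Function.Injective L) {ρ : ℝ} (hρ : ρ ≠ 0) (η : E →L[ℝ] ℝ)
    {A A' : E →L[ℝ] E →L[ℝ] E} (hA : A' = A - ρ⁻¹ • confS G η)
    (P : EuclideanSpace ℝ (Fin e) → EuclideanSpace ℝ (Fin e) → E) :
    mcv ((ρ ^ 2)⁻¹ • G) L (fun u v => P u v + A' (L u) (L v))
      = ρ • (ρ • mcv G L (fun u v => P u v + A (L u) (L v)) + (e : ℝ) • nproj G L (grad G η)) := by
  have h1 : mcv G L (fun u v => P u v + A' (L u) (L v))
      = mcv G L fun u v => (P u v + A (L u) (L v)) + (ρ⁻¹ * G (L u) (L v)) • grad G η := by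
    refine mcv_congr_of_nproj fun u v => ?_
    rw [hA]
    simp only [sub_apply, smul_apply, confS_apply, nproj_add, nproj_sub, nproj_smul,
      nproj_range hG hL, smul_zero, zero_add, smul_sub, smul_smul]
    simp only [mul_smul, zero_sub, sub_neg_eq_add]
    abel
  have h2 : mcv G L (fun u v => (ρ⁻¹ * G (L u) (L v)) • grad G η)
      = ρ⁻¹ • (e : ℝ) • nproj G L (grad G η) := by
    rw [← traceM_self_smul (isUnit_det_gramOf hG hL) (gramOf_transpose hG L), ← traceM_smul]
    simp only [mcv, nproj_smul, mul_smul]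
    rfl
  rw [mcv_smul_metric (by positivity), h1, mcv_add, h2, inv_inv]
  match_scalars <;> field_simp

omit [FiniteDimensional ℝ E'] in
/-- The squared mean curvature tends to `e² |(grad r)^⊥|²` at the boundary. -/
lemma tendsto_mcSq_conformal {s : Set E} {s' : Set (EuclideanSpace ℝ (Fin e))}
    (hs : UniqueDiffOn ℝ s) (hs' : UniqueDiffOn ℝ s') {z₀ : EuclideanSpace ℝ (Fin e)}
    (hz₀ : z₀ ∈ s') {F : EuclideanSpace ℝ (Fin e) → E} (hF : ContDiffWithinAt ℝ 2 F s' z₀)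
    (hFs : F z₀ ∈ s) (hFi : ∀ᶠ z in 𝓝[interior s'] z₀, F z ∈ interior s)
    (hinj : Function.Injective (fderivWithin ℝ F s' z₀))
    {B Bb : E → Bil E} {r : E → ℝ} (hBb : ContDiffWithinAt ℝ 1 Bb s (F z₀))
    (hr : ContDiffWithinAt ℝ 1 r s (F z₀)) (hi : ∀ᶠ x in 𝓝[s] (F z₀), IsInner (Bb x))
    (hr0 : r (F z₀) = 0)
    (hB : ∀ᶠ x in 𝓝[interior s] (F z₀), 0 < r x ∧ B =ᶠ[𝓝 x] fun y => (r y ^ 2)⁻¹ • Bb y)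
    (hinj' : ∀ᶠ z in 𝓝[interior s'] z₀, Function.Injective (fderiv ℝ F z)) :
    Tendsto (mcSq B F) (𝓝[interior s'] z₀)
      (𝓝 ((e : ℝ) ^ 2 * (Bb (F z₀) (grad (Bb (F z₀)) (fderivWithin ℝ r s (F z₀)))
          (grad (Bb (F z₀)) (fderivWithin ℝ r s (F z₀)))
        - traceM (gramOf (Bb (F z₀)) (fderivWithin ℝ F s' z₀)) fun α β =>
          fderivWithin ℝ r s (F z₀) (fderivWithin ℝ F s' z₀ (ev α))
            * fderivWithin ℝ r s (F z₀) (fderivWithin ℝ F s' z₀ (ev β))))) := by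
  have hi0 : IsInner (Bb (F z₀)) := hi.self_of_nhdsWithin hFs
  have tF : Tendsto F (𝓝[interior s'] z₀) (𝓝[interior s] (F z₀)) :=
    tendsto_nhdsWithin_iff.2 ⟨hF.tendsto_interior, hFi⟩
  have tL := (hF.of_le (by norm_num : (1 : WithTop ℕ∞) ≤ 2)).tendsto_fderiv hs' hz₀
  have tD2 : Tendsto (fderiv ℝ (fderiv ℝ F)) (𝓝[interior s'] z₀)
      (𝓝 (fderivWithin ℝ (fderivWithin ℝ F s') s' z₀)) := by
    have h1 : ContDiffWithinAt ℝ 1 (fderivWithin ℝ F s') s' z₀ :=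
      hF.fderivWithin_right hs' (by norm_num) hz₀
    refine (h1.tendsto_fderiv hs' hz₀).congr' ?_
    filter_upwards [self_mem_nhdsWithin] with x hx
    exact (fderivWithin_eventuallyEq hx).fderiv_eq
  have tG := hBb.tendsto_interior.comp tF
  have tη := (hr.tendsto_fderiv hs hFs).comp tF
  have tr := hr.tendsto_interior.comp tF
  rw [hr0] at tr
  have tdG := (hBb.tendsto_fderiv hs hFs).comp tF
  have tchr : Tendsto (fun z => chr (Bb (F z)) (fderiv ℝ Bb (F z))) (𝓝[interior s'] z₀)
      (𝓝 (chr (Bb (F z₀)) (fderivWithin ℝ Bb s (F z₀)))) := by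
    exact tendsto_chr hi0 tG tdG
  have tN : Tendsto (fun z => grad (Bb (F z)) (fderiv ℝ r (F z))) (𝓝[interior s'] z₀)
      (𝓝 (grad (Bb (F z₀)) (fderivWithin ℝ r s (F z₀)))) := by
    exact tendsto_grad hi0 tG tη
  have hu := isUnit_det_gramOf hi0 hinj
  have tH := tendsto_mcv tG tL hu (Q := fun z u v => hessMap Bb F z u v)
    (Q₀ := fun u v => fderivWithin ℝ (fderivWithin ℝ F s') s' z₀ u v
      + chr (Bb (F z₀)) (fderivWithin ℝ Bb s (F z₀)) (fderivWithin ℝ F s' z₀ u)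
        (fderivWithin ℝ F s' z₀ v)) fun u v => by
    refine (tendsto_clm_apply (tendsto_clm_apply tD2 (tendsto_const_nhds (x := u)))
      (tendsto_const_nhds (x := v))).add ?_
    exact tendsto_clm_apply
      (tendsto_clm_apply tchr (tendsto_clm_apply tL (tendsto_const_nhds (x := u))))
      (tendsto_clm_apply tL (tendsto_const_nhds (x := v)))
  have tY := (tr.smul tH).add ((tendsto_nproj tG tL hu tN).const_smul (e : ℝ))
  rw [zero_smul, zero_add] at tY
  have lim := tendsto_clm_apply (tendsto_clm_apply tG tY) tY
  simp only [map_smul, smul_apply, smul_eq_mul, inner_nproj_self hi0 hinj, hi0.grad_spec] at lim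
  rw [← mul_assoc, ← pow_two] at lim
  rw [hi0.grad_spec]
  refine lim.congr' ?_
  have e1 := tF.eventually (hBb.eventually_contDiffAt (n := 1) hFs)
  have e2 := tF.eventually (hr.eventually_contDiffAt (n := 1) hFs)
  have e3 := tF.eventually hB
  have e4 := tF.eventually (nhdsWithin_mono _ interior_subset hi)
  filter_upwards [e1, e2, e3, e4, hinj'] with z h1 h2 h3 h4 h5
  have hc := chr_conformal_eventuallyEq h3.2 (h1.differentiableAt (by norm_num))
    (h2.differentiableAt (by norm_num)) h4 h3.1.ne'
  have hm := mcv_conformal h4 h5 h3.1.ne' (fderiv ℝ r (F z)) hc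
    (fun u v => fderiv ℝ (fderiv ℝ F) z u v)
  unfold mcSq
  simp only [hessMap_apply]
  rw [h3.2.self_of_nhds] at hm ⊢
  rw [hm]
  have h0 : r (F z) ≠ 0 := h3.1.ne'
  simp only [map_smul, smul_apply, smul_eq_mul, Function.comp_apply]
  field_simp

end MeanCurvature

/-! ### Components of the connection and of the curvature -/

section Components

variable {d : ℕ}

/-- `G` is the matrix of components of the bilinear forms `B`. -/
def IsMatrixOf (G : EuclideanSpace ℝ (Fin d) → Matrix (Fin d) (Fin d) ℝ)
    (B : EuclideanSpace ℝ (Fin d) → Bil (EuclideanSpace ℝ (Fin d))) : Prop :=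
  ∀ z i j, G z i j = B z (ev i) (ev j)

variable {G : EuclideanSpace ℝ (Fin d) → Matrix (Fin d) (Fin d) ℝ}
  {B : EuclideanSpace ℝ (Fin d) → Bil (EuclideanSpace ℝ (Fin d))} {z : EuclideanSpace ℝ (Fin d)}

lemma IsMatrixOf.pd_eq (h : IsMatrixOf G B) (hB : DifferentiableAt ℝ B z) (i j m : Fin d) :
    pd i (fun w => G w j m) z = fderiv ℝ B z (ev i) (ev j) (ev m) := by
  have : (fun w => G w j m) = fun w => B w (ev j) (ev m) := funext fun w => h w j m
  rw [pd, this, fderiv_bil_apply_const hB]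

lemma IsMatrixOf.christoffel_eq (h : IsMatrixOf G B) (hB : DifferentiableAt ℝ B z)
    (hi : IsInner (B z)) (l i j : Fin d) :
    christoffel G l i j z = chr (B z) (fderiv ℝ B z) (ev i) (ev j) l := by
  set c := chr (B z) (fderiv ℝ B z) (ev i) (ev j) with hc
  have hG : G z = gramOf (B z) (ContinuousLinearMap.id ℝ _) := by
    ext a b; exact h z a b
  have hu : IsUnit (G z).det := by
    rw [hG]; exact isUnit_det_gramOf hi Function.injective_id
  have h1 : G z *ᵥ c.ofLp = fun m => (1 / 2 : ℝ) * (pd i (fun w => G w j m) z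
      + pd j (fun w => G w i m) z - pd m (fun w => G w i j) z) := by
    ext m
    simp only [h.pd_eq hB]
    rw [← hi.chr_spec, ← hc]
    conv_rhs => rw [euclid_expand c]
    simp only [Matrix.mulVec, dotProduct, h z, map_sum, map_smul, FunLike.coe_sum, Finset.sum_apply,
      smul_apply, smul_eq_mul]
    exact Finset.sum_congr rfl fun x _ => by rw [hi.symm, mul_comm]
  have h2 := congrArg (fun k => ((G z)⁻¹ *ᵥ k) l) h1
  simp only [Matrix.mulVec_mulVec, Matrix.nonsing_inv_mul _ hu, Matrix.one_mulVec] at h2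
  rw [h2, christoffel, Finset.mul_sum]
  simp only [Matrix.mulVec, dotProduct]
  exact Finset.sum_congr rfl fun m _ => by ring

lemma IsMatrixOf.riemann_eq (h : IsMatrixOf G B) (hB : ContDiffAt ℝ 2 B z)
    (hi : ∀ᶠ x in 𝓝 z, IsInner (B x)) (l k i j : Fin d) :
    riemann G l k i j z
      = riemC (fun x => chr (B x) (fderiv ℝ B x)) z (ev i) (ev j) (ev k) l := by
  have hΓ : DifferentiableAt ℝ (fun x => chr (B x) (fderiv ℝ B x)) z := by
    have h1 : ContDiffWithinAt ℝ 1 (fderiv ℝ B) univ z :=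
      (hB.fderiv_right (m := 1) (by norm_num)).contDiffWithinAt
    have h2 := ContDiffWithinAt.chr (hB.contDiffWithinAt.of_le (by norm_num)) h1 hi.self_of_nhds
    exact (contDiffWithinAt_univ.1 h2).differentiableAt (by norm_num)
  have hc : ∀ᶠ x in 𝓝 z, ∀ l i j, christoffel G l i j x = chr (B x) (fderiv ℝ B x) (ev i) (ev j) l := by
    filter_upwards [hi, hB.eventually (by simp)] with x h1 h2
    exact fun l i j => h.christoffel_eq (h2.differentiableAt (by norm_num)) h1 l i j
  have hpd : ∀ i l j k, pd i (christoffel G l j k) z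
      = fderiv ℝ (fun x => chr (B x) (fderiv ℝ B x)) z (ev i) (ev j) (ev k) l := by
    intro i l j k
    have e1 : christoffel G l j k =ᶠ[𝓝 z]
        fun x => EuclideanSpace.proj (𝕜 := ℝ) l (chr (B x) (fderiv ℝ B x) (ev j) (ev k)) := by
      filter_upwards [hc] with x hx using hx l j k
    rw [pd, e1.fderiv_eq]
    have d1 : DifferentiableAt ℝ (fun x => chr (B x) (fderiv ℝ B x) (ev j) (ev k)) z :=
      (hΓ.clm_apply (differentiableAt_const _)).clm_apply (differentiableAt_const _)
    have := ((EuclideanSpace.proj (𝕜 := ℝ) l).hasFDerivAt.comp z d1.hasFDerivAt).fderiv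
    simp only [Function.comp_def] at this
    rw [this]
    simp only [ContinuousLinearMap.comp_apply]
    rw [fderiv_bil_apply_const hΓ]
    rfl
  have hm : ∀ i j k, ∑ m, christoffel G l i m z * christoffel G m j k z
      = chr (B z) (fderiv ℝ B z) (ev i) (chr (B z) (fderiv ℝ B z) (ev j) (ev k)) l := by
    intro i j k
    conv_rhs => rw [euclid_expand (chr (B z) (fderiv ℝ B z) (ev j) (ev k))]
    simp only [hc.self_of_nhds, map_sum, map_smul, WithLp.ofLp_sum, WithLp.ofLp_smul,
      Finset.sum_apply, Pi.smul_apply, smul_eq_mul]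
    exact Finset.sum_congr rfl fun m _ => mul_comm _ _
  rw [riemann, Finset.sum_sub_distrib, hm, hm, hpd, hpd, riemC]
  simp only [PiLp.sub_apply, PiLp.add_apply]
  ring

/-- The components of the curvature, contracted as in the definition of the sectional curvature. -/
lemma IsMatrixOf.sum_riemann_eq (h : IsMatrixOf G B) (hB : ContDiffAt ℝ 2 B z)
    (hi : ∀ᶠ x in 𝓝 z, IsInner (B x)) (v w : EuclideanSpace ℝ (Fin d)) :
    ∑ i, ∑ j, ∑ k, ∑ l, ∑ m, v i * w j * w k * v m * G z l m * riemann G l k i j z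
      = B z (riemC (fun x => chr (B x) (fderiv ℝ B x)) z v w w) v := by
  set Γ := fun x => chr (B x) (fderiv ℝ B x) with hΓ
  -- the curvature as a trilinear map
  have e1 : ∀ i j, riemC Γ z (ev i) (ev j) w = ∑ k, w k • riemC Γ z (ev i) (ev j) (ev k) := by
    intro i j
    conv_lhs => rw [euclid_expand w]
    simp only [riemC, map_sum, map_smul, smul_sub, smul_add, Finset.sum_sub_distrib,
      Finset.sum_add_distrib]
  have e2 : ∀ i x, riemC Γ z (ev i) w x = ∑ j, w j • riemC Γ z (ev i) (ev j) x := by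
    intro i x
    conv_lhs => rw [euclid_expand w]
    simp only [riemC, map_sum, map_smul, smul_sub, smul_add, Finset.sum_sub_distrib,
      Finset.sum_add_distrib, FunLike.coe_sum, Finset.sum_apply, smul_apply]
  have e3 : ∀ y x, riemC Γ z v y x = ∑ i, v i • riemC Γ z (ev i) y x := by
    intro y x
    conv_lhs => rw [euclid_expand v]
    simp only [riemC, map_sum, map_smul, smul_sub, smul_add, Finset.sum_sub_distrib,
      Finset.sum_add_distrib, FunLike.coe_sum, Finset.sum_apply, smul_apply]
  have e4 : ∀ x : EuclideanSpace ℝ (Fin d), B z x v = ∑ l, ∑ m, x l * (v m * G z l m) := by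
    intro x
    conv_lhs => rw [euclid_expand x, euclid_expand v]
    simp only [map_sum, map_smul, FunLike.coe_sum, Finset.sum_apply, smul_apply, smul_eq_mul, h z,
      Finset.mul_sum]
    rw [Finset.sum_comm]
    refine Finset.sum_congr rfl fun l _ => Finset.sum_congr rfl fun m _ => by ring
  rw [e3]
  simp only [e2, e1, map_sum, map_smul, FunLike.coe_sum, Finset.sum_apply, smul_apply, smul_eq_mul]
  refine Finset.sum_congr rfl fun i _ => ?_
  rw [Finset.mul_sum]
  refine Finset.sum_congr rfl fun j _ => ?_
  rw [Finset.mul_sum, Finset.mul_sum]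
  refine Finset.sum_congr rfl fun k _ => ?_
  rw [e4]
  simp only [Finset.mul_sum, h.riemann_eq hB hi]
  refine Finset.sum_congr rfl fun l _ => Finset.sum_congr rfl fun m _ => ?_
  ring

end Components

/-! ### Charts of a manifold with boundary -/

section Charts

variable {d : ℕ} [NeZero d]

/-- The closed half-space onto which the model maps. -/
abbrev halfSpace (d : ℕ) [NeZero d] : Set (EuclideanSpace ℝ (Fin d)) := range (𝓡∂ d)

lemma uniqueDiffOn_halfSpace : UniqueDiffOn ℝ (halfSpace d) := (𝓡∂ d).uniqueDiffOn

lemma mem_interior_halfSpace {z : EuclideanSpace ℝ (Fin d)} :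
    z ∈ interior (halfSpace d) ↔ 0 < z 0 := by
  rw [halfSpace, interior_range_modelWithCornersEuclideanHalfSpace]; rfl

lemma mem_halfSpace {z : EuclideanSpace ℝ (Fin d)} : z ∈ halfSpace d ↔ 0 ≤ z 0 := by
  rw [halfSpace, range_modelWithCornersEuclideanHalfSpace]; rfl

variable {M : Type*} [TopologicalSpace M] [ChartedSpace (EuclideanHalfSpace d) M]

/-- The change of coordinates from the chart at `a` to the chart at `b`. -/
def trans (d : ℕ) [NeZero d] {M : Type*} [TopologicalSpace M]
    [ChartedSpace (EuclideanHalfSpace d) M] (a b : M) :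
    EuclideanSpace ℝ (Fin d) → EuclideanSpace ℝ (Fin d) :=
  extChartAt (𝓡∂ d) b ∘ (extChartAt (𝓡∂ d) a).symm

/-- The coordinate frame of the chart at `a`, at the point with coordinates `z`. -/
def frame (d : ℕ) [NeZero d] {M : Type*} [TopologicalSpace M]
    [ChartedSpace (EuclideanHalfSpace d) M] (a : M) (z : EuclideanSpace ℝ (Fin d)) :
    EuclideanSpace ℝ (Fin d) →L[ℝ] EuclideanSpace ℝ (Fin d) :=
  mfderivWithin 𝓘(ℝ, EuclideanSpace ℝ (Fin d)) (𝓡∂ d) (extChartAt (𝓡∂ d) a).symm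
    (range (𝓡∂ d)) z

/-- The interior points with coordinates `z` in the chart at `a` that lie in the domain of the
chart at `b`. -/
def overlap (d : ℕ) [NeZero d] {M : Type*} [TopologicalSpace M]
    [ChartedSpace (EuclideanHalfSpace d) M] (a b : M) : Set (EuclideanSpace ℝ (Fin d)) :=
  {z | z ∈ (extChartAt (𝓡∂ d) a).target ∧ z ∈ interior (halfSpace d) ∧
    (extChartAt (𝓡∂ d) a).symm z ∈ (extChartAt (𝓡∂ d) b).source}

lemma isOpen_target_inter_interior (a : M) :
    IsOpen ((extChartAt (𝓡∂ d) a).target ∩ interior (halfSpace d)) := by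
  have : (extChartAt (𝓡∂ d) a).target ∩ interior (halfSpace d)
      = (𝓡∂ d).symm ⁻¹' (chartAt (EuclideanHalfSpace d) a).target ∩ interior (halfSpace d) := by
    rw [extChartAt_target, inter_assoc, inter_eq_right.2 interior_subset]
  rw [this]
  exact ((chartAt (EuclideanHalfSpace d) a).open_target.preimage (𝓡∂ d).continuous_symm).inter
    isOpen_interior

lemma isOpen_overlap (a b : M) : IsOpen (overlap d a b) := by
  have h := ((continuousOn_extChartAt_symm (I := 𝓡∂ d) a).mono inter_subset_left).isOpen_inter_preimage
    (isOpen_target_inter_interior a) (isOpen_extChartAt_source (I := 𝓡∂ d) b)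
  have e : overlap d a b = (extChartAt (𝓡∂ d) a).target ∩ interior (halfSpace d) ∩
      (extChartAt (𝓡∂ d) a).symm ⁻¹' (extChartAt (𝓡∂ d) b).source :=
    Set.ext fun z => ⟨fun h => ⟨⟨h.1, h.2.1⟩, h.2.2⟩, fun h => ⟨h.1.1, h.1.2, h.2⟩⟩
  rwa [e]

variable [IsManifold (𝓡∂ d) ∞ M]

instance : IsManifold (𝓡∂ d) 1 M := IsManifold.of_le (n := ∞) (by norm_num)

lemma mem_interiorSet_iff {a x : M} (hx : x ∈ (extChartAt (𝓡∂ d) a).source) :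
    x ∈ interiorSet d M ↔ extChartAt (𝓡∂ d) a x ∈ interior (halfSpace d) := by
  rw [extChartAt_source] at hx
  have h := (𝓡∂ d).isInteriorPoint_iff_of_mem_atlas (n := 1) one_ne_zero
    (chart_mem_atlas (EuclideanHalfSpace d) a) hx
  refine h.trans ⟨fun h => ?_, fun h => ?_⟩
  · exact interior_mono (OpenPartialHomeomorph.extend_target_subset_range _) h
  · exact (chartAt (EuclideanHalfSpace d) a).mem_interior_extend_target
      (by simpa using (chartAt (EuclideanHalfSpace d) a).map_source hx) h

lemma symm_mem_interiorSet_iff {a : M} {z : EuclideanSpace ℝ (Fin d)}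
    (hz : z ∈ (extChartAt (𝓡∂ d) a).target) :
    (extChartAt (𝓡∂ d) a).symm z ∈ interiorSet d M ↔ z ∈ interior (halfSpace d) := by
  rw [mem_interiorSet_iff ((extChartAt (𝓡∂ d) a).map_target hz),
    (extChartAt (𝓡∂ d) a).right_inv hz]

lemma mem_boundarySet_iff {a x : M} (hx : x ∈ (extChartAt (𝓡∂ d) a).source) :
    x ∈ boundarySet d M ↔ extChartAt (𝓡∂ d) a x 0 = 0 := by
  have h1 : x ∈ boundarySet d M ↔ x ∉ interiorSet d M := by
    rw [boundarySet, ← ModelWithCorners.compl_interior]; rfl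
  have h2 : 0 ≤ extChartAt (𝓡∂ d) a x 0 :=
    mem_halfSpace.1 (extChartAt_target_subset_range a ((extChartAt (𝓡∂ d) a).map_source hx))
  rw [h1, mem_interiorSet_iff hx, mem_interior_halfSpace, not_lt]
  exact ⟨fun h => le_antisymm h h2, fun h => h.le⟩

omit [IsManifold (𝓡∂ d) ∞ M] in
lemma trans_self_mem {a b : M} {z : EuclideanSpace ℝ (Fin d)} (hz : z ∈ overlap d a b) :
    (extChartAt (𝓡∂ d) b).symm (trans d a b z) = (extChartAt (𝓡∂ d) a).symm z :=
  (extChartAt (𝓡∂ d) b).left_inv hz.2.2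

lemma trans_mem_overlap {a b : M} {z : EuclideanSpace ℝ (Fin d)} (hz : z ∈ overlap d a b) :
    trans d a b z ∈ overlap d b a := by
  refine ⟨(extChartAt (𝓡∂ d) b).map_source hz.2.2, ?_, ?_⟩
  · exact (mem_interiorSet_iff hz.2.2).1 ((symm_mem_interiorSet_iff hz.1).2 hz.2.1)
  · rw [trans_self_mem hz]
    exact (extChartAt (𝓡∂ d) a).map_target hz.1

omit [IsManifold (𝓡∂ d) ∞ M] in
lemma trans_trans {a b : M} {z : EuclideanSpace ℝ (Fin d)} (hz : z ∈ overlap d a b) :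
    trans d b a (trans d a b z) = z := by
  change extChartAt (𝓡∂ d) a ((extChartAt (𝓡∂ d) b).symm (trans d a b z)) = z
  rw [trans_self_mem hz, (extChartAt (𝓡∂ d) a).right_inv hz.1]

lemma contDiffAt_trans {a b : M} {z : EuclideanSpace ℝ (Fin d)} (hz : z ∈ overlap d a b) :
    ContDiffAt ℝ ∞ (trans d a b) z := by
  have h := contDiffWithinAt_ext_coord_change (I := 𝓡∂ d) (n := ∞) b a (y := z) (by
    rw [PartialEquiv.trans_source, PartialEquiv.symm_source]
    exact ⟨hz.1, hz.2.2⟩)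
  exact h.contDiffAt (mem_interior_iff_mem_nhds.1 hz.2.1)

lemma fderiv_trans_comp {a b : M} {z : EuclideanSpace ℝ (Fin d)} (hz : z ∈ overlap d a b) :
    (fderiv ℝ (trans d b a) (trans d a b z)).comp (fderiv ℝ (trans d a b) z)
      = ContinuousLinearMap.id ℝ _ := by
  have h1 := (contDiffAt_trans hz).differentiableAt (by norm_num)
  have h2 := (contDiffAt_trans (trans_mem_overlap hz)).differentiableAt (by norm_num)
  rw [← fderiv_comp z h2 h1]
  have : trans d b a ∘ trans d a b =ᶠ[𝓝 z] id := by
    filter_upwards [(isOpen_overlap a b).mem_nhds hz] with x hx using trans_trans hx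
  rw [this.fderiv_eq, fderiv_id]

lemma fderiv_trans_comp' {a b : M} {z : EuclideanSpace ℝ (Fin d)} (hz : z ∈ overlap d a b) :
    (fderiv ℝ (trans d a b) z).comp (fderiv ℝ (trans d b a) (trans d a b z))
      = ContinuousLinearMap.id ℝ _ := by
  have h := fderiv_trans_comp (trans_mem_overlap hz)
  rwa [trans_trans hz] at h

lemma surjective_fderiv_trans {a b : M} {z : EuclideanSpace ℝ (Fin d)} (hz : z ∈ overlap d a b) :
    Function.Surjective (fderiv ℝ (trans d a b) z) := fun y =>
  ⟨_, DFunLike.congr_fun (fderiv_trans_comp' hz) y⟩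

lemma isUnit_det_fderiv_trans {a b : M} {z : EuclideanSpace ℝ (Fin d)} (hz : z ∈ overlap d a b) :
    IsUnit (matOf (fderiv ℝ (trans d a b) z)).det := isUnit_det_matOf (fderiv_trans_comp' hz)

lemma frame_self (x : M) : frame d x (extChartAt (𝓡∂ d) x x) = ContinuousLinearMap.id ℝ _ :=
  mfderivWithin_range_extChartAt_symm (I := 𝓡∂ d) (x := x)

/-- The coordinate frames of two charts differ by the differential of the change of coordinates. -/
lemma frame_trans {a b : M} {z : EuclideanSpace ℝ (Fin d)} (hz : z ∈ overlap d a b) :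
    frame d a z = (frame d b (trans d a b z)).comp (fderiv ℝ (trans d a b) z) := by
  have hy : (extChartAt (𝓡∂ d) a).symm z ∈ (extChartAt (𝓡∂ d) b).source := hz.2.2
  have hU : UniqueMDiffWithinAt 𝓘(ℝ, EuclideanSpace ℝ (Fin d)) (range (𝓡∂ d)) z :=
    (𝓡∂ d).uniqueMDiffOn _ (interior_subset hz.2.1)
  have h1 : (mfderiv (𝓡∂ d) 𝓘(ℝ, EuclideanSpace ℝ (Fin d)) (extChartAt (𝓡∂ d) b)
      ((extChartAt (𝓡∂ d) a).symm z)).comp (mfderivWithin 𝓘(ℝ, EuclideanSpace ℝ (Fin d)) (𝓡∂ d)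
        (extChartAt (𝓡∂ d) a).symm (range (𝓡∂ d)) z) = fderiv ℝ (trans d a b) z := by
    rw [← mfderiv_comp_mfderivWithin z (mdifferentiableAt_extChartAt
      (by rwa [← extChartAt_source (I := 𝓡∂ d)])) (mdifferentiableWithinAt_extChartAt_symm hz.1) hU,
      mfderivWithin_eq_fderivWithin]
    exact fderivWithin_of_mem_interior hz.2.1
  have h2 := mfderivWithin_extChartAt_symm_comp_mfderiv_extChartAt' (I := 𝓡∂ d) hy
  rw [← h1]
  change _ = ContinuousLinearMap.comp (ContinuousLinearMap.comp (frame d b (trans d a b z)) _) _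
  have h3 : (frame d b (trans d a b z)).comp (mfderiv (𝓡∂ d) 𝓘(ℝ, EuclideanSpace ℝ (Fin d))
      (extChartAt (𝓡∂ d) b) ((extChartAt (𝓡∂ d) a).symm z)) = ContinuousLinearMap.id ℝ _ := h2
  rw [h3]
  rfl

lemma isInvertible_frame {a : M} {z : EuclideanSpace ℝ (Fin d)}
    (hz : z ∈ (extChartAt (𝓡∂ d) a).target) : (frame d a z).IsInvertible :=
  isInvertible_mfderivWithin_extChartAt_symm (I := 𝓡∂ d) hz

end Charts

/-! ### Metrics in charts -/

section MetricInCharts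

/-- A bilinear form on a finite-dimensional space as a continuous bilinear form. -/
def toBil {E : Type*} [NormedAddCommGroup E] [NormedSpace ℝ E] [FiniteDimensional ℝ E]
    (b : E →ₗ[ℝ] E →ₗ[ℝ] ℝ) : Bil E :=
  LinearMap.toContinuousLinearMap
    ((LinearMap.toContinuousLinearMap : (E →ₗ[ℝ] ℝ) ≃ₗ[ℝ] (E →L[ℝ] ℝ)).toLinearMap ∘ₗ b)

variable {d : ℕ} [NeZero d] {M : Type*} [TopologicalSpace M]
  [ChartedSpace (EuclideanHalfSpace d) M]

/-- The bilinear form `g x`, read in the coordinate frame at `x` of the chart at `x`. -/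
def atPoint (g : MetricField d M) (x : M) : Bil (EuclideanSpace ℝ (Fin d)) :=
  toBil (E := EuclideanSpace ℝ (Fin d)) (g x)

/-- The metric `g` in the chart at `a`, as a function of the coordinates. -/
def chartBil (g : MetricField d M) (a : M) (z : EuclideanSpace ℝ (Fin d)) :
    Bil (EuclideanSpace ℝ (Fin d)) :=
  pullBil (atPoint g ((extChartAt (𝓡∂ d) a).symm z)) (frame d a z)

lemma chartBil_apply (g : MetricField d M) (a : M) (z v w : EuclideanSpace ℝ (Fin d)) :
    chartBil g a z v w
      = atPoint g ((extChartAt (𝓡∂ d) a).symm z) (frame d a z v) (frame d a z w) := rfl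

lemma isMatrixOf_metricInChart (g : MetricField d M) (a : M) :
    IsMatrixOf (metricInChart g a) (chartBil g a) := fun _ _ _ => rfl

lemma contDiffAt_pullBil {F E E' : Type*} [NormedAddCommGroup E] [NormedSpace ℝ E]
    [NormedAddCommGroup E'] [NormedSpace ℝ E'] [NormedAddCommGroup F] [NormedSpace ℝ F]
    {m : WithTop ℕ∞} {z : F} {s : Set F} {G : F → Bil E'} {L : F → E →L[ℝ] E'}
    (hG : ContDiffWithinAt ℝ m G s z)
    (hL : ContDiffWithinAt ℝ m L s z) : ContDiffWithinAt ℝ m (fun x => pullBil (G x) (L x)) s z := by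
  have h1 : ContDiffWithinAt ℝ m (fun x => ((G x).comp (L x)).flip) s z :=
    (ContinuousLinearMap.flipₗᵢ ℝ E E' ℝ).contDiff.contDiffAt.comp_contDiffWithinAt z
      (hG.clm_comp hL)
  exact (ContinuousLinearMap.flipₗᵢ ℝ E E ℝ).contDiff.contDiffAt.comp_contDiffWithinAt z
      (h1.clm_comp hL)

lemma IsInner.pullBil {E E' : Type*} [NormedAddCommGroup E] [NormedSpace ℝ E]
    [NormedAddCommGroup E'] [NormedSpace ℝ E'] {G : Bil E'} (hG : IsInner G) {L : E →L[ℝ] E'}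
    (hL : Function.Injective L) : IsInner (pullBil G L) where
  symm _ _ := hG.symm _ _
  pos _ hv := hG.pos _ fun h => hv (hL (h.trans (map_zero L).symm))

variable [IsManifold (𝓡∂ d) ∞ M]

lemma chartBil_self (g : MetricField d M) (x : M) :
    chartBil g x (extChartAt (𝓡∂ d) x x) = atPoint g x := by
  have h : (extChartAt (𝓡∂ d) x).symm (extChartAt (𝓡∂ d) x x) = x := extChartAt_to_inv x
  ext1 v
  ext1 w
  rw [chartBil_apply, frame_self, h]
  rfl

/-- The transformation law of a metric. -/
lemma chartBil_trans (g : MetricField d M) {a b : M} {z : EuclideanSpace ℝ (Fin d)}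
    (hz : z ∈ overlap d a b) :
    chartBil g a z = pullBil (chartBil g b (trans d a b z)) (fderiv ℝ (trans d a b) z) := by
  ext1 v
  ext1 w
  rw [chartBil_apply, frame_trans hz, ← trans_self_mem hz]
  rfl

/-- A Riemannian metric as a field of bilinear forms. -/
def metricFieldOf {m : WithTop ℕ∞} (gb : Bundle.ContMDiffRiemannianMetric (𝓡∂ d) m
    (EuclideanSpace ℝ (Fin d)) (fun x : M => TangentSpace (𝓡∂ d) x)) : MetricField d M := fun x =>
  LinearMap.mk₂ ℝ (fun v w => gb.inner x v w) (by simp) (by simp) (by simp) (by simp)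

lemma isInner_chartBil {m : WithTop ℕ∞} (gb : Bundle.ContMDiffRiemannianMetric (𝓡∂ d) m
    (EuclideanSpace ℝ (Fin d)) (fun x : M => TangentSpace (𝓡∂ d) x)) {a : M}
    {z : EuclideanSpace ℝ (Fin d)} (hz : z ∈ (extChartAt (𝓡∂ d) a).target) :
    IsInner (chartBil (metricFieldOf gb) a z) :=
  IsInner.pullBil ⟨gb.symm _, gb.pos _⟩ (isInvertible_frame hz).injective

lemma contDiffWithinAt_chartBil {m : WithTop ℕ∞} (gb : Bundle.ContMDiffRiemannianMetric (𝓡∂ d) m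
    (EuclideanSpace ℝ (Fin d)) (fun x : M => TangentSpace (𝓡∂ d) x)) (a : M) :
    ContDiffWithinAt ℝ m (chartBil (metricFieldOf gb) a) (halfSpace d)
      (extChartAt (𝓡∂ d) a a) := by
  have h := (Bundle.contMDiffAt_section a).1 (gb.contMDiff a)
  rw [contMDiffAt_iff] at h
  have key : ∀ z ∈ (extChartAt (𝓡∂ d) a).target, chartBil (metricFieldOf gb) a z
      = (trivializationAt (Bil (EuclideanSpace ℝ (Fin d)))
        (fun x : M => TangentSpace (𝓡∂ d) x →L[ℝ] TangentSpace (𝓡∂ d) x →L[ℝ] ℝ) a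
        ⟨(extChartAt (𝓡∂ d) a).symm z, gb.inner ((extChartAt (𝓡∂ d) a).symm z)⟩).2 := by
    intro z hz
    set x := (extChartAt (𝓡∂ d) a).symm z with hx
    have hxs : x ∈ (chartAt (EuclideanHalfSpace d) a).source := by
      rw [← extChartAt_source (𝓡∂ d)]; exact (extChartAt (𝓡∂ d) a).map_target hz
    have hb : x ∈ (trivializationAt (EuclideanSpace ℝ (Fin d)) (TangentSpace (𝓡∂ d)) a).baseSet :=
      hxs
    have hfr : frame d a z = (trivializationAt (EuclideanSpace ℝ (Fin d))
        (TangentSpace (𝓡∂ d)) a).symmL ℝ x := by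
      rw [TangentBundle.symmL_trivializationAt hxs, hx, (extChartAt (𝓡∂ d) a).right_inv hz]
      rfl
    ext1 v
    ext1 w
    rw [hom_trivializationAt_apply]
    dsimp only
    rw [inCoordinates_apply_eq₂ hb hb (by simp)]
    refine Eq.trans ?_ (LinearMap.congr_fun
      (Bundle.Trivial.linearMapAt_trivialization ℝ M ℝ x) _).symm
    rw [chartBil_apply, hfr]
    have hs : ∀ u, (trivializationAt (EuclideanSpace ℝ (Fin d)) (TangentSpace (𝓡∂ d)) a).symmL ℝ x u
        = (trivializationAt (EuclideanSpace ℝ (Fin d)) (TangentSpace (𝓡∂ d)) a).symm x u :=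
      fun u => Bundle.Trivialization.symmL_apply _ hb u
    erw [hs v, hs w]
    rfl
  have h2 : ContDiffWithinAt ℝ m _ (halfSpace d) (extChartAt (𝓡∂ d) a a) := h.2
  refine h2.congr_of_eventuallyEq ?_ (key _ (mem_extChartAt_target a))
  filter_upwards [extChartAt_target_mem_nhdsWithin (I := 𝓡∂ d) a] with z hz using key z hz

end MetricInCharts

/-! ### Conformally compact metrics near a boundary point -/

lemma natCast_le_infty (n : ℕ) : (n : WithTop ℕ∞) ≤ ∞ := by exact_mod_cast le_top

section BoundaryPoint

variable {d : ℕ} [NeZero d] {M : Type*} [TopologicalSpace M]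
  [ChartedSpace (EuclideanHalfSpace d) M] [IsManifold (𝓡∂ d) ∞ M]

/-- The function `r` in the chart at `a`. -/
def inChart (d : ℕ) [NeZero d] {M : Type*} [TopologicalSpace M]
    [ChartedSpace (EuclideanHalfSpace d) M] (r : M → ℝ) (a : M) :
    EuclideanSpace ℝ (Fin d) → ℝ := r ∘ (extChartAt (𝓡∂ d) a).symm

omit [IsManifold (𝓡∂ d) ∞ M] in
lemma contDiffWithinAt_inChart {r : M → ℝ} {m : WithTop ℕ∞}
    (hr : ContMDiff (𝓡∂ d) 𝓘(ℝ, ℝ) m r) (a : M) :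
    ContDiffWithinAt ℝ m (inChart d r a) (halfSpace d) (extChartAt (𝓡∂ d) a a) :=
  (contMDiffAt_iff.1 (hr a)).2

/-- `gb` is the extension of `r² g` to the closed manifold. -/
def IsExtension {m : WithTop ℕ∞} (g : MetricField d M) (r : M → ℝ)
    (gb : Bundle.ContMDiffRiemannianMetric (𝓡∂ d) m
    (EuclideanSpace ℝ (Fin d)) (fun x : M => TangentSpace (𝓡∂ d) x)) : Prop :=
  ∀ x ∈ interiorSet d M, ∀ v w : TangentSpace (𝓡∂ d) x, gb.inner x v w = r x ^ 2 * g x v w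

variable {m : WithTop ℕ∞} {g : MetricField d M} {r : M → ℝ}
  {gb : Bundle.ContMDiffRiemannianMetric (𝓡∂ d) m
    (EuclideanSpace ℝ (Fin d)) (fun x : M => TangentSpace (𝓡∂ d) x)}

lemma inChart_pos (hr : IsDefiningFunction d r) {a : M} {z : EuclideanSpace ℝ (Fin d)}
    (hz : z ∈ (extChartAt (𝓡∂ d) a).target ∩ interior (halfSpace d)) : 0 < inChart d r a z :=
  hr.pos _ ((symm_mem_interiorSet_iff hz.1).2 hz.2)

lemma chartBil_eq (hr : IsDefiningFunction d r) (hg : IsExtension g r gb) {a : M}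
    {z : EuclideanSpace ℝ (Fin d)}
    (hz : z ∈ (extChartAt (𝓡∂ d) a).target ∩ interior (halfSpace d)) :
    chartBil g a z = (inChart d r a z ^ 2)⁻¹ • chartBil (metricFieldOf gb) a z := by
  have h0 := inChart_pos hr hz
  ext1 v
  ext1 w
  have h1 := hg _ ((symm_mem_interiorSet_iff hz.1).2 hz.2) (frame d a z v) (frame d a z w)
  change _ = (inChart d r a z ^ 2)⁻¹ * _
  rw [eq_inv_mul_iff_mul_eq₀ (by positivity)]
  exact h1.symm

lemma chartBil_eventuallyEq (hr : IsDefiningFunction d r) (hg : IsExtension g r gb) {a : M}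
    {z : EuclideanSpace ℝ (Fin d)}
    (hz : z ∈ (extChartAt (𝓡∂ d) a).target ∩ interior (halfSpace d)) :
    chartBil g a =ᶠ[𝓝 z]
      fun x => (inChart d r a x ^ 2)⁻¹ • chartBil (metricFieldOf gb) a x := by
  filter_upwards [(isOpen_target_inter_interior a).mem_nhds hz] with x hx using chartBil_eq hr hg hx

omit [IsManifold (𝓡∂ d) ∞ M] in
lemma eventually_mem_target (a : M) :
    ∀ᶠ z in 𝓝[interior (halfSpace d)] (extChartAt (𝓡∂ d) a a),
      z ∈ (extChartAt (𝓡∂ d) a).target ∩ interior (halfSpace d) := by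
  filter_upwards [nhdsWithin_mono _ interior_subset
    (extChartAt_target_mem_nhdsWithin (I := 𝓡∂ d) a), self_mem_nhdsWithin] with z h1 h2 using ⟨h1, h2⟩

lemma isInner_chartBil_of_interior (hr : IsDefiningFunction d r) (hg : IsExtension g r gb) {a : M}
    {z : EuclideanSpace ℝ (Fin d)}
    (hz : z ∈ (extChartAt (𝓡∂ d) a).target ∩ interior (halfSpace d)) :
    IsInner (chartBil g a z) := by
  rw [chartBil_eq hr hg hz]
  have := inChart_pos hr hz
  exact (isInner_chartBil gb hz.1).smul (by positivity)

lemma eventually_contDiffAt_chartBil {n : ℕ} (hr : IsDefiningFunction d r)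
    (hg : IsExtension g r gb) (hn : (n : WithTop ℕ∞) ≤ m) (a : M) :
    ∀ᶠ z in 𝓝[interior (halfSpace d)] (extChartAt (𝓡∂ d) a a),
      ContDiffAt ℝ n (chartBil g a) z := by
  filter_upwards [((contDiffWithinAt_chartBil gb a).of_le hn).eventually_contDiffAt
      (extChartAt_target_subset_range a (mem_extChartAt_target a)),
    ((contDiffWithinAt_inChart hr.smooth a).of_le
      (natCast_le_infty n)).eventually_contDiffAt
      (extChartAt_target_subset_range a (mem_extChartAt_target a)),
    eventually_mem_target a] with z h1 h2 h3
  have h0 := inChart_pos hr h3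
  refine ContDiffAt.congr_of_eventuallyEq ?_ (chartBil_eventuallyEq hr hg h3)
  exact ((h2.pow 2).inv (by positivity)).smul h1

lemma tendsto_symm_nearBoundary {a : M} (ha : a ∈ boundarySet d M) :
    Tendsto (extChartAt (𝓡∂ d) a).symm (𝓝[interior (halfSpace d)] (extChartAt (𝓡∂ d) a a))
      (nearBoundary d M) := by
  refine tendsto_inf.2 ⟨?_, tendsto_principal.2 ?_⟩
  · have h := (continuousAt_extChartAt_symm'' (I := 𝓡∂ d) (mem_extChartAt_target a)).mono_left
      (nhdsWithin_le_nhds (s := interior (halfSpace d)))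
    rw [extChartAt_to_inv] at h
    exact h.mono_right (nhds_le_nhdsSet ha)
  · filter_upwards [eventually_mem_target a] with z hz
    exact (symm_mem_interiorSet_iff hz.1).2 hz.2

omit [IsManifold (𝓡∂ d) ∞ M] in
instance neBot_interior (a : M) :
    (𝓝[interior (halfSpace d)] (extChartAt (𝓡∂ d) a a)).NeBot := by
  rw [← mem_closure_iff_nhdsWithin_neBot]
  have h := (𝓡∂ d).range_subset_closure_interior
  exact h (extChartAt_target_subset_range a (mem_extChartAt_target a))

omit [IsManifold (𝓡∂ d) ∞ M] in
/-- A point in the domain of the chart at `a`, in its own chart. -/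
lemma self_mem_overlap {a : M} {z : EuclideanSpace ℝ (Fin d)} [IsManifold (𝓡∂ d) ∞ M]
    (hz : z ∈ (extChartAt (𝓡∂ d) a).target ∩ interior (halfSpace d)) :
    let x := (extChartAt (𝓡∂ d) a).symm z
    extChartAt (𝓡∂ d) x x ∈ overlap d x a ∧ trans d x a (extChartAt (𝓡∂ d) x x) = z := by
  intro x
  refine ⟨⟨mem_extChartAt_target x, ?_, ?_⟩, ?_⟩
  · exact (mem_interiorSet_iff (mem_extChartAt_source x)).1 ((symm_mem_interiorSet_iff hz.1).2 hz.2)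
  · rw [extChartAt_to_inv]; exact (extChartAt (𝓡∂ d) a).map_target hz.1
  · simp only [trans, Function.comp_apply, extChartAt_to_inv]
    exact (extChartAt (𝓡∂ d) a).right_inv hz.1

/-- The sectional curvature, computed in the chart at `a`. -/
lemma sectionalCurvature_eq {a x : M} {z : EuclideanSpace ℝ (Fin d)}
    (hr : IsDefiningFunction d r) (hg : IsExtension g r gb)
    (hz : z ∈ (extChartAt (𝓡∂ d) a).target ∩ interior (halfSpace d))
    (hC : ContDiffAt ℝ 2 (chartBil g a) z) (hx : x = (extChartAt (𝓡∂ d) a).symm z)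
    (v w v' w' : EuclideanSpace ℝ (Fin d))
    (hv : fderiv ℝ (trans d x a) (extChartAt (𝓡∂ d) x x) v' = v)
    (hw : fderiv ℝ (trans d x a) (extChartAt (𝓡∂ d) x x) w' = w) :
    sectionalCurvature g x v' w'
      = chartBil g a z (riemC (fun x => chr (chartBil g a x) (fderiv ℝ (chartBil g a) x)) z v w w) v
        / (chartBil g a z v v * chartBil g a z w w - chartBil g a z v w ^ 2) := by
  obtain ⟨hx1, hx2⟩ := self_mem_overlap hz
  rw [← hx] at hx1 hx2
  set z' := extChartAt (𝓡∂ d) x x with hz'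
  set B := chartBil g a with hB
  set B' := chartBil g x with hB'
  have hopen := isOpen_overlap x a (d := d)
  have hφ : ∀ y ∈ overlap d x a, ContDiffAt ℝ ∞ (trans d x a) y := fun y hy => contDiffAt_trans hy
  have ev : B' =ᶠ[𝓝 z'] fun y => pullBil (B (trans d x a y)) (fderiv ℝ (trans d x a) y) := by
    filter_upwards [hopen.mem_nhds hx1] with y hy using chartBil_trans g hy
  have hC' : ContDiffAt ℝ 2 B' z' := by
    refine ContDiffAt.congr_of_eventuallyEq ?_ ev
    rw [← contDiffWithinAt_univ]
    refine contDiffAt_pullBil (ContDiffAt.contDiffWithinAt ?_) (ContDiffAt.contDiffWithinAt ?_)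
    · rw [← hx2] at hC
      exact hC.comp z' ((hφ z' hx1).of_le (natCast_le_infty 2))
    · exact (hφ z' hx1).fderiv_right (m := 2) (natCast_le_infty 3)
  have hin : ∀ᶠ y in 𝓝 z, IsInner (B y) := by
    filter_upwards [(isOpen_target_inter_interior a).mem_nhds hz] with y hy using
      isInner_chartBil_of_interior hr hg hy
  have hin' : ∀ᶠ y in 𝓝 z', IsInner (B' y) := by
    filter_upwards [hopen.mem_nhds hx1] with y hy using
      isInner_chartBil_of_interior hr hg ⟨hy.1, hy.2.1⟩
  have dchr {E : Type} [NormedAddCommGroup E] [NormedSpace ℝ E] [FiniteDimensional ℝ E]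
      {T : E → Bil E} {y : E} (h : ContDiffAt ℝ 2 T y) (hi : IsInner (T y)) :
      DifferentiableAt ℝ (fun y => chr (T y) (fderiv ℝ T y)) y := by
    have h1 : ContDiffWithinAt ℝ 1 (fderiv ℝ T) univ y :=
      (h.fderiv_right (m := 1) (by norm_num)).contDiffWithinAt
    have h2 := ContDiffWithinAt.chr (h.contDiffWithinAt.of_le (by norm_num)) h1 hi
    exact (contDiffWithinAt_univ.1 h2).differentiableAt (by norm_num)
  have htend : ContinuousAt (trans d x a) z' := (hφ z' hx1).continuousAt
  have hlaw : ∀ᶠ y in 𝓝 z', ∀ v w, fderiv ℝ (trans d x a) y (chr (B' y) (fderiv ℝ B' y) v w)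
      = fderiv ℝ (fderiv ℝ (trans d x a)) y v w
        + chr (B (trans d x a y)) (fderiv ℝ B (trans d x a y)) (fderiv ℝ (trans d x a) y v)
          (fderiv ℝ (trans d x a) y w) := by
    have e1 : ∀ᶠ y in 𝓝 z', ContDiffAt ℝ 2 B (trans d x a y) := by
      refine htend.eventually (p := fun y => ContDiffAt ℝ 2 B y) ?_
      rw [hx2]
      exact hC.eventually (by simp)
    have e2 : ∀ᶠ y in 𝓝 z', IsInner (B (trans d x a y)) := by
      refine htend.eventually (p := fun y => IsInner (B y)) ?_
      rwa [hx2]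
    filter_upwards [e1, e2, hin', hC'.eventually (by simp), ev.eventuallyEq_nhds,
      hopen.mem_nhds hx1] with y h1 h2 h3 h4 h5 h6 v w
    exact chr_change ((hφ y h6).of_le (natCast_le_infty 2)) (surjective_fderiv_trans h6)
      (h1.differentiableAt (by norm_num)) h2 h3 h5 (h4.differentiableAt (by norm_num)) v w
  have hR := riemC_change (Γ := fun y => chr (B y) (fderiv ℝ B y))
    (Γ' := fun y => chr (B' y) (fderiv ℝ B' y)) ((hφ z' hx1).of_le (natCast_le_infty 3))
    (by rw [hx2]; exact dchr hC hin.self_of_nhds) (dchr hC' hin'.self_of_nhds) hlaw v' w' w'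
  have hself : B' z' = atPoint g x := chartBil_self g x
  have e0 : ∀ a₁ a₂ : EuclideanSpace ℝ (Fin d), atPoint g x a₁ a₂
      = B z (fderiv ℝ (trans d x a) z' a₁) (fderiv ℝ (trans d x a) z' a₂) := fun a₁ a₂ => by
    rw [← hself, ev.self_of_nhds, ← hx2]; rfl
  have hnum := (isMatrixOf_metricInChart g x).sum_riemann_eq hC' hin' v' w'
  have hgram : ∀ l k, metricInChart g x z' l k = gram g x l k := fun l k => by
    rw [isMatrixOf_metricInChart g x z' l k, ← hB', hself]; rfl
  simp only [hgram] at hnum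
  have hrhs : B' z' (riemC (fun y => chr (B' y) (fderiv ℝ B' y)) z' v' w' w') v'
      = B z (riemC (fun y => chr (B y) (fderiv ℝ B y)) z v w w) v := by
    rw [hself, e0, hR, hv, hw, hx2]
  replace hnum := hnum.trans hrhs
  have f1 : g x v' v' = B z v v := (e0 v' v').trans (by rw [hv])
  have f2 : g x w' w' = B z w w := (e0 w' w').trans (by rw [hw])
  have f3 : g x v' w' = B z v w := (e0 v' w').trans (by rw [hv, hw])
  exact congrArg₂ (· / ·) hnum (congrArg₂ (· - ·) (congrArg₂ (· * ·) f1 f2) (congrArg (· ^ 2) f3))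

/-- At the boundary of an asymptotically hyperbolic manifold of dimension at least two, the
differential of the defining function has length one. -/
lemma inner_grad_of_hyperbolic {gb : Bundle.ContMDiffRiemannianMetric (𝓡∂ d) 3
    (EuclideanSpace ℝ (Fin d)) (fun x : M => TangentSpace (𝓡∂ d) x)} (hd : 2 ≤ d)
    (hr : IsDefiningFunction d r) (hg : IsExtension g r gb)
    (hK : HasAsymptoticSectionalCurvature g (-1)) {a : M} (ha : a ∈ boundarySet d M) :
    let G := chartBil (metricFieldOf gb) a (extChartAt (𝓡∂ d) a a)
    let η := fderivWithin ℝ (inChart d r a) (halfSpace d) (extChartAt (𝓡∂ d) a a)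
    G (grad G η) (grad G η) = 1 := by
  intro G η
  have hz₀ : extChartAt (𝓡∂ d) a a ∈ halfSpace d :=
    extChartAt_target_subset_range a (mem_extChartAt_target a)
  have hvw : LinearIndependent ℝ ![(ev ⟨0, by omega⟩ : EuclideanSpace ℝ (Fin d)), ev ⟨1, by omega⟩] := by
    rw [LinearIndependent.pair_iff]
    intro s t h
    have h0 := congrArg (fun x : EuclideanSpace ℝ (Fin d) => x ⟨0, by omega⟩) h
    have h1 := congrArg (fun x : EuclideanSpace ℝ (Fin d) => x ⟨1, by omega⟩) h
    simp at h0 h1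
    exact ⟨h0, h1⟩
  have hr0 : inChart d r a (extChartAt (𝓡∂ d) a a) = 0 := by
    simp only [inChart, Function.comp_apply, extChartAt_to_inv]
    exact hr.zero a ha
  have hmem := eventually_mem_target a (d := d)
  have lim := tendsto_sectional_conformal uniqueDiffOn_halfSpace hz₀ (B := chartBil g a)
    ((contDiffWithinAt_chartBil gb a).of_le (by norm_num))
    ((contDiffWithinAt_inChart hr.smooth a).of_le (natCast_le_infty 2))
    (by filter_upwards [extChartAt_target_mem_nhdsWithin (I := 𝓡∂ d) a] with z hz using
      isInner_chartBil gb hz) hr0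
    (by filter_upwards [hmem] with z hz using
      ⟨inChart_pos hr hz, chartBil_eventuallyEq hr hg hz⟩) hvw
  -- the curvature of a coordinate plane has the limits `-|dr|²` and `-1`
  suffices h : -(G (grad G η) (grad G η)) = -1 by linarith
  refine tendsto_nhds_unique lim (Metric.tendsto_nhds.2 fun ε hε => ?_)
  filter_upwards [(tendsto_symm_nearBoundary ha).eventually (hK ε hε), hmem,
    eventually_contDiffAt_chartBil (n := 2) hr hg (by norm_num) a] with z h1 hz hC
  obtain ⟨hx1, hx2⟩ := self_mem_overlap hz
  obtain ⟨v', hv'⟩ := surjective_fderiv_trans hx1 (ev ⟨0, by omega⟩)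
  obtain ⟨w', hw'⟩ := surjective_fderiv_trans hx1 (ev ⟨1, by omega⟩)
  have hind : LinearIndependent ℝ ![v', w'] := by
    rw [LinearIndependent.pair_iff] at hvw ⊢
    intro s t h
    refine hvw s t ?_
    rw [← hv', ← hw', ← map_smul, ← map_smul, ← map_add, h, map_zero]
  rw [← sectionalCurvature_eq hr hg hz hC rfl _ _ v' w' hv' hw', Real.dist_eq]
  exact h1 v' w' hind

end BoundaryPoint

/-! ### The mean curvature near a boundary point -/

section Submanifold

variable {d e : ℕ} [NeZero d] [NeZero e]
  {X : Type*} [TopologicalSpace X] [ChartedSpace (EuclideanHalfSpace d) X]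
  {Y : Type*} [TopologicalSpace Y] [ChartedSpace (EuclideanHalfSpace e) Y] {ι : Y → X}

lemma contDiffWithinAt_coordMap {m : WithTop ℕ∞} (hι : ContMDiff (𝓡∂ e) (𝓡∂ d) m ι) (y : Y) :
    ContDiffWithinAt ℝ m (coordMap d e ι y) (halfSpace e) (extChartAt (𝓡∂ e) y y) :=
  (contMDiffAt_iff.1 (hι y)).2

lemma coordMap_self (y : Y) :
    coordMap d e ι y (extChartAt (𝓡∂ e) y y) = extChartAt (𝓡∂ d) (ι y) (ι y) := by
  simp only [coordMap, writtenInExtChartAt, Function.comp_apply, extChartAt_to_inv]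

/-- The differential of `ι` at `y`, in the coordinate frames at `y` and `ι y`. -/
lemma tangentMap_eq (hι : ContMDiff (𝓡∂ e) (𝓡∂ d) 2 ι) (y : Y) (v : EuclideanSpace ℝ (Fin e)) :
    tangentMap d e ι y v
      = fderivWithin ℝ (coordMap d e ι y) (halfSpace e) (extChartAt (𝓡∂ e) y y) v := by
  have h : MDifferentiableAt (𝓡∂ e) (𝓡∂ d) ι y := (hι y).mdifferentiableAt (by norm_num)
  have h2 := h.mfderiv
  change mfderiv (𝓡∂ e) (𝓡∂ d) ι y v = _
  rw [h2]
  rfl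

lemma ambientHessian_eq (g : MetricField d X) (y : Y)
    (hF : ContDiffAt ℝ 2 (coordMap d e ι y) (extChartAt (𝓡∂ e) y y))
    (hB : DifferentiableAt ℝ (chartBil g (ι y)) (extChartAt (𝓡∂ d) (ι y) (ι y)))
    (hi : IsInner (chartBil g (ι y) (extChartAt (𝓡∂ d) (ι y) (ι y)))) (α β : Fin e) :
    (ambientHessian g ι y α β : EuclideanSpace ℝ (Fin d))
      = hessMap (chartBil g (ι y)) (coordMap d e ι y) (extChartAt (𝓡∂ e) y y) (ev α) (ev β) := by
  set F := coordMap d e ι y with hFdef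
  set z := extChartAt (𝓡∂ e) y y with hz
  have hFz : F z = extChartAt (𝓡∂ d) (ι y) (ι y) := coordMap_self y
  have hF1 : DifferentiableAt ℝ (fderiv ℝ F) z :=
    (hF.fderiv_right (m := 1) (by norm_num)).differentiableAt (by norm_num)
  have p1 : ∀ w, DifferentiableAt ℝ F w → ∀ (γ : Fin e) (a : Fin d),
      pd γ (fun z => F z a) w = fderiv ℝ F w (ev γ) a := by
    intro w hw γ a
    have := ((EuclideanSpace.proj (𝕜 := ℝ) a).hasFDerivAt.comp w hw.hasFDerivAt).fderiv
    exact DFunLike.congr_fun this (ev γ)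
  have p2 : ∀ a : Fin d, pd α (pd β (fun z => F z a)) z = fderiv ℝ (fderiv ℝ F) z (ev α) (ev β) a := by
    intro a
    have e1 : pd β (fun z => F z a) =ᶠ[𝓝 z]
        fun w => EuclideanSpace.proj (𝕜 := ℝ) a (fderiv ℝ F w (ev β)) := by
      filter_upwards [hF.eventually (by simp)] with w hw using
        p1 w (hw.differentiableAt (by norm_num)) β a
    rw [pd, e1.fderiv_eq]
    have d1 : DifferentiableAt ℝ (fun w => fderiv ℝ F w (ev β)) z :=
      hF1.clm_apply (differentiableAt_const _)
    have := ((EuclideanSpace.proj (𝕜 := ℝ) a).hasFDerivAt.comp z d1.hasFDerivAt).fderiv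
    simp only [Function.comp_def] at this
    rw [this, ContinuousLinearMap.comp_apply, fderiv_clm_apply hF1 (differentiableAt_const _)]
    simp [ev]
  have hF0 : DifferentiableAt ℝ F z := hF.differentiableAt (by norm_num)
  refine PiLp.ext (x := (ambientHessian g ι y α β : EuclideanSpace ℝ (Fin d))) fun a => ?_
  rw [hessMap_apply, hFz]
  refine congrArg₂ (· + ·) (p2 a) ?_
  set Γ := chr (chartBil g (ι y) (extChartAt (𝓡∂ d) (ι y) (ι y)))
    (fderiv ℝ (chartBil g (ι y)) (extChartAt (𝓡∂ d) (ι y) (ι y))) with hΓ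
  have hsum : ∀ u v : EuclideanSpace ℝ (Fin d), (Γ u v) a = ∑ b, ∑ c,
      christoffel (metricInChart g (ι y)) a b c (extChartAt (𝓡∂ d) (ι y) (ι y)) * u b * v c := by
    intro u v
    conv_lhs => rw [euclid_expand u, euclid_expand v]
    simp only [(isMatrixOf_metricInChart g (ι y)).christoffel_eq hB hi, ← hΓ]
    simp only [map_sum, map_smul, FunLike.coe_sum, Finset.sum_apply, smul_apply, WithLp.ofLp_sum,
      WithLp.ofLp_smul, Pi.smul_apply, smul_eq_mul, Finset.mul_sum]
    rw [Finset.sum_comm]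
    refine Finset.sum_congr rfl fun b _ => Finset.sum_congr rfl fun c _ => ?_
    ring
  refine Eq.trans ?_ (hsum _ _).symm
  refine Finset.sum_congr rfl fun b _ => Finset.sum_congr rfl fun c _ => ?_
  change _ * pd α (fun z => F z b) z * pd β (fun z => F z c) z = _
  rw [p1 z hF0, p1 z hF0]

lemma gram_pullback_eq (g : MetricField d X) (hι : ContMDiff (𝓡∂ e) (𝓡∂ d) 2 ι) (y : Y) :
    gram (pullback ι g : MetricField e Y) y = gramOf (atPoint g (ι y))
      (fderivWithin ℝ (coordMap d e ι y) (halfSpace e) (extChartAt (𝓡∂ e) y y)) := by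
  ext α β
  exact congrArg₂ (fun u v => atPoint g (ι y) u v) (tangentMap_eq hι y (ev α))
    (tangentMap_eq hι y (ev β))

variable [IsManifold (𝓡∂ d) ∞ X] [IsManifold (𝓡∂ e) ∞ Y]

/-- The squared mean curvature at `y`, in the charts at `y` and `ι y`. -/
lemma meanCurvature_sq_eq (g : MetricField d X) (hι : ContMDiff (𝓡∂ e) (𝓡∂ d) 2 ι) {y : Y}
    (hy : y ∈ interiorSet e Y)
    (hB : DifferentiableAt ℝ (chartBil g (ι y)) (extChartAt (𝓡∂ d) (ι y) (ι y)))
    (hi : IsInner (chartBil g (ι y) (extChartAt (𝓡∂ d) (ι y) (ι y)))) :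
    g (ι y) (meanCurvature (e := e) g ι y) (meanCurvature (e := e) g ι y)
      = mcSq (chartBil g (ι y)) (coordMap d e ι y) (extChartAt (𝓡∂ e) y y) := by
  have hz : extChartAt (𝓡∂ e) y y ∈ interior (halfSpace e) :=
    (mem_interiorSet_iff (mem_extChartAt_source y)).1 hy
  have hF : ContDiffAt ℝ 2 (coordMap d e ι y) (extChartAt (𝓡∂ e) y y) :=
    (contDiffWithinAt_coordMap hι y).contDiffAt (mem_interior_iff_mem_nhds.1 hz)
  have hL := fderivWithin_of_mem_interior (f := coordMap d e ι y) hz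
  have hgram := gram_pullback_eq g hι y
  rw [hL] at hgram
  have hproj : ∀ v : EuclideanSpace ℝ (Fin d), normalProj (e := e) g ι y v
      = nproj (atPoint g (ι y)) (fderiv ℝ (coordMap d e ι y) (extChartAt (𝓡∂ e) y y)) v := by
    intro v
    refine congrArg (fun x : EuclideanSpace ℝ (Fin d) => v - x) ?_
    refine Finset.sum_congr rfl fun α _ => Finset.sum_congr rfl fun β _ => ?_
    rw [hgram]
    have h1 := tangentMap_eq hι y (ev α)
    have h2 := tangentMap_eq hι y (ev β)
    rw [hL] at h1 h2
    rw [← mul_smul]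
    exact congrArg₂ (fun u w : EuclideanSpace ℝ (Fin d) =>
      ((gramOf (atPoint g (ι y)) (fderiv ℝ (coordMap d e ι y) (extChartAt (𝓡∂ e) y y)))⁻¹ α β
        * atPoint g (ι y) v u) • w) h1 h2
  have hH : (meanCurvature (e := e) g ι y : EuclideanSpace ℝ (Fin d))
      = mcv (atPoint g (ι y)) (fderiv ℝ (coordMap d e ι y) (extChartAt (𝓡∂ e) y y)) fun u v =>
        hessMap (chartBil g (ι y)) (coordMap d e ι y) (extChartAt (𝓡∂ e) y y) u v := by
    refine Finset.sum_congr rfl fun α _ => Finset.sum_congr rfl fun β _ => ?_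
    rw [hgram]
    exact congrArg (fun w : EuclideanSpace ℝ (Fin d) => (gramOf (atPoint g (ι y)) (fderiv ℝ
      (coordMap d e ι y) (extChartAt (𝓡∂ e) y y)))⁻¹ α β • w) ((hproj _).trans (congrArg (nproj (E := EuclideanSpace ℝ (Fin d)) _ _)
        (ambientHessian_eq g y hF hB hi α β)))
  rw [mcSq, coordMap_self, chartBil_self]
  exact congrArg₂ (fun u v => atPoint g (ι y) u v) hH hH

/-- Along the interior of the chart at `a`, the expressions of `ι` in the charts at `y` and `ι y` and
in the charts at `a` and `ι a` have the same mean curvature. -/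
lemma meanCurvature_sq_eq_mcSq {m : WithTop ℕ∞} {g : MetricField d X} {r : X → ℝ}
    {gb : Bundle.ContMDiffRiemannianMetric (𝓡∂ d) m
      (EuclideanSpace ℝ (Fin d)) (fun x : X => TangentSpace (𝓡∂ d) x)}
    (hr : IsDefiningFunction d r) (hg : IsExtension g r gb)
    (hι : ContMDiff (𝓡∂ e) (𝓡∂ d) 2 ι) (hint : MapsTo ι (interiorSet e Y) (interiorSet d X))
    {a y : Y} {z : EuclideanSpace ℝ (Fin e)}
    (hz : z ∈ (extChartAt (𝓡∂ e) a).target ∩ interior (halfSpace e))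
    (hy : y = (extChartAt (𝓡∂ e) a).symm z) (hs : ι y ∈ (extChartAt (𝓡∂ d) (ι a)).source)
    (hF : ContDiffAt ℝ 2 (coordMap d e ι a) z)
    (hinj : Function.Injective (fderiv ℝ (coordMap d e ι a) z))
    (hB : ContDiffAt ℝ 1 (chartBil g (ι a)) (coordMap d e ι a z)) :
    g (ι y) (meanCurvature (e := e) g ι y) (meanCurvature (e := e) g ι y)
      = mcSq (chartBil g (ι a)) (coordMap d e ι a) z := by
  obtain ⟨hy1, hy2⟩ := self_mem_overlap hz
  rw [← hy] at hy1 hy2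
  have hyi : y ∈ interiorSet e Y := hy ▸ (symm_mem_interiorSet_iff hz.1).2 hz.2
  have hx0 : extChartAt (𝓡∂ d) (ι y) (ι y) ∈ overlap d (ι y) (ι a) :=
    ⟨mem_extChartAt_target _,
      (mem_interiorSet_iff (mem_extChartAt_source _)).1 (hint hyi), by rwa [extChartAt_to_inv]⟩
  have hxz : trans d (ι y) (ι a) (extChartAt (𝓡∂ d) (ι y) (ι y)) = coordMap d e ι a z := by
    simp only [trans, Function.comp_apply, extChartAt_to_inv, coordMap, writtenInExtChartAt, ← hy]
  have ev : chartBil g (ι y) =ᶠ[𝓝 (extChartAt (𝓡∂ d) (ι y) (ι y))] fun x =>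
      pullBil (chartBil g (ι a) (trans d (ι y) (ι a) x)) (fderiv ℝ (trans d (ι y) (ι a)) x) := by
    filter_upwards [(isOpen_overlap (ι y) (ι a)).mem_nhds hx0] with x hx using chartBil_trans g hx
  have hψ := contDiffAt_trans hx0
  have hBy : ContDiffAt ℝ 1 (chartBil g (ι y)) (extChartAt (𝓡∂ d) (ι y) (ι y)) := by
    refine ContDiffAt.congr_of_eventuallyEq ?_ ev
    rw [← contDiffWithinAt_univ]
    refine contDiffAt_pullBil (ContDiffAt.contDiffWithinAt ?_) (ContDiffAt.contDiffWithinAt ?_)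
    · rw [← hxz] at hB
      exact hB.comp _ (hψ.of_le (natCast_le_infty 1))
    · exact hψ.fderiv_right (m := 1) (natCast_le_infty 2)
  have hBi : IsInner (chartBil g (ι y) (extChartAt (𝓡∂ d) (ι y) (ι y))) :=
    isInner_chartBil_of_interior hr hg ⟨hx0.1, hx0.2.1⟩
  rw [meanCurvature_sq_eq g hι hyi (hBy.differentiableAt (by norm_num)) hBi]
  have hF' : ContDiffAt ℝ 2 (coordMap d e ι y) (extChartAt (𝓡∂ e) y y) :=
    (contDiffWithinAt_coordMap hι y).contDiffAt (mem_interior_iff_mem_nhds.1 hy1.2.1)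
  have hcomm : trans d (ι y) (ι a) ∘ coordMap d e ι y
      =ᶠ[𝓝 (extChartAt (𝓡∂ e) y y)] coordMap d e ι a ∘ trans e y a := by
    have hc : ContinuousAt (ι ∘ (extChartAt (𝓡∂ e) y).symm) (extChartAt (𝓡∂ e) y y) :=
      hι.continuous.continuousAt.comp (continuousAt_extChartAt_symm y)
    have hn : (extChartAt (𝓡∂ d) (ι y)).source
        ∈ 𝓝 ((ι ∘ (extChartAt (𝓡∂ e) y).symm) (extChartAt (𝓡∂ e) y y)) := by
      rw [Function.comp_apply, extChartAt_to_inv]; exact extChartAt_source_mem_nhds _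
    filter_upwards [hc hn, (isOpen_overlap y a).mem_nhds hy1] with w h1 h2
    have h3 := trans_self_mem h2
    simp only [Function.comp_apply, coordMap, writtenInExtChartAt, h3]
    exact congrArg _ ((extChartAt (𝓡∂ d) (ι y)).left_inv h1)
  have hx0' := hx0
  have hψ' := hψ
  have ev' := ev
  have hBi' := hBi
  rw [← coordMap_self (d := d) (e := e) (ι := ι) y] at hx0' hψ' ev' hBi' hxz hBy
  rw [mcSq_change (B := chartBil g (ι a)) (hψ'.of_le (natCast_le_infty 2))
    ((contDiffAt_trans hy1).of_le (natCast_le_infty 2)) (by rwa [hy2]) hF'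
    (surjective_fderiv_trans hx0') (isUnit_det_fderiv_trans hy1) hcomm
    (by rw [hxz]; exact hB.differentiableAt (by norm_num)) (hBy.differentiableAt (by norm_num))
    (isInner_chartBil_of_interior hr hg ⟨(trans_mem_overlap hx0').1, (trans_mem_overlap hx0').2.1⟩)
    hBi' ev' (by rwa [hy2]), hy2]

end Submanifold

/-! ### Test functions in the half-space model -/

section Model

variable {k : ℕ}

/-- The box of the points `w` with `lo ≤ w₀ ≤ hi` whose other coordinates differ from those of `c` by
at most `l`. -/
def boxSet (c : EuclideanSpace ℝ (Fin (k + 1))) (lo hi l : ℝ) :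
    Set (EuclideanSpace ℝ (Fin (k + 1))) :=
  {w | w 0 ∈ Icc lo hi ∧ ∀ j, j ≠ 0 → w j ∈ Icc (c j - l) (c j + l)}

lemma isClosed_boxSet (c : EuclideanSpace ℝ (Fin (k + 1))) (lo hi l : ℝ) :
    IsClosed (boxSet c lo hi l) := by
  have h : ∀ i : Fin (k + 1), Continuous fun w : EuclideanSpace ℝ (Fin (k + 1)) => w i :=
    fun i => (EuclideanSpace.proj (𝕜 := ℝ) i).continuous
  simp only [boxSet, Set.ofPred_and, Set.ofPred_forall]
  exact (isClosed_Icc.preimage (h 0)).inter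
    (isClosed_iInter fun j => isClosed_iInter fun _ => isClosed_Icc.preimage (h j))

/-- The mass of a box for the measure `dw / w₀`. -/
lemma lintegral_boxSet (c : EuclideanSpace ℝ (Fin (k + 1))) {lo hi l : ℝ} (hlo : 0 < lo)
    (hhi : lo ≤ hi) (hl : 0 ≤ l) :
    ∫⁻ w in boxSet c lo hi l, ENNReal.ofReal (w 0)⁻¹
      = ENNReal.ofReal (Real.log (hi / lo) * (2 * l) ^ k) := by
  set f : Fin (k + 1) → ℝ → ℝ := Fin.cons ((Icc lo hi).indicator fun x => x⁻¹)
    (fun j => (Icc (c j.succ - l) (c j.succ + l)).indicator fun _ => 1) with hf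
  have hf0 : ∀ i x, 0 ≤ f i x := by
    intro i
    refine Fin.cases ?_ (fun j => ?_) i <;> intro x
    · simp only [hf, Fin.cons_zero]
      exact indicator_nonneg (fun x hx => inv_nonneg.2 (hlo.le.trans hx.1)) x
    · simp only [hf, Fin.cons_succ]
      exact indicator_nonneg (fun x hx => zero_le_one) x
  have hfi : ∀ i, Integrable (f i) := by
    intro i
    refine Fin.cases ?_ (fun j => ?_) i
    · simp only [hf, Fin.cons_zero]
      refine (integrable_indicator_iff measurableSet_Icc).2 (ContinuousOn.integrableOn_Icc ?_)
      exact continuousOn_inv₀.mono fun x hx => (hlo.trans_le hx.1).ne'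
    · simp only [hf, Fin.cons_succ]
      exact (integrable_indicator_iff measurableSet_Icc).2 (integrableOn_const (by simp))
  have e1 : ∫⁻ w in boxSet c lo hi l, ENNReal.ofReal (w 0)⁻¹
      = ∫⁻ w : EuclideanSpace ℝ (Fin (k + 1)), ENNReal.ofReal (∏ i, f i (w i)) := by
    rw [← lintegral_indicator (isClosed_boxSet c lo hi l).measurableSet]
    refine lintegral_congr fun w => ?_
    rw [Fin.prod_univ_succ]
    simp only [hf, Fin.cons_zero, Fin.cons_succ]
    by_cases hw : w ∈ boxSet c lo hi l
    · rw [indicator_of_mem hw, indicator_of_mem hw.1, Finset.prod_eq_one, mul_one]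
      exact fun j _ => indicator_of_mem (hw.2 j.succ (Fin.succ_ne_zero j)) _
    · rw [indicator_of_notMem hw]
      symm
      rw [ENNReal.ofReal_eq_zero]
      refine le_of_eq ?_
      by_cases h0 : w 0 ∈ Icc lo hi
      · have h1 : ¬ ∀ j, j ≠ 0 → w j ∈ Icc (c j - l) (c j + l) := fun h => hw ⟨h0, h⟩
        push Not at h1
        obtain ⟨j, hj, hj'⟩ := h1
        obtain ⟨i, rfl⟩ := Fin.exists_succ_eq.2 hj
        rw [Finset.prod_eq_zero (Finset.mem_univ i) (indicator_of_notMem hj' _), mul_zero]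
      · rw [indicator_of_notMem h0, zero_mul]
  have e2 : ∫⁻ w : EuclideanSpace ℝ (Fin (k + 1)), ENNReal.ofReal (∏ i, f i (w i))
      = ∫⁻ x : Fin (k + 1) → ℝ, ENNReal.ofReal (∏ i, f i (x i)) := by
    exact (PiLp.volume_preserving_ofLp (Fin (k + 1))).lintegral_comp_emb
      (MeasurableEquiv.toLp 2 _).symm.measurableEmbedding
      (fun x : Fin (k + 1) → ℝ => ENNReal.ofReal (∏ i, f i (x i)))
  have hint : Integrable fun x : Fin (k + 1) → ℝ => ∏ i, f i (x i) := Integrable.fintype_prod hfi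
  rw [e1, e2, ← ofReal_integral_eq_lintegral_ofReal hint
    (Eventually.of_forall fun x => Finset.prod_nonneg fun i _ => hf0 i _)]
  congr 1
  rw [integral_fintype_prod_volume_eq_prod, Fin.prod_univ_succ]
  simp only [hf, Fin.cons_zero, Fin.cons_succ]
  congr 1
  · rw [integral_indicator measurableSet_Icc, integral_Icc_eq_integral_Ioc,
      ← intervalIntegral.integral_of_le hhi, integral_inv_of_pos hlo (hlo.trans_le hhi)]
  · rw [Finset.prod_congr rfl fun j _ => ?_, Finset.prod_const, Finset.card_univ, Fintype.card_fin]
    rw [integral_indicator measurableSet_Icc]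
    simp only [integral_const, smul_eq_mul, mul_one, MeasurableSet.univ, measureReal_restrict_apply,
      univ_inter, Real.volume_real_Icc]
    rw [max_eq_left] <;> linarith

/-- The `p`-th power of a length is uniformly continuous in its square. -/
lemma exists_sqrt_rpow_le {p X δ : ℝ} (hp : 0 < p) (hδ : 0 < δ) :
    ∃ ε > 0, ∀ x ∈ Icc 0 X, ∀ y ≤ x + ε, Real.sqrt y ^ p ≤ Real.sqrt x ^ p + δ := by
  have hc : Continuous fun t : ℝ => Real.sqrt t ^ p :=
    Real.continuous_sqrt.rpow_const fun _ => Or.inr hp.le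
  have hu := isCompact_Icc.uniformContinuousOn_of_continuous (hc.continuousOn (s := Icc 0 (X + 1)))
  obtain ⟨ε, hε, h⟩ := Metric.uniformContinuousOn_iff.1 hu δ hδ
  refine ⟨min (ε / 2) 1, by positivity, fun x hx y hy => ?_⟩
  have h0 : 0 < min (ε / 2) 1 := by positivity
  have h1 : min (ε / 2) 1 ≤ ε / 2 := min_le_left _ _
  have h2 : min (ε / 2) 1 ≤ 1 := min_le_right _ _
  have h3 := h (x + min (ε / 2) 1) ⟨by linarith [hx.1], by linarith [hx.2]⟩ x
    ⟨hx.1, by linarith [hx.2]⟩ (by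
      rw [Real.dist_eq, add_sub_cancel_left, abs_of_pos h0]; linarith)
  rw [Real.dist_eq] at h3
  have h4 := (abs_lt.1 h3).2
  have h5 : Real.sqrt y ^ p ≤ Real.sqrt (x + min (ε / 2) 1) ^ p := by
    have := Real.sqrt_le_sqrt hy
    gcongr
  linarith

/-- The value of a quadratic form at a vector within `ε` of `A e₀`. -/
lemma sum_mul_le {n : ℕ} {M : Matrix (Fin (n + 1)) (Fin (n + 1)) ℝ} {K A ε : ℝ}
    (hK : ∀ i j, |M i j| ≤ K) (hA : 0 ≤ A) (hε : 0 ≤ ε) {v ξ : Fin (n + 1) → ℝ}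
    (hv : ∀ i, v i = (if i = 0 then A else 0) + ξ i) (hξ : ∀ i, |ξ i| ≤ ε) :
    ∑ i, ∑ j, M i j * v i * v j ≤ M 0 0 * A ^ 2 + K * (2 * A * (n + 1) * ε + (n + 1) ^ 2 * ε ^ 2) := by
  have hK0 : 0 ≤ K := (abs_nonneg _).trans (hK 0 0)
  set D : Fin (n + 1) → ℝ := fun i => if i = 0 then A else 0 with hD
  have hD0 : ∀ i, 0 ≤ D i := fun i => by simp only [hD]; split_ifs <;> simp [hA]
  have h : ∀ i j, M i j * v i * v j ≤ M i j * (D i * D j) + K * (D i * ε + D j * ε + ε ^ 2) := by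
    intro i j
    rw [hv i, hv j]
    have h1 : |M i j * (D i * ξ j + D j * ξ i + ξ i * ξ j)|
        ≤ K * (D i * ε + D j * ε + ε ^ 2) := by
      rw [abs_mul]
      refine mul_le_mul (hK i j) ?_ (abs_nonneg _) hK0
      refine (abs_add_le _ _).trans (add_le_add ((abs_add_le _ _).trans (add_le_add ?_ ?_)) ?_)
      · rw [abs_mul, abs_of_nonneg (hD0 i)]
        exact mul_le_mul_of_nonneg_left (hξ j) (hD0 i)
      · rw [abs_mul, abs_of_nonneg (hD0 j)]
        exact mul_le_mul_of_nonneg_left (hξ i) (hD0 j)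
      · rw [abs_mul, pow_two]
        exact mul_le_mul (hξ i) (hξ j) (abs_nonneg _) hε
    have h2 := le_of_abs_le h1
    linear_combination h2
  refine (Finset.sum_le_sum fun i _ => Finset.sum_le_sum fun j _ => h i j).trans (le_of_eq ?_)
  simp only [Finset.sum_add_distrib, ← Finset.mul_sum, ← Finset.sum_mul, Finset.sum_const,
    Finset.card_univ, Fintype.card_fin, nsmul_eq_mul]
  simp [hD, Finset.sum_ite_eq']
  ring

/-- The test function `w₀^κ Θ(u)`, where `u` has the coordinates `log (w₀ / t) / Λ` and
`(w_j - c_j) / l`. -/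
def modelFun (Θ : ContDiffBump (0 : EuclideanSpace ℝ (Fin (k + 1)))) (κ t Λ l : ℝ)
    (c w : EuclideanSpace ℝ (Fin (k + 1))) : ℝ :=
  if 0 < w 0 then w 0 ^ κ * Θ ((Real.log (w 0 / t) / Λ) • ev 0 + l⁻¹ • (w - c - (w - c) 0 • ev 0))
  else 0

variable {Θ : ContDiffBump (0 : EuclideanSpace ℝ (Fin (k + 1)))} {κ t Λ l : ℝ}
  {c w : EuclideanSpace ℝ (Fin (k + 1))}

lemma mem_boxSet_iff (ht : 0 < t) (hΛ : 0 < Λ) (hl : 0 < l) {m : ℝ} (hw : 0 < w 0) :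
    w ∈ boxSet c (t * Real.exp (-(m * Λ))) (t * Real.exp (m * Λ)) (m * l) ↔
      ∀ i, |((Real.log (w 0 / t) / Λ) • ev 0 + l⁻¹ • (w - c - (w - c) 0 • ev 0) :
        EuclideanSpace ℝ (Fin (k + 1))) i| ≤ m := by
  have h0 : ((Real.log (w 0 / t) / Λ) • ev 0 + l⁻¹ • (w - c - (w - c) 0 • ev 0) :
        EuclideanSpace ℝ (Fin (k + 1))) 0 = Real.log (w 0 / t) / Λ := by
    simp [ev]
  have hj : ∀ j, j ≠ 0 → ((Real.log (w 0 / t) / Λ) • ev 0 + l⁻¹ • (w - c - (w - c) 0 • ev 0) :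
        EuclideanSpace ℝ (Fin (k + 1))) j = (w j - c j) / l := by
    intro j hj
    simp [ev, hj, div_eq_inv_mul]
  have e0 : w 0 ∈ Icc (t * Real.exp (-(m * Λ))) (t * Real.exp (m * Λ)) ↔
      |Real.log (w 0 / t) / Λ| ≤ m := by
    rw [abs_le, le_div_iff₀ hΛ, div_le_iff₀ hΛ, Real.le_log_iff_exp_le (by positivity),
      Real.log_le_iff_le_exp (by positivity), le_div_iff₀' ht, div_le_iff₀' ht, neg_mul]
    rfl
  have ej : ∀ j, w j ∈ Icc (c j - m * l) (c j + m * l) ↔ |(w j - c j) / l| ≤ m := by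
    intro j
    rw [abs_le, le_div_iff₀ hl, div_le_iff₀ hl]
    exact ⟨fun h => ⟨by linarith [h.1], by linarith [h.2]⟩,
      fun h => ⟨by linarith [h.1], by linarith [h.2]⟩⟩
  constructor
  · rintro ⟨h1, h2⟩ i
    by_cases hi : i = 0
    · subst hi; rw [h0]; exact e0.1 h1
    · rw [hj i hi]; exact (ej i).1 (h2 i hi)
  · intro h
    exact ⟨e0.2 (h0 ▸ h 0), fun j hj' => (ej j).2 (hj j hj' ▸ h j)⟩

lemma norm_le_sqrt_mul {m : ℝ} (hm : 0 ≤ m) {u : EuclideanSpace ℝ (Fin (k + 1))}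
    (h : ∀ i, |u i| ≤ m) : ‖u‖ ≤ Real.sqrt (k + 1) * m := by
  rw [EuclideanSpace.norm_eq, ← Real.sqrt_sq hm, ← Real.sqrt_mul (by positivity)]
  refine Real.sqrt_le_sqrt ?_
  refine (Finset.sum_le_sum fun i _ => (pow_le_pow_left₀ (norm_nonneg _) (h i) 2)).trans ?_
  simp

lemma support_modelFun_subset (ht : 0 < t) (hΛ : 0 < Λ) (hl : 0 < l) :
    Function.support (modelFun Θ κ t Λ l c)
      ⊆ boxSet c (t * Real.exp (-(Θ.rOut * Λ))) (t * Real.exp (Θ.rOut * Λ)) (Θ.rOut * l) := by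
  intro w hw
  rw [Function.mem_support, modelFun] at hw
  split_ifs at hw with h0
  · refine (mem_boxSet_iff ht hΛ hl h0).2 fun i => ?_
    have h1 : Θ ((Real.log (w 0 / t) / Λ) • ev 0 + l⁻¹ • (w - c - (w - c) 0 • ev 0)) ≠ 0 :=
      right_ne_zero_of_mul hw
    have h2 := Θ.support_eq ▸ Function.mem_support.2 h1
    rw [mem_ball_zero_iff] at h2
    exact (PiLp.norm_apply_le _ i).trans h2.le
  · exact absurd rfl hw

lemma modelFun_eq (ht : 0 < t) (hΛ : 0 < Λ) (hl : 0 < l) (hΘ : Θ.rIn = Real.sqrt (k + 1))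
    (hw : w ∈ boxSet c (t * Real.exp (-(1 * Λ))) (t * Real.exp (1 * Λ)) (1 * l)) :
    modelFun Θ κ t Λ l c w = w 0 ^ κ := by
  have h0 : 0 < w 0 := lt_of_lt_of_le (by positivity) hw.1.1
  have h1 := norm_le_sqrt_mul zero_le_one ((mem_boxSet_iff ht hΛ hl h0).1 hw)
  rw [modelFun, if_pos h0, Θ.one_of_mem_closedBall (by rw [mem_closedBall_zero_iff, hΘ]; linarith),
    mul_one]

lemma modelFun_nonneg : 0 ≤ modelFun Θ κ t Λ l c w := by
  rw [modelFun]
  split_ifs with h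
  · exact mul_nonneg (Real.rpow_nonneg h.le _) Θ.nonneg
  · exact le_rfl

lemma eventually_pos (hw : 0 < w 0) : ∀ᶠ x : EuclideanSpace ℝ (Fin (k + 1)) in 𝓝 w, 0 < x 0 :=
  (EuclideanSpace.proj (𝕜 := ℝ) (0 : Fin (k + 1))).continuous.continuousAt.eventually
    (lt_mem_nhds hw)

lemma contDiff_modelFun (ht : 0 < t) (hΛ : 0 < Λ) (hl : 0 < l) :
    ContDiff ℝ ∞ (modelFun Θ κ t Λ l c) := by
  rw [contDiff_iff_contDiffAt]
  intro w
  by_cases h0 : 0 < w 0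
  · have e : modelFun Θ κ t Λ l c =ᶠ[𝓝 w] fun w => w 0 ^ κ *
        Θ ((Real.log (w 0 / t) / Λ) • ev 0 + l⁻¹ • (w - c - (w - c) 0 • ev 0)) := by
      filter_upwards [eventually_pos h0] with x hx
      rw [modelFun, if_pos hx]
    refine ContDiffAt.congr_of_eventuallyEq ?_ e
    have hc : ∀ i : Fin (k + 1), ContDiffAt ℝ ∞
        (fun w : EuclideanSpace ℝ (Fin (k + 1)) => w i) w := fun i =>
      (EuclideanSpace.proj (𝕜 := ℝ) i).contDiff.contDiffAt
    have h1 : ContDiffAt ℝ ∞ (fun w : EuclideanSpace ℝ (Fin (k + 1)) => w 0 ^ κ) w :=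
      (hc 0).rpow_const_of_ne h0.ne'
    have h2 : ContDiffAt ℝ ∞ (fun w : EuclideanSpace ℝ (Fin (k + 1)) =>
        Real.log (w 0 / t) / Λ) w :=
      (((hc 0).div_const t).log (by positivity)).div_const Λ
    have h3 : ContDiffAt ℝ ∞ (fun w : EuclideanSpace ℝ (Fin (k + 1)) =>
        (w - c) 0) w := (hc 0).sub contDiffAt_const
    refine h1.mul (Θ.contDiffAt.comp w ((h2.smul contDiffAt_const).add ?_))
    exact ((contDiffAt_id.sub contDiffAt_const).sub (h3.smul contDiffAt_const)).const_smul l⁻¹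
  · have h1 : w ∉ boxSet c (t * Real.exp (-(Θ.rOut * Λ))) (t * Real.exp (Θ.rOut * Λ))
        (Θ.rOut * l) := fun h => h0 (lt_of_lt_of_le (by positivity) h.1.1)
    have e : modelFun Θ κ t Λ l c =ᶠ[𝓝 w] fun _ => 0 := by
      filter_upwards [(isClosed_boxSet c _ _ _).isOpen_compl.mem_nhds h1] with x hx
      by_contra h
      exact hx (support_modelFun_subset ht hΛ hl h)
    exact contDiffAt_const.congr_of_eventuallyEq e

/-- The differential of the test function: its leading part comes from `w₀^κ`, and the rest is
small if `Λ` is large. -/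
lemma fderiv_modelFun (ht : 0 < t) (hΛ : 0 < Λ) (hl : 0 < l) (h0 : 0 < w 0) (hlw : w 0 * Λ ≤ l)
    {CΘ : ℝ} (hC : ∀ u, ‖fderiv ℝ Θ u‖ ≤ CΘ) :
    ∃ χ ∈ Icc (0 : ℝ) 1, modelFun Θ κ t Λ l c w = w 0 ^ κ * χ ∧ ∃ ξ : Fin (k + 1) → ℝ,
      (∀ i, |ξ i| ≤ CΘ / Λ) ∧ ∀ i, fderiv ℝ (modelFun Θ κ t Λ l c) w (ev i)
        = w 0 ^ (κ - 1) * ((if i = 0 then κ * χ else 0) + ξ i) := by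
  set P0 : EuclideanSpace ℝ (Fin (k + 1)) →L[ℝ] ℝ := EuclideanSpace.proj 0 with hP0
  set U : EuclideanSpace ℝ (Fin (k + 1)) → EuclideanSpace ℝ (Fin (k + 1)) := fun w =>
    (Real.log (w 0 / t) / Λ) • ev 0 + l⁻¹ • (w - c - (w - c) 0 • ev 0) with hU
  set U' : EuclideanSpace ℝ (Fin (k + 1)) →L[ℝ] EuclideanSpace ℝ (Fin (k + 1)) :=
    (((w 0)⁻¹ / Λ) • P0).smulRight (ev 0)
      + l⁻¹ • (ContinuousLinearMap.id ℝ _ - P0.smulRight (ev 0)) with hU'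
  have hd0 : HasFDerivAt (fun w : EuclideanSpace ℝ (Fin (k + 1)) => w 0) P0 w := P0.hasFDerivAt
  have hlog : HasFDerivAt (fun w : EuclideanSpace ℝ (Fin (k + 1)) => Real.log (w 0 / t) / Λ)
      (((w 0)⁻¹ / Λ) • P0) w := by
    have h1 : HasDerivAt (fun x : ℝ => Real.log (x / t) / Λ) ((w 0)⁻¹ / Λ) (w 0) := by
      have := (((hasDerivAt_id (w 0)).div_const t).log (div_ne_zero h0.ne' ht.ne')).div_const Λ
      refine this.congr_deriv ?_
      simp only [id]
      field_simp
    exact h1.comp_hasFDerivAt w hd0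
  have hUd : HasFDerivAt U U' w := by
    refine (hlog.smul_const (ev 0)).add (HasFDerivAt.const_smul ?_ l⁻¹)
    refine ((hasFDerivAt_id w).sub_const c).sub (HasFDerivAt.smul_const ?_ (ev 0))
    exact hd0.sub_const (c 0)
  have hΘd : HasFDerivAt (fun w => Θ (U w)) ((fderiv ℝ Θ (U w)).comp U') w :=
    ((Θ.contDiff (n := 1)).differentiable (by norm_num) (U w)).hasFDerivAt.comp w hUd
  have hpow : HasFDerivAt (fun w : EuclideanSpace ℝ (Fin (k + 1)) => w 0 ^ κ)
      ((κ * w 0 ^ (κ - 1)) • P0) w := by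
    have h1 : HasDerivAt (fun x : ℝ => x ^ κ) (κ * w 0 ^ (κ - 1)) (w 0) :=
      Real.hasDerivAt_rpow_const (Or.inl h0.ne')
    exact h1.comp_hasFDerivAt w hd0
  have e : modelFun Θ κ t Λ l c =ᶠ[𝓝 w] fun w => w 0 ^ κ * Θ (U w) := by
    filter_upwards [eventually_pos h0] with x hx
    rw [modelFun, if_pos hx]
  refine ⟨Θ (U w), ⟨Θ.nonneg, Θ.le_one⟩, e.self_of_nhds,
    fun i => w 0 * fderiv ℝ Θ (U w) (U' (ev i)), fun i => ?_, fun i => ?_⟩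
  · -- the vectors `w₀ ∂ᵢ` have unit length in the hyperbolic metric, and `u` varies slowly along them
    have h1 : ‖w 0 • U' (ev i)‖ ≤ Λ⁻¹ := by
      by_cases hi : i = 0
      · subst hi
        have : w 0 • U' (ev 0) = Λ⁻¹ • ev 0 := by
          simp only [hU', hP0, add_apply, ContinuousLinearMap.smulRight_apply, smul_apply,
            sub_apply, ContinuousLinearMap.id_apply]
          simp [ev, smul_smul]
          field_simp
        rw [this, norm_smul, ev, PiLp.norm_single]
        simp [abs_of_pos hΛ]
      · have : w 0 • U' (ev i) = (w 0 / l) • ev i := by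
          simp only [hU', hP0, add_apply, ContinuousLinearMap.smulRight_apply, smul_apply,
            sub_apply, ContinuousLinearMap.id_apply]
          simp [ev, smul_smul, Ne.symm hi, div_eq_mul_inv]
        rw [this, norm_smul, ev, PiLp.norm_single]
        simp only [norm_one, mul_one, Real.norm_eq_abs]
        rw [abs_of_pos (by positivity), div_le_iff₀ hl, ← div_eq_inv_mul, le_div_iff₀ hΛ]
        exact hlw
    have h2 : w 0 * fderiv ℝ Θ (U w) (U' (ev i)) = fderiv ℝ Θ (U w) (w 0 • U' (ev i)) := by
      rw [map_smul, smul_eq_mul]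
    dsimp only
    rw [h2, div_eq_mul_inv]
    exact ((fderiv ℝ Θ (U w)).le_opNorm _).trans
      (mul_le_mul (hC _) h1 (norm_nonneg _) ((norm_nonneg _).trans (hC 0)))
  · have hmul : HasFDerivAt (fun w => w 0 ^ κ * Θ (U w)) _ w := hpow.mul hΘd
    rw [e.fderiv_eq, hmul.fderiv]
    have h3 : w 0 ^ κ = w 0 ^ (κ - 1) * w 0 := by
      rw [Real.rpow_sub_one h0.ne', div_mul_cancel₀ _ h0.ne']
    simp only [add_apply, smul_apply, ContinuousLinearMap.comp_apply, smul_eq_mul]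
    have h4 : P0 (ev i) = if i = 0 then 1 else 0 := by
      simp [hP0, ev, eq_comm]
    rw [h4, h3]
    split_ifs <;> ring

/-- Boxes of a fixed shape in the hyperbolic sense lie in arbitrarily small Euclidean balls that stay
away from the boundary. -/
lemma exists_ball_boxSet {z₀ : EuclideanSpace ℝ (Fin (k + 1))} (hz₀ : z₀ 0 = 0) {r₀ m Λ : ℝ}
    (hr₀ : 0 < r₀) (hm : 0 < m) (hΛ : 0 < Λ) :
    ∃ (t : ℝ) (c : EuclideanSpace ℝ (Fin (k + 1))) (ρ : ℝ), 0 < t ∧ 0 < ρ ∧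
      boxSet z₀ (t * Real.exp (-(m * Λ))) (t * Real.exp (m * Λ))
        (m * (t * (Λ * Real.exp (m * Λ)))) ⊆ Metric.ball c ρ ∧
      Metric.closedBall c ρ ⊆ Metric.ball z₀ r₀ ∩ interior (halfSpace (k + 1)) := by
  set q : ℝ := Real.exp (m * Λ) with hq
  have hq0 : 0 < q := Real.exp_pos _
  have hq1 : 1 ≤ q := Real.one_le_exp (by positivity)
  have hq' : Real.exp (-(m * Λ)) = q⁻¹ := Real.exp_neg _
  have hk : (1 : ℝ) ≤ (k : ℝ) + 1 := by linarith [(Nat.cast_nonneg k : (0 : ℝ) ≤ k)]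
  -- the box of scale `t` lies within `t R₁` of `z₀` and above the height `t / q`; the ball is centred
  -- at the height `T`, with `(t R₁)² = T (t / q)`, so that it contains all such points
  set b : ℝ := q + m * (Λ * q) with hb
  have hb1 : 1 ≤ b := by
    have : 0 < m * (Λ * q) := by positivity
    linarith
  set R₁ : ℝ := ((k : ℝ) + 1) * b with hR₁
  have hR₁1 : 1 ≤ R₁ := one_le_mul_of_one_le_of_one_le hk hb1
  set t : ℝ := r₀ / (4 * (R₁ ^ 2 * q)) with ht
  have ht0 : 0 < t := by positivity
  set T : ℝ := t * (R₁ ^ 2 * q) with hT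
  have hT0 : 0 < T := by positivity
  have hTr : 4 * T = r₀ := by rw [hT, ht]; field_simp
  have hRT : t * R₁ ≤ T := by
    refine mul_le_mul_of_nonneg_left ?_ ht0.le
    calc R₁ = R₁ * 1 * 1 := by ring
      _ ≤ R₁ * R₁ * q := by gcongr
      _ = R₁ ^ 2 * q := by ring
  have htR0 : 0 < t * R₁ := by positivity
  have hRT2 : (t * R₁) ^ 2 ≤ T ^ 2 := pow_le_pow_left₀ htR0.le hRT 2
  have htR2 : 0 < (t * R₁) ^ 2 := by positivity
  set ρ : ℝ := Real.sqrt (T ^ 2 - (t * R₁) ^ 2 / 2) with hρ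
  have hpos2 : 0 < T ^ 2 - (t * R₁) ^ 2 / 2 := by linarith
  have hρ2 : ρ ^ 2 = T ^ 2 - (t * R₁) ^ 2 / 2 := Real.sq_sqrt hpos2.le
  have hρ0 : 0 < ρ := Real.sqrt_pos.2 hpos2
  have hρT : ρ < T := lt_of_pow_lt_pow_left₀ 2 hT0.le (by linarith)
  have e2 : ‖(ev 0 : EuclideanSpace ℝ (Fin (k + 1)))‖ = 1 := by simp [ev]
  refine ⟨t, z₀ + T • ev 0, ρ, ht0, hρ0, fun w hw => ?_, fun w hw => ⟨?_, ?_⟩⟩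
  · have h0 : 0 < w 0 := lt_of_lt_of_le (by positivity) hw.1.1
    have h3 : ∀ i, |(w - z₀) i| ≤ t * b := by
      intro i
      by_cases hi : i = 0
      · subst hi
        rw [PiLp.sub_apply, hz₀, sub_zero, abs_of_pos h0]
        refine hw.1.2.trans (mul_le_mul_of_nonneg_left ?_ ht0.le)
        have : 0 < m * (Λ * q) := by positivity
        linarith
      · have h4 := hw.2 i hi
        rw [PiLp.sub_apply, abs_le]
        have h5 : m * (t * (Λ * q)) ≤ t * b := by
          have : 0 < t * q := by positivity
          rw [hb]
          linarith
        constructor <;> linarith [h4.1, h4.2]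
    have h4 : ‖w - z₀‖ ≤ t * R₁ := by
      refine (norm_le_sqrt_mul (by positivity) h3).trans ?_
      have h5 : Real.sqrt ((k : ℝ) + 1) ≤ (k : ℝ) + 1 :=
        Real.sqrt_le_self_iff.2 (Or.inr hk)
      calc _ ≤ ((k : ℝ) + 1) * (t * b) := mul_le_mul_of_nonneg_right h5 (by positivity)
        _ = t * R₁ := by rw [hR₁]; ring
    rw [mem_ball_iff_norm]
    refine lt_of_pow_lt_pow_left₀ 2 hρ0.le ?_
    rw [hρ2, ← sub_sub, norm_sub_sq_real, norm_smul, real_inner_smul_right]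
    have e1 : inner ℝ (w - z₀) (ev 0) = w 0 := by
      simp [ev, EuclideanSpace.inner_single_right, hz₀]
    rw [e1, e2, mul_one, Real.norm_eq_abs, sq_abs]
    have h5 : (t * R₁) ^ 2 ≤ T * w 0 := by
      have h6 : t * q⁻¹ ≤ w 0 := hq' ▸ hw.1.1
      calc (t * R₁) ^ 2 = T * (t * q⁻¹) := by rw [hT]; field_simp
        _ ≤ T * w 0 := mul_le_mul_of_nonneg_left h6 hT0.le
    have h6 : ‖w - z₀‖ ^ 2 ≤ (t * R₁) ^ 2 := pow_le_pow_left₀ (norm_nonneg _) h4 2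
    linarith
  · rw [mem_closedBall_iff_norm] at hw
    rw [mem_ball_iff_norm]
    have e : w - z₀ = (w - (z₀ + T • ev 0)) + T • ev 0 := by abel
    rw [e]
    refine (norm_add_le _ _).trans_lt ?_
    rw [norm_smul, Real.norm_eq_abs, abs_of_pos hT0, e2]
    linarith
  · rw [mem_closedBall_iff_norm] at hw
    rw [mem_interior_halfSpace]
    have h3 := (PiLp.norm_apply_le (w - (z₀ + T • ev 0)) 0).trans hw
    have e : (w - (z₀ + T • ev 0)).ofLp 0 = w 0 - T := by simp [ev, hz₀]
    rw [e, Real.norm_eq_abs] at h3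
    linarith [(abs_le.1 h3).1]

/-- The Rayleigh quotient of the test function, pointwise. -/
lemma sqrt_rpow_fderiv_modelFun_le {M : Matrix (Fin (k + 1)) (Fin (k + 1)) ℝ}
    {a p K δ ε ε₁ ε₂ CΘ : ℝ} (ht : 0 < t) (hΛ : 0 < Λ) (hl : 0 < l) (h0 : 0 < w 0)
    (hlw : w 0 * Λ ≤ l) (hCΘ : ∀ u, ‖fderiv ℝ Θ u‖ ≤ CΘ) (hp : 0 < p) (hκ : κ * p = k)
    (hκ0 : 0 ≤ κ) (ha : 0 ≤ a) (hε₁0 : 0 ≤ ε₁) (hε₁1 : ε₁ ≤ 1) (hΛ1 : CΘ / Λ ≤ ε₁)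
    (hε₂0 : 0 ≤ ε₂) (hε₂ : ε₂ * κ ^ 2 ≤ ε / 2)
    (hε₁ : |K| * (2 * κ * (k + 1) + (k + 1) ^ 2) * ε₁ ≤ ε / 2)
    (hsq : ∀ x ∈ Icc 0 ((κ * a) ^ 2), ∀ y ≤ x + ε, Real.sqrt y ^ p ≤ Real.sqrt x ^ p + δ)
    (hM0 : M 0 0 ≤ w 0 ^ 2 * (a ^ 2 + ε₂)) (hMK : ∀ i j, |M i j| ≤ K * w 0 ^ 2) :
    Real.sqrt (∑ i, ∑ j, M i j * fderiv ℝ (modelFun Θ κ t Λ l c) w (ev i)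
        * fderiv ℝ (modelFun Θ κ t Λ l c) w (ev j)) ^ p
      ≤ (κ * a) ^ p * modelFun Θ κ t Λ l c w ^ p + δ * w 0 ^ k := by
  obtain ⟨χ, ⟨hχ0, hχ1⟩, hφw, ξ, hξ, hdφ⟩ := fderiv_modelFun (κ := κ) (c := c) ht hΛ hl h0 hlw hCΘ
  have hMK' : ∀ i j, |M i j| ≤ |K| * w 0 ^ 2 := fun i j => (hMK i j).trans
    (mul_le_mul_of_nonneg_right (le_abs_self K) (by positivity))
  have h3 := sum_mul_le hMK' (mul_nonneg hκ0 hχ0) hε₁0 (fun i => rfl) fun i => (hξ i).trans hΛ1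
  set v : Fin (k + 1) → ℝ := fun i => (if i = 0 then κ * χ else 0) + ξ i with hv
  have h4 : ∑ i, ∑ j, M i j * fderiv ℝ (modelFun Θ κ t Λ l c) w (ev i)
        * fderiv ℝ (modelFun Θ κ t Λ l c) w (ev j)
      = (w 0 ^ (κ - 1)) ^ 2 * ∑ i, ∑ j, M i j * v i * v j := by
    simp only [hdφ, Finset.mul_sum]
    refine Finset.sum_congr rfl fun i _ => Finset.sum_congr rfl fun j _ => ?_
    simp only [hv]
    ring
  have hp1 : w 0 ^ (κ - 1) * w 0 = w 0 ^ κ := by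
    rw [Real.rpow_sub_one h0.ne', div_mul_cancel₀ _ h0.ne']
  have hκχ : κ * χ ≤ κ := mul_le_of_le_one_right hκ0 hχ1
  have hκχ0 : 0 ≤ κ * χ := mul_nonneg hκ0 hχ0
  -- the quadratic form is at most `w₀^(2κ) ((κ χ a)² + ε)`
  have h5 : ∑ i, ∑ j, M i j * v i * v j ≤ w 0 ^ 2 * ((κ * χ * a) ^ 2 + ε) := by
    refine h3.trans ?_
    have h6 : M 0 0 * (κ * χ) ^ 2 ≤ w 0 ^ 2 * (a ^ 2 + ε₂) * (κ * χ) ^ 2 :=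
      mul_le_mul_of_nonneg_right hM0 (by positivity)
    have h7 : ε₂ * (κ * χ) ^ 2 ≤ ε / 2 :=
      (mul_le_mul_of_nonneg_left (pow_le_pow_left₀ hκχ0 hκχ 2) hε₂0).trans hε₂
    have h8 : |K| * (2 * (κ * χ) * (k + 1) * ε₁ + (k + 1) ^ 2 * ε₁ ^ 2) ≤ ε / 2 := by
      refine le_trans ?_ hε₁
      rw [mul_assoc |K|]
      refine mul_le_mul_of_nonneg_left ?_ (abs_nonneg K)
      have h13 : ε₁ ^ 2 ≤ ε₁ := by
        rw [pow_two]; exact mul_le_of_le_one_left hε₁0 hε₁1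
      have h14 : 2 * (κ * χ) * ((k : ℝ) + 1) * ε₁ ≤ 2 * κ * ((k : ℝ) + 1) * ε₁ := by gcongr
      have h15 : ((k : ℝ) + 1) ^ 2 * ε₁ ^ 2 ≤ ((k : ℝ) + 1) ^ 2 * ε₁ := by gcongr
      linarith
    have h9 := mul_le_mul_of_nonneg_left h7 (sq_nonneg (w 0))
    have h10 := mul_le_mul_of_nonneg_left h8 (sq_nonneg (w 0))
    linarith
  have h6 := hsq ((κ * χ * a) ^ 2) ⟨by positivity,
    pow_le_pow_left₀ (by positivity) (mul_le_mul_of_nonneg_right hκχ ha) 2⟩ _ le_rfl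
  rw [Real.sqrt_sq (by positivity)] at h6
  have h7 : Real.sqrt (∑ i, ∑ j, M i j * fderiv ℝ (modelFun Θ κ t Λ l c) w (ev i)
        * fderiv ℝ (modelFun Θ κ t Λ l c) w (ev j))
      ≤ w 0 ^ κ * Real.sqrt ((κ * χ * a) ^ 2 + ε) := by
    rw [h4, ← hp1, ← Real.sqrt_sq (x := w 0 ^ (κ - 1) * w 0) (by positivity),
      ← Real.sqrt_mul (by positivity)]
    refine Real.sqrt_le_sqrt ?_
    have := mul_le_mul_of_nonneg_left h5 (sq_nonneg (w 0 ^ (κ - 1)))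
    linarith
  have h8 : (w 0 ^ κ) ^ p = w 0 ^ k := by
    rw [← Real.rpow_mul h0.le, hκ, Real.rpow_natCast]
  calc _ ≤ (w 0 ^ κ * Real.sqrt ((κ * χ * a) ^ 2 + ε)) ^ p :=
        Real.rpow_le_rpow (Real.sqrt_nonneg _) h7 hp.le
    _ = w 0 ^ k * Real.sqrt ((κ * χ * a) ^ 2 + ε) ^ p := by
        rw [Real.mul_rpow (by positivity) (Real.sqrt_nonneg _), h8]
    _ ≤ w 0 ^ k * ((κ * χ * a) ^ p + δ) := mul_le_mul_of_nonneg_left h6 (by positivity)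
    _ = (κ * a) ^ p * modelFun Θ κ t Λ l c w ^ p + δ * w 0 ^ k := by
        rw [hφw, Real.mul_rpow (by positivity) hχ0, h8,
          show κ * χ * a = κ * a * χ by ring, Real.mul_rpow (by positivity) hχ0]
        ring

/-- A test function whose Rayleigh quotient, for a metric with inverse `M` asymptotic to that of a
hyperbolic metric, is close to `(κ a)^p`. It is supported in a box `S`, equals `w₀^κ` on a smaller
box `S'`, and the ratio of the masses of the boxes is controlled independently of `δ`. -/
lemma exists_test_function {z₀ : EuclideanSpace ℝ (Fin (k + 1))} (hz₀ : z₀ 0 = 0)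
    {M : EuclideanSpace ℝ (Fin (k + 1)) → Matrix (Fin (k + 1)) (Fin (k + 1)) ℝ} {κ a p K : ℝ}
    (hp : 0 < p) (hκ : κ * p = k) (hκ0 : 0 ≤ κ) (ha : 0 ≤ a)
    (h1 : ∀ ε > 0, ∀ᶠ w in 𝓝[interior (halfSpace (k + 1))] z₀, M w 0 0 ≤ w 0 ^ 2 * (a ^ 2 + ε))
    (h2 : ∀ᶠ w in 𝓝[interior (halfSpace (k + 1))] z₀, ∀ i j, |M w i j| ≤ K * w 0 ^ 2)
    {U : Set (EuclideanSpace ℝ (Fin (k + 1)))} (hU : U ∈ 𝓝[interior (halfSpace (k + 1))] z₀)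
    {δ : ℝ} (hδ : 0 < δ) :
    ∃ (φ : EuclideanSpace ℝ (Fin (k + 1)) → ℝ) (c : EuclideanSpace ℝ (Fin (k + 1))) (ρ : ℝ)
      (S S' : Set (EuclideanSpace ℝ (Fin (k + 1)))), 0 < ρ ∧
      Metric.closedBall c ρ ⊆ U ∩ interior (halfSpace (k + 1)) ∧ ContDiff ℝ ∞ φ ∧ (∀ w, 0 ≤ φ w) ∧
      tsupport φ ⊆ S ∧ S ⊆ Metric.ball c ρ ∧ IsClosed S ∧ IsClosed S' ∧ S' ⊆ S ∧
      (∀ w ∈ S', φ w ^ p = w 0 ^ k) ∧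
      (∀ w ∈ S, Real.sqrt (∑ i, ∑ j, M w i j * fderiv ℝ φ w (ev i) * fderiv ℝ φ w (ev j)) ^ p
        ≤ (κ * a) ^ p * φ w ^ p + δ * w 0 ^ k) ∧
      ∫⁻ w in S, ENNReal.ofReal (w 0)⁻¹ ≤ ENNReal.ofReal ((2 * Real.sqrt (k + 1)) ^ (k + 1))
        * ∫⁻ w in S', ENNReal.ofReal (w 0)⁻¹ ∧
      0 < ∫⁻ w in S', ENNReal.ofReal (w 0)⁻¹ := by
  have hN0 : 0 < (k : ℝ) + 1 := by positivity
  have hsN : 0 < Real.sqrt ((k : ℝ) + 1) := Real.sqrt_pos.2 hN0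
  let Θ : ContDiffBump (0 : EuclideanSpace ℝ (Fin (k + 1))) :=
    ⟨Real.sqrt (k + 1), 2 * Real.sqrt (k + 1), hsN, by linarith⟩
  set m : ℝ := 2 * Real.sqrt (k + 1) with hm
  have hm0 : 0 < m := by positivity
  have hm1 : 1 ≤ m := by
    have : 1 ≤ Real.sqrt ((k : ℝ) + 1) :=
      Real.one_le_sqrt.2 (by linarith [(Nat.cast_nonneg k : (0 : ℝ) ≤ k)])
    linarith
  obtain ⟨CΘ, hCΘ⟩ : ∃ C, ∀ u, ‖fderiv ℝ Θ u‖ ≤ C :=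
    (Θ.hasCompactSupport.fderiv ℝ).exists_bound_of_continuous
      ((Θ.contDiff (n := 1)).continuous_fderiv (by norm_num))
  have hC0 : 0 ≤ CΘ := (norm_nonneg _).trans (hCΘ 0)
  obtain ⟨ε, hε, hsq⟩ := exists_sqrt_rpow_le (X := (κ * a) ^ 2) hp hδ
  -- `ε₂` is the error of the metric and `ε₁` that of the cut-off
  obtain ⟨ε₂, hε₂0, hε₂⟩ : ∃ ε₂ > 0, ε₂ * κ ^ 2 ≤ ε / 2 := by
    refine ⟨ε / (2 * (κ ^ 2 + 1)), by positivity, ?_⟩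
    rw [div_mul_eq_mul_div, div_le_div_iff₀ (by positivity) (by positivity)]
    linarith
  obtain ⟨ε₁, hε₁0, hε₁1, hε₁⟩ : ∃ ε₁ > 0, ε₁ ≤ 1 ∧
      |K| * (2 * κ * (k + 1) + (k + 1) ^ 2) * ε₁ ≤ ε / 2 := by
    have hc : 0 ≤ |K| * (2 * κ * (k + 1) + (k + 1) ^ 2) := by positivity
    set C₁ := |K| * (2 * κ * (k + 1) + (k + 1) ^ 2)
    refine ⟨min 1 (ε / (2 * (C₁ + 1))), by positivity, min_le_left _ _, ?_⟩
    refine (mul_le_mul_of_nonneg_left (min_le_right _ _) hc).trans ?_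
    rw [mul_div_assoc', div_le_div_iff₀ (by positivity) (by positivity)]
    linarith
  have hΛ0 : 0 < (CΘ + 1) / ε₁ := by positivity
  have hΛ1 : CΘ / ((CΘ + 1) / ε₁) ≤ ε₁ := by
    rw [div_le_iff₀ hΛ0, mul_div_cancel₀ _ hε₁0.ne']
    linarith
  set Λ : ℝ := (CΘ + 1) / ε₁
  obtain ⟨r₀, hr₀, hball⟩ := Metric.mem_nhdsWithin_iff.1 ((h1 ε₂ hε₂0).and (h2.and hU))
  obtain ⟨t, c, ρ, ht0, hρ0, hSball, hcb⟩ := exists_ball_boxSet hz₀ hr₀ hm0 hΛ0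
  -- the width `l` is at least `Λ` times the height of every point of the box
  set l : ℝ := t * (Λ * Real.exp (m * Λ)) with hl
  have hl0 : 0 < l := by positivity
  have hlog : ∀ x : ℝ, Real.log (t * Real.exp x / (t * Real.exp (-x))) = 2 * x := by
    intro x
    rw [mul_div_mul_left _ _ ht0.ne', ← Real.exp_sub, Real.log_exp]
    ring
  -- the mass is homogeneous of degree `k + 1` in the size of the box in the coordinates `u`
  have hmass : ∀ x : ℝ, 0 < x → ∫⁻ w in boxSet z₀ (t * Real.exp (-(x * Λ)))
      (t * Real.exp (x * Λ)) (x * l), ENNReal.ofReal (w 0)⁻¹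
        = ENNReal.ofReal (x ^ (k + 1) * (2 * Λ * (2 * l) ^ k)) := by
    intro x hx
    have h3 : -(x * Λ) ≤ x * Λ := by linarith [mul_pos hx hΛ0]
    rw [lintegral_boxSet z₀ (by positivity)
      (mul_le_mul_of_nonneg_left (Real.exp_le_exp.2 h3) ht0.le) (by positivity), hlog]
    congr 1
    rw [show 2 * (x * l) = x * (2 * l) by ring, mul_pow, pow_succ]
    ring
  refine ⟨modelFun Θ κ t Λ l z₀, c, ρ,
    boxSet z₀ (t * Real.exp (-(m * Λ))) (t * Real.exp (m * Λ)) (m * l),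
    boxSet z₀ (t * Real.exp (-(1 * Λ))) (t * Real.exp (1 * Λ)) (1 * l),
    hρ0, fun w hw => ⟨(hball (hcb hw)).2.2, (hcb hw).2⟩,
    contDiff_modelFun ht0 hΛ0 hl0, fun w => modelFun_nonneg,
    closure_minimal (support_modelFun_subset ht0 hΛ0 hl0) (isClosed_boxSet _ _ _ _), hSball,
    isClosed_boxSet _ _ _ _, isClosed_boxSet _ _ _ _, ?_, ?_, ?_, ?_, ?_⟩
  · intro w hw
    have h0 : 0 < w 0 := lt_of_lt_of_le (by positivity) hw.1.1
    exact (mem_boxSet_iff ht0 hΛ0 hl0 h0).2 fun i =>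
      ((mem_boxSet_iff ht0 hΛ0 hl0 h0).1 hw i).trans hm1
  · intro w hw
    have h0 : 0 < w 0 := lt_of_lt_of_le (by positivity) hw.1.1
    rw [modelFun_eq ht0 hΛ0 hl0 rfl hw, ← Real.rpow_mul h0.le, hκ, Real.rpow_natCast]
  · intro w hw
    have h0 : 0 < w 0 := lt_of_lt_of_le (by positivity) hw.1.1
    obtain ⟨hM0, hMK, -⟩ := hball (hcb (Metric.ball_subset_closedBall (hSball hw)))
    have hlw : w 0 * Λ ≤ l := by
      have h3 := mul_le_mul_of_nonneg_right hw.1.2 hΛ0.le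
      rw [hl]
      linarith
    exact sqrt_rpow_fderiv_modelFun_le ht0 hΛ0 hl0 h0 hlw hCΘ hp hκ hκ0 ha hε₁0.le hε₁1 hΛ1
      hε₂0.le hε₂ hε₁ hsq hM0 hMK
  · rw [hmass m hm0, hmass 1 one_pos, ← ENNReal.ofReal_mul (by positivity)]
    refine le_of_eq (congrArg _ ?_)
    ring
  · rw [hmass 1 one_pos]
    exact ENNReal.ofReal_pos.2 (by positivity)

end Model

/-! ### The volume measure in a chart -/

section Volume

variable {d : ℕ} [NeZero d] {M : Type*} [TopologicalSpace M]
  [ChartedSpace (EuclideanHalfSpace d) M]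

omit [NeZero d] in
lemma det_eq_det_matOf (J : EuclideanSpace ℝ (Fin d) →L[ℝ] EuclideanSpace ℝ (Fin d)) :
    J.det = (matOf J).det := by
  rw [ContinuousLinearMap.det, ← LinearMap.det_toMatrix (EuclideanSpace.basisFun (Fin d) ℝ).toBasis]
  congr 1

/-- The points of the domain of the chart at `a` in the interior of the manifold, in coordinates. -/
def chartDomain (d : ℕ) [NeZero d] {M : Type*} [TopologicalSpace M]
    [ChartedSpace (EuclideanHalfSpace d) M] (a : M) : Set (EuclideanSpace ℝ (Fin d)) :=
  (extChartAt (𝓡∂ d) a).target ∩ interior (range (𝓡∂ d))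

lemma isOpen_chartDomain (a : M) : IsOpen (chartDomain d a) := isOpen_target_inter_interior a

lemma continuousOn_symm_chartDomain (a : M) :
    ContinuousOn (extChartAt (𝓡∂ d) a).symm (chartDomain d a) :=
  (continuousOn_extChartAt_symm a).mono inter_subset_left

/-- The density of the Riemannian volume in the chart at `a`. -/
def chartDensity (h : MetricField d M) (a : M) (z : EuclideanSpace ℝ (Fin d)) : ENNReal :=
  ENNReal.ofReal (Real.sqrt (metricInChart h a z).det)

/-- The Riemannian volume of the domain of the chart at `a`. -/
def chartVolume [MeasurableSpace M] (h : MetricField d M) (a : M) : Measure M :=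
  Measure.map (extChartAt (𝓡∂ d) a).symm
    ((volume.restrict (chartDomain d a)).withDensity (chartDensity h a))

lemma volumeMeasure_eq [MeasurableSpace M] (h : MetricField d M) :
    volumeMeasure h = ⨆ a, chartVolume h a := rfl

variable [MeasurableSpace M] [BorelSpace M]

lemma aemeasurable_symm (h : MetricField d M) (a : M) :
    AEMeasurable (extChartAt (𝓡∂ d) a).symm
      ((volume.restrict (chartDomain d a)).withDensity (chartDensity h a)) :=
  ((continuousOn_symm_chartDomain a).aemeasurable
    (isOpen_chartDomain a).measurableSet).mono_ac (withDensity_absolutelyContinuous _ _)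

lemma measurableSet_preimage_symm (a : M) {S : Set M} (hS : MeasurableSet S) :
    MeasurableSet ((extChartAt (𝓡∂ d) a).symm ⁻¹' S ∩ chartDomain d a) := by
  have h := (isOpen_chartDomain (d := d) a).measurableSet.subtype_image
    ((continuousOn_symm_chartDomain (d := d) a).domRestrict.measurable hS)
  convert h using 1
  ext z
  simp only [mem_inter_iff, mem_preimage, mem_image, Subtype.exists, exists_and_right,
    exists_eq_right]
  exact ⟨fun hz => ⟨hz.2, hz.1⟩, fun ⟨h1, h2⟩ => ⟨h2, h1⟩⟩

lemma chartVolume_apply (h : MetricField d M) (a : M) {S : Set M} (hS : MeasurableSet S) :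
    chartVolume h a S
      = ∫⁻ z in (extChartAt (𝓡∂ d) a).symm ⁻¹' S ∩ chartDomain d a, chartDensity h a z := by
  rw [chartVolume, Measure.map_apply_of_aemeasurable (aemeasurable_symm h a) hS,
    withDensity_apply', Measure.restrict_restrict' (isOpen_chartDomain a).measurableSet]

variable [IsManifold (𝓡∂ d) ∞ M]

omit [MeasurableSpace M] [BorelSpace M] in
/-- The transformation law of the Riemannian density. -/
lemma chartDensity_trans (h : MetricField d M) {a b : M} {z : EuclideanSpace ℝ (Fin d)}
    (hz : z ∈ overlap d a b) : chartDensity h a z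
      = ENNReal.ofReal |(fderiv ℝ (trans d a b) z).det| * chartDensity h b (trans d a b z) := by
  have hm : metricInChart h a z = (matOf (fderiv ℝ (trans d a b) z))ᵀ
      * metricInChart h b (trans d a b z) * matOf (fderiv ℝ (trans d a b) z) := by
    ext i j
    rw [isMatrixOf_metricInChart h a z i j, chartBil_trans h hz]
    have h1 := bilin_expand (fderiv ℝ (trans d a b) z)
      (toLin₂ (chartBil h b (trans d a b z))) i j
    simp only [toLin₂_apply, smul_eq_mul] at h1
    change chartBil h b (trans d a b z) (fderiv ℝ (trans d a b) z (ev i))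
      (fderiv ℝ (trans d a b) z (ev j)) = _
    rw [h1]
    simp only [Matrix.mul_apply, Matrix.transpose_apply, Finset.sum_mul,
      isMatrixOf_metricInChart h b (trans d a b z) _ _]
    rw [Finset.sum_comm]
    exact Finset.sum_congr rfl fun x _ => Finset.sum_congr rfl fun y _ => by ring
  rw [chartDensity, chartDensity, ← ENNReal.ofReal_mul (abs_nonneg _), hm, Matrix.det_mul,
    Matrix.det_mul, Matrix.det_transpose, ← det_eq_det_matOf, ← Real.sqrt_sq_eq_abs,
    ← Real.sqrt_mul (sq_nonneg _)]
  congr 2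
  ring

/-- The volumes computed in two charts agree. -/
lemma chartVolume_le (h : MetricField d M) (a b : M) {S : Set M} (hS : MeasurableSet S)
    (hSb : S ⊆ (extChartAt (𝓡∂ d) b).source) : chartVolume h a S ≤ chartVolume h b S := by
  rw [chartVolume_apply h a hS, chartVolume_apply h b hS]
  set A := (extChartAt (𝓡∂ d) a).symm ⁻¹' S ∩ chartDomain d a with hA
  have hAm : MeasurableSet A := measurableSet_preimage_symm a hS
  have hAo : A ⊆ overlap d a b := fun z hz => ⟨hz.2.1, hz.2.2, hSb hz.1⟩
  have hinj : InjOn (trans d a b) A := fun z hz w hw hzw => by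
    rw [← trans_trans (hAo hz), ← trans_trans (hAo hw), hzw]
  have hd : ∀ z ∈ A, HasFDerivWithinAt (trans d a b) (fderiv ℝ (trans d a b) z) A z := fun z hz =>
    ((contDiffAt_trans (hAo hz)).differentiableAt (by norm_num)).hasFDerivAt.hasFDerivWithinAt
  calc ∫⁻ z in A, chartDensity h a z
      = ∫⁻ z in A, ENNReal.ofReal |(fderiv ℝ (trans d a b) z).det|
          * chartDensity h b (trans d a b z) :=
        setLIntegral_congr_fun hAm fun z hz => chartDensity_trans h (hAo hz)
    _ = ∫⁻ z in trans d a b '' A, chartDensity h b z :=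
        (lintegral_image_eq_lintegral_abs_det_fderiv_mul volume hAm hd hinj _).symm
    _ ≤ _ := by
        refine lintegral_mono_set ?_
        rintro _ ⟨z, hz, rfl⟩
        have h1 := trans_mem_overlap (hAo hz)
        refine ⟨?_, h1.1, h1.2.1⟩
        rw [mem_preimage, trans_self_mem (hAo hz)]
        exact hz.1

/-- In the domain of a chart the supremum that defines the volume is attained by that chart. -/
lemma volumeMeasure_restrict_le (h : MetricField d M) (b : M) {Ω : Set M} (hΩ : MeasurableSet Ω)
    (hΩb : Ω ⊆ (extChartAt (𝓡∂ d) b).source) :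
    (volumeMeasure h).restrict Ω ≤ chartVolume h b := by
  have h1 : volumeMeasure h ≤ (chartVolume h b).restrict Ω + (volumeMeasure h).restrict Ωᶜ := by
    rw [volumeMeasure_eq]
    refine iSup_le fun a => Measure.le_iff.2 fun S hS => ?_
    rw [Measure.add_apply, Measure.restrict_apply hS, Measure.restrict_apply hS,
      ← measure_inter_add_sdiff S hΩ]
    refine add_le_add (chartVolume_le h a b (hS.inter hΩ) (inter_subset_right.trans hΩb)) ?_
    rw [← volumeMeasure_eq]
    exact (le_iSup (fun a => chartVolume h a) a) _
  refine Measure.le_iff.2 fun S hS => ?_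
  rw [Measure.restrict_apply hS]
  refine (h1 _).trans ?_
  rw [Measure.add_apply, Measure.restrict_apply (hS.inter hΩ), Measure.restrict_apply (hS.inter hΩ),
    inter_assoc, inter_assoc, inter_compl_self, inter_empty, measure_empty, add_zero]
  exact measure_mono inter_subset_left

lemma lintegral_volumeMeasure_le (h : MetricField d M) (b : M) {Ω : Set M} (hΩ : MeasurableSet Ω)
    (hΩb : Ω ⊆ (extChartAt (𝓡∂ d) b).source) {S : Set (EuclideanSpace ℝ (Fin d))}
    (hS : MeasurableSet S) {G : M → ENNReal} {g ρ : EuclideanSpace ℝ (Fin d) → ENNReal}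
    (hρm : Measurable ρ)
    (hG : ∀ z ∈ chartDomain d b, G ((extChartAt (𝓡∂ d) b).symm z) ≤ S.indicator g z)
    (hρ : ∀ z ∈ S, chartDensity h b z ≤ ρ z) :
    ∫⁻ x in Ω, G x ∂(volumeMeasure h) ≤ ∫⁻ z in S, ρ z * g z := by
  set μ := (volume.restrict (chartDomain d b)).withDensity (chartDensity h b) with hμ
  have hae : ∀ᵐ z ∂μ, G ((extChartAt (𝓡∂ d) b).symm z) ≤ S.indicator g z := by
    refine (withDensity_absolutelyContinuous _ _).ae_le ?_
    filter_upwards [ae_restrict_mem (isOpen_chartDomain b).measurableSet] with z hz using hG z hz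
  calc ∫⁻ x in Ω, G x ∂(volumeMeasure h) ≤ ∫⁻ x, G x ∂(chartVolume h b) :=
        lintegral_mono' (volumeMeasure_restrict_le h b hΩ hΩb) le_rfl
    _ ≤ ∫⁻ z, G ((extChartAt (𝓡∂ d) b).symm z) ∂μ := lintegral_map_le _ _
    _ ≤ ∫⁻ z, S.indicator g z ∂μ := lintegral_mono_ae hae
    _ = ∫⁻ z in S, g z ∂μ := lintegral_indicator hS _
    _ ≤ ∫⁻ z, g z ∂((volume.restrict S).withDensity ρ) := by
        refine lintegral_mono' ?_ le_rfl
        rw [hμ, restrict_withDensity hS, Measure.restrict_restrict hS]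
        refine (withDensity_mono ?_).trans
          (Measure.le_iff.2 fun A hA => ?_) (b := ((volume.restrict (S ∩ chartDomain d b)).withDensity ρ))
        · filter_upwards [ae_restrict_mem (hS.inter (isOpen_chartDomain b).measurableSet)] with z hz
            using hρ z hz.1
        · rw [withDensity_apply _ hA, withDensity_apply _ hA]
          exact lintegral_mono' (Measure.restrict_mono le_rfl
            (Measure.restrict_mono inter_subset_left le_rfl)) le_rfl
    _ ≤ _ := lintegral_withDensity_le_lintegral_mul _ hρm g

omit [IsManifold (𝓡∂ d) ∞ M] in
lemma le_lintegral_volumeMeasure (h : MetricField d M) (b : M) {Ω : Set M} (hΩ : MeasurableSet Ω)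
    {S : Set (EuclideanSpace ℝ (Fin d))} (hS : MeasurableSet S) (hSb : S ⊆ chartDomain d b)
    (hSΩ : ∀ z ∈ S, (extChartAt (𝓡∂ d) b).symm z ∈ Ω) {F : M → ENNReal} (hF : Measurable F)
    {g ρ : EuclideanSpace ℝ (Fin d) → ENNReal} (hρm : Measurable ρ) (hgm : Measurable g)
    (hg : ∀ z ∈ S, g z ≤ F ((extChartAt (𝓡∂ d) b).symm z))
    (hρ : ∀ z ∈ S, ρ z ≤ chartDensity h b z) :
    ∫⁻ z in S, ρ z * g z ≤ ∫⁻ x in Ω, F x ∂(volumeMeasure h) := by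
  set μ := (volume.restrict (chartDomain d b)).withDensity (chartDensity h b) with hμ
  calc ∫⁻ z in S, ρ z * g z = ∫⁻ z, g z ∂((volume.restrict S).withDensity ρ) :=
        (lintegral_withDensity_eq_lintegral_mul _ hρm hgm).symm
    _ ≤ ∫⁻ z in S, g z ∂μ := by
        refine lintegral_mono' ?_ le_rfl
        rw [hμ, restrict_withDensity hS, Measure.restrict_restrict hS, inter_eq_left.2 hSb]
        refine withDensity_mono ?_
        filter_upwards [ae_restrict_mem hS] with z hz using hρ z hz
    _ = ∫⁻ z, S.indicator g z ∂μ := (lintegral_indicator hS _).symm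
    _ ≤ ∫⁻ z, Ω.indicator F ((extChartAt (𝓡∂ d) b).symm z) ∂μ := by
        refine lintegral_mono fun z => ?_
        by_cases hz : z ∈ S
        · rw [indicator_of_mem hz, indicator_of_mem (hSΩ z hz)]
          exact hg z hz
        · rw [indicator_of_notMem hz]; exact zero_le
    _ = ∫⁻ x, Ω.indicator F x ∂(chartVolume h b) :=
        (lintegral_map' (hF.indicator hΩ).aemeasurable (aemeasurable_symm h b)).symm
    _ ≤ ∫⁻ x, Ω.indicator F x ∂(volumeMeasure h) :=
        lintegral_mono' (le_iSup (fun a => chartVolume h a) b) le_rfl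
    _ = _ := lintegral_indicator hΩ _

end Volume

/-! ### Functions and domains supported in a chart -/

section Support

variable {d : ℕ} [NeZero d] {M : Type*} [TopologicalSpace M]
  [ChartedSpace (EuclideanHalfSpace d) M]

open scoped Classical in
/-- The function on the manifold that is `φ` in the chart at `a` and zero outside its domain. -/
def ofChart (d : ℕ) [NeZero d] {M : Type*} [TopologicalSpace M]
    [ChartedSpace (EuclideanHalfSpace d) M] (a : M) (φ : EuclideanSpace ℝ (Fin d) → ℝ) (x : M) : ℝ :=
  if x ∈ (extChartAt (𝓡∂ d) a).source then φ (extChartAt (𝓡∂ d) a x) else 0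

variable {a : M} {φ : EuclideanSpace ℝ (Fin d) → ℝ}

lemma ofChart_symm {z : EuclideanSpace ℝ (Fin d)} (hz : z ∈ (extChartAt (𝓡∂ d) a).target) :
    ofChart d a φ ((extChartAt (𝓡∂ d) a).symm z) = φ z := by
  rw [ofChart, if_pos ((extChartAt (𝓡∂ d) a).map_target hz), (extChartAt (𝓡∂ d) a).right_inv hz]

lemma isCompact_symm_image {K : Set (EuclideanSpace ℝ (Fin d))} (hK : IsCompact K)
    (hKt : K ⊆ (extChartAt (𝓡∂ d) a).target) :
    IsCompact ((extChartAt (𝓡∂ d) a).symm '' K) :=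
  hK.image_of_continuousOn ((continuousOn_extChartAt_symm a).mono hKt)

lemma support_ofChart_subset :
    Function.support (ofChart d a φ) ⊆ (extChartAt (𝓡∂ d) a).symm '' tsupport φ := by
  intro x hx
  rw [Function.mem_support, ofChart] at hx
  split_ifs at hx with h
  · exact ⟨_, subset_tsupport φ hx, (extChartAt (𝓡∂ d) a).left_inv h⟩
  · exact absurd rfl hx

lemma tsupport_ofChart_subset [T2Space M] (hc : HasCompactSupport φ)
    (ht : tsupport φ ⊆ (extChartAt (𝓡∂ d) a).target) :
    tsupport (ofChart d a φ) ⊆ (extChartAt (𝓡∂ d) a).symm '' tsupport φ :=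
  closure_minimal support_ofChart_subset (isCompact_symm_image hc ht).isClosed

lemma contMDiff_ofChart [T2Space M] [IsManifold (𝓡∂ d) ∞ M] (hφ : ContDiff ℝ ∞ φ)
    (hc : HasCompactSupport φ) (ht : tsupport φ ⊆ (extChartAt (𝓡∂ d) a).target) :
    ContMDiff (𝓡∂ d) 𝓘(ℝ, ℝ) ∞ (ofChart d a φ) := by
  intro x
  by_cases hx : x ∈ (extChartAt (𝓡∂ d) a).source
  · have e : ofChart d a φ =ᶠ[𝓝 x] φ ∘ extChartAt (𝓡∂ d) a := by
      filter_upwards [(isOpen_extChartAt_source (I := 𝓡∂ d) a).mem_nhds hx] with y hy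
      rw [ofChart, if_pos hy, Function.comp_apply]
    refine ContMDiffAt.congr_of_eventuallyEq ?_ e
    exact hφ.contMDiff.contMDiffAt.comp x
      (contMDiffAt_extChartAt' (by rwa [← extChartAt_source (I := 𝓡∂ d)]))
  · have hx' : x ∉ (extChartAt (𝓡∂ d) a).symm '' tsupport φ := by
      rintro ⟨z, hz, rfl⟩
      exact hx ((extChartAt (𝓡∂ d) a).map_target (ht hz))
    have e : ofChart d a φ =ᶠ[𝓝 x] fun _ => 0 := by
      filter_upwards [(isCompact_symm_image hc ht).isClosed.isOpen_compl.mem_nhds hx'] with y hy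
      by_contra h
      exact hy (support_ofChart_subset h)
    exact contMDiffAt_const.congr_of_eventuallyEq e

variable [IsManifold (𝓡∂ d) ∞ M]

/-- The differential of a function in a chart. -/
lemma differential_frame {f : M → ℝ} (hf : ContMDiff (𝓡∂ d) 𝓘(ℝ, ℝ) ∞ f)
    {z : EuclideanSpace ℝ (Fin d)} (hz : z ∈ chartDomain d a) (v : EuclideanSpace ℝ (Fin d)) :
    differential f ((extChartAt (𝓡∂ d) a).symm z) (frame d a z v)
      = fderiv ℝ (inChart d f a) z v := by
  have hU : UniqueMDiffWithinAt 𝓘(ℝ, EuclideanSpace ℝ (Fin d)) (range (𝓡∂ d)) z :=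
    (𝓡∂ d).uniqueMDiffOn _ (interior_subset hz.2)
  have h1 : (mfderiv (𝓡∂ d) 𝓘(ℝ, ℝ) f ((extChartAt (𝓡∂ d) a).symm z)).comp
      (mfderivWithin 𝓘(ℝ, EuclideanSpace ℝ (Fin d)) (𝓡∂ d)
        (extChartAt (𝓡∂ d) a).symm (range (𝓡∂ d)) z) = fderiv ℝ (inChart d f a) z := by
    rw [← mfderiv_comp_mfderivWithin z ((hf _).mdifferentiableAt (by simp))
      (mdifferentiableWithinAt_extChartAt_symm hz.1) hU, mfderivWithin_eq_fderivWithin]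
    exact fderivWithin_of_mem_interior hz.2
  exact DFunLike.congr_fun h1 v

/-- The length of the differential of a function, computed in a chart. -/
lemma covectorNorm_differential (h : MetricField d M) {f : M → ℝ}
    (hf : ContMDiff (𝓡∂ d) 𝓘(ℝ, ℝ) ∞ f) {z : EuclideanSpace ℝ (Fin d)}
    (hz : z ∈ chartDomain d a) :
    covectorNorm h ((extChartAt (𝓡∂ d) a).symm z) (differential f ((extChartAt (𝓡∂ d) a).symm z))
      = Real.sqrt (∑ i, ∑ j, (metricInChart h a z)⁻¹ i j * fderiv ℝ (inChart d f a) z (ev i)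
          * fderiv ℝ (inChart d f a) z (ev j)) := by
  set x := (extChartAt (𝓡∂ d) a).symm z with hx
  obtain ⟨J', hJ', hJ''⟩ : ∃ J', (frame d a z).comp J' = ContinuousLinearMap.id ℝ _ ∧
      J'.comp (frame d a z) = ContinuousLinearMap.id ℝ _ := by
    obtain ⟨e, he⟩ := isInvertible_frame (d := d) hz.1
    refine ⟨e.symm, ?_, ?_⟩ <;> rw [← he] <;> ext1 v
    · exact e.apply_symm_apply v
    · exact e.symm_apply_apply v
  let η : EuclideanSpace ℝ (Fin d) →L[ℝ] ℝ := differential f x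
  have h1 := traceM_comp (isUnit_det_matOf hJ') (toLin₂ (atPoint h x))
    (toLin₂ (η.smulRight η : EuclideanSpace ℝ (Fin d) →L[ℝ] EuclideanSpace ℝ (Fin d) →L[ℝ] ℝ))
  have hη : ∀ v, η (frame d a z v) = fderiv ℝ (inChart d f a) z v := differential_frame hf hz
  rw [covectorNorm]
  congr 1
  have e1 : ∑ i, ∑ j, (gram h x)⁻¹ i j * differential f x (basisVec x i)
        * differential f x (basisVec x j)
      = traceM (Matrix.of fun α β => toLin₂ (atPoint h x) (ev α) (ev β)) fun α β =>
        toLin₂ (η.smulRight η : EuclideanSpace ℝ (Fin d) →L[ℝ] EuclideanSpace ℝ (Fin d) →L[ℝ] ℝ)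
          (ev α) (ev β) :=
    Finset.sum_congr rfl fun i _ => Finset.sum_congr rfl fun j _ => mul_assoc _ _ _
  rw [e1, ← h1]
  refine Finset.sum_congr rfl fun i _ => Finset.sum_congr rfl fun j _ => ?_
  change (metricInChart h a z)⁻¹ i j * (η (frame d a z (ev i)) * η (frame d a z (ev j))) = _
  rw [hη, hη, mul_assoc]

variable [T2Space M]

/-- The image of a Euclidean ball under a chart is a bounded domain with smooth boundary. -/
lemma isBoundedSmoothDomain_ball [CompactSpace M] {c : EuclideanSpace ℝ (Fin d)} {ρ : ℝ}
    (hρ : 0 < ρ) (hc : Metric.closedBall c ρ ⊆ chartDomain d a) :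
    IsBoundedSmoothDomain d ((extChartAt (𝓡∂ d) a).symm '' Metric.ball c ρ) := by
  have hbt : Metric.ball c ρ ⊆ (extChartAt (𝓡∂ d) a).target := fun z hz =>
    (hc (Metric.ball_subset_closedBall hz)).1
  have hct : Metric.closedBall c ρ ⊆ (extChartAt (𝓡∂ d) a).target := fun z hz => (hc hz).1
  have hΩ : (extChartAt (𝓡∂ d) a).symm '' Metric.ball c ρ
      = (extChartAt (𝓡∂ d) a).source ∩ extChartAt (𝓡∂ d) a ⁻¹' Metric.ball c ρ :=
    PartialEquiv.symm_image_eq_source_inter_preimage _ hbt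
  have hopen : IsOpen ((extChartAt (𝓡∂ d) a).symm '' Metric.ball c ρ) := by
    rw [hΩ]
    exact (continuousOn_extChartAt a).isOpen_inter_preimage (isOpen_extChartAt_source a)
      Metric.isOpen_ball
  have hcl : closure ((extChartAt (𝓡∂ d) a).symm '' Metric.ball c ρ)
      ⊆ (extChartAt (𝓡∂ d) a).symm '' Metric.closedBall c ρ :=
    closure_minimal (image_mono Metric.ball_subset_closedBall)
      (isCompact_symm_image (isCompact_closedBall c ρ) hct).isClosed
  refine ⟨hopen, ?_, isClosed_closure.isCompact, fun x hx => ?_, fun q hq => ?_⟩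
  · exact ((convex_ball c ρ).isConnected (Metric.nonempty_ball.2 hρ)).image _
      ((continuousOn_extChartAt_symm a).mono hbt)
  · obtain ⟨z, hz, rfl⟩ := hcl hx
    exact (symm_mem_interiorSet_iff (hc hz).1).2 (hc hz).2
  · obtain ⟨z, hz, rfl⟩ := hcl (frontier_subset_closure hq)
    have hzb : z ∉ Metric.ball c ρ := fun h => by
      rw [hopen.frontier_eq] at hq
      exact hq.2 ⟨z, h, rfl⟩
    have hzc : z - c ≠ 0 := fun h => hzb (by
      rw [mem_ball_iff_norm, h, norm_zero]; exact hρ)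
    -- a cut-off of the defining function `|w - c|² - ρ²` of the ball
    obtain ⟨s, hs, hsb⟩ := Metric.isOpen_iff.1 (isOpen_chartDomain (d := d) a) z (hc hz)
    let Θ : ContDiffBump z := ⟨s / 4, s / 2, by positivity, by linarith⟩
    set φ : EuclideanSpace ℝ (Fin d) → ℝ := fun w => Θ w * (‖w - c‖ ^ 2 - ρ ^ 2) with hφ
    have hφd : ContDiff ℝ ∞ φ :=
      Θ.contDiff.mul (((contDiff_id.sub contDiff_const).norm_sq ℝ).sub contDiff_const)
    have hφc : HasCompactSupport φ := Θ.hasCompactSupport.mul_right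
    have hφt : tsupport φ ⊆ (extChartAt (𝓡∂ d) a).target := by
      refine (tsupport_mul_subset_left (f := Θ)).trans ?_
      rw [Θ.tsupport_eq]
      exact fun w hw => (hsb (Metric.closedBall_subset_ball (by simp [Θ]; linarith) hw)).1
    have hu := contMDiff_ofChart (a := a) hφd hφc hφt
    have hΘ1 : ∀ᶠ w in 𝓝 z, Θ w = 1 := Θ.eventuallyEq_one
    refine ⟨ofChart d a φ, hu, fun h0 => ?_, ?_⟩
    · have e : inChart d (ofChart d a φ) a =ᶠ[𝓝 z] fun w => ‖w - c‖ ^ 2 - ρ ^ 2 := by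
        filter_upwards [hΘ1, (isOpen_chartDomain a).mem_nhds (hc hz)] with w hw hw'
        rw [inChart, Function.comp_apply, ofChart_symm hw'.1, hφ]
        simp only [hw, one_mul]
      have h1 := differential_frame hu (hc hz) (z - c)
      rw [differential, h0, e.fderiv_eq] at h1
      have h2 : HasFDerivAt (fun w : EuclideanSpace ℝ (Fin d) => ‖w - c‖ ^ 2 - ρ ^ 2)
          (2 • (innerSL ℝ (z - c)).comp (ContinuousLinearMap.id ℝ _)) z :=
        (((hasFDerivAt_id z).sub_const c).norm_sq).sub_const _
      rw [h2.fderiv] at h1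
      have h3 : (0 : ℝ) = 2 * ‖z - c‖ ^ 2 := by
        rw [← real_inner_self_eq_norm_sq]
        refine Eq.trans h1 ?_
        rw [smul_apply, ContinuousLinearMap.comp_apply, ContinuousLinearMap.id_apply,
          innerSL_apply_apply, nsmul_eq_mul, Nat.cast_ofNat]
      have h4 := norm_pos_iff.2 hzc
      nlinarith
    · have hs' : (extChartAt (𝓡∂ d) a).symm z ∈ (extChartAt (𝓡∂ d) a).source :=
        (extChartAt (𝓡∂ d) a).map_target (hc hz).1
      have hcont : ContinuousAt (extChartAt (𝓡∂ d) a) ((extChartAt (𝓡∂ d) a).symm z) :=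
        continuousAt_extChartAt' hs'
      have h1 : ∀ᶠ x in 𝓝 ((extChartAt (𝓡∂ d) a).symm z), Θ (extChartAt (𝓡∂ d) a x) = 1 := by
        refine hcont.eventually (p := fun w => Θ w = 1) ?_
        rwa [(extChartAt (𝓡∂ d) a).right_inv (hc hz).1]
      filter_upwards [h1, (isOpen_extChartAt_source a).mem_nhds hs'] with x hx hxs
      rw [hΩ, ofChart, if_pos hxs, hφ]
      simp only [hx, one_mul, mem_inter_iff, hxs, true_and, mem_preimage, mem_ball_iff_norm]
      rw [sub_neg, pow_lt_pow_iff_left₀ (norm_nonneg _) hρ.le two_ne_zero]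

end Support

/-! ### The first eigenvalue of a metric that is asymptotic to a hyperbolic metric -/

section Eigenvalue

variable {k : ℕ} {M : Type*} [TopologicalSpace M] [ChartedSpace (EuclideanHalfSpace (k + 1)) M]

lemma covectorNorm_zero (h : MetricField (k + 1) M) (x : M) : covectorNorm h x 0 = 0 := by
  rw [covectorNorm]
  simp

/-- A test function belongs to `W_0^{1,p}`. -/
lemma IsTestFunction.memSobolevZero [MeasurableSpace M] {Ω : Set M} {f : M → ℝ}
    (hf : IsTestFunction (k + 1) Ω f) (h : MetricField (k + 1) M) (p : ℝ) :
    MemSobolevZero h p Ω f (differential f) := by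
  refine ⟨fun _ => f, fun _ => hf, fun _ => ?_, fun _ => ?_, ?_, ?_⟩ <;>
    simp [covectorNorm_zero]

variable [T2Space M] [CompactSpace M] [IsManifold (𝓡∂ (k + 1)) ∞ M] [MeasurableSpace M]
  [BorelSpace M]

/-- If the metric is, near a boundary point, comparable to a hyperbolic metric of the half-space and
the length of `dw₀ / w₀` tends to `a`, then the functions `w₀^(k/p)` cut off near the boundary point
show that the first eigenvalue is at most `(k a / p)^p`. -/
lemma firstEigenvalue_le (h : MetricField (k + 1) M) {y₀ : M} (hy₀ : y₀ ∈ boundarySet (k + 1) M)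
    {κ a p K D₁ D₂ : ℝ} (hp : 0 < p) (hκ : κ * p = k) (hκ0 : 0 ≤ κ) (ha : 0 ≤ a) (hD₁ : 0 < D₁)
    (h1 : ∀ ε > 0, ∀ᶠ w in 𝓝[interior (halfSpace (k + 1))] (extChartAt (𝓡∂ (k + 1)) y₀ y₀),
      (metricInChart h y₀ w)⁻¹ 0 0 ≤ w 0 ^ 2 * (a ^ 2 + ε))
    (h2 : ∀ᶠ w in 𝓝[interior (halfSpace (k + 1))] (extChartAt (𝓡∂ (k + 1)) y₀ y₀),
      ∀ i j, |(metricInChart h y₀ w)⁻¹ i j| ≤ K * w 0 ^ 2)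
    (h3 : ∀ᶠ w in 𝓝[interior (halfSpace (k + 1))] (extChartAt (𝓡∂ (k + 1)) y₀ y₀),
      Real.sqrt (metricInChart h y₀ w).det * w 0 ^ (k + 1) ∈ Icc D₁ D₂) :
    firstEigenvalue h p ≤ ENNReal.ofReal ((κ * a) ^ p) := by
  have hz₀ : extChartAt (𝓡∂ (k + 1)) y₀ y₀ 0 = 0 :=
    (mem_boundarySet_iff (mem_extChartAt_source y₀)).1 hy₀
  have hD₂ : 0 < D₂ := by
    obtain ⟨w, hw⟩ := h3.exists
    exact hD₁.trans_le (hw.1.trans hw.2)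
  refine ENNReal.le_of_forall_pos_le_add fun η hη _ => ?_
  set m : ℝ := (2 * Real.sqrt (k + 1)) ^ (k + 1) with hm
  have hm0 : 0 < m := by
    have : 0 < Real.sqrt ((k : ℝ) + 1) := Real.sqrt_pos.2 (by positivity)
    positivity
  have hη' : 0 < (η : ℝ) := hη
  set δ : ℝ := η * D₁ / (D₂ * m) with hδ
  have hδ0 : 0 < δ := by positivity
  obtain ⟨φ, c, ρ, S, S', hρ0, hcb, hφd, hφ0, hφS, hSb, hSc, hS'c, hS'S, hφS', hφle, hmass, hmass0⟩ :=
    exists_test_function hz₀ hp hκ hκ0 ha h1 h2 ((eventually_mem_target y₀).and h3) hδ0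
  have hcbd : Metric.closedBall c ρ ⊆ chartDomain (k + 1) y₀ := fun z hz => (hcb hz).1.1
  have hbd : ∀ z ∈ Metric.ball c ρ, z ∈ chartDomain (k + 1) y₀ := fun z hz =>
    hcbd (Metric.ball_subset_closedBall hz)
  have hdens : ∀ z ∈ S, Real.sqrt (metricInChart h y₀ z).det * z 0 ^ (k + 1) ∈ Icc D₁ D₂ :=
    fun z hz => (hcb (Metric.ball_subset_closedBall (hSb hz))).1.2
  have hpos : ∀ z ∈ S, 0 < z 0 := fun z hz =>
    mem_interior_halfSpace.1 (hbd z (hSb hz)).2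
  set Ω : Set M := (extChartAt (𝓡∂ (k + 1)) y₀).symm '' Metric.ball c ρ with hΩ
  have hdom : IsBoundedSmoothDomain (k + 1) Ω := isBoundedSmoothDomain_ball hρ0 hcbd
  have hΩm : MeasurableSet Ω := hdom.isOpen.measurableSet
  have hΩs : Ω ⊆ (extChartAt (𝓡∂ (k + 1)) y₀).source := by
    rintro _ ⟨z, hz, rfl⟩
    exact (extChartAt (𝓡∂ (k + 1)) y₀).map_target (hbd z hz).1
  have hφt : tsupport φ ⊆ (extChartAt (𝓡∂ (k + 1)) y₀).target := fun z hz =>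
    (hbd z (hSb (hφS hz))).1
  have hφc : HasCompactSupport φ :=
    (isCompact_closedBall c ρ).of_isClosed_subset (isClosed_tsupport φ)
      ((hφS.trans hSb).trans Metric.ball_subset_closedBall)
  set f : M → ℝ := ofChart (k + 1) y₀ φ with hf
  have hfs : ContMDiff (𝓡∂ (k + 1)) 𝓘(ℝ, ℝ) ∞ f := contMDiff_ofChart hφd hφc hφt
  have hfT : IsTestFunction (k + 1) Ω f := ⟨hfs, HasCompactSupport.of_compactSpace f,
    (tsupport_ofChart_subset hφc hφt).trans (image_mono (hφS.trans hSb))⟩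
  have hfsymm : ∀ z ∈ Metric.ball c ρ, f ((extChartAt (𝓡∂ (k + 1)) y₀).symm z) = φ z := fun z hz =>
    ofChart_symm (hbd z hz).1
  have hfd : ∀ z ∈ Metric.ball c ρ, fderiv ℝ (inChart (k + 1) f y₀) z = fderiv ℝ φ z := by
    intro z hz
    refine Filter.EventuallyEq.fderiv_eq ?_
    filter_upwards [Metric.isOpen_ball.mem_nhds hz] with w hw using hfsymm w hw
  have hm0' : Measurable fun z : EuclideanSpace ℝ (Fin (k + 1)) => z 0 :=
    (EuclideanSpace.proj (𝕜 := ℝ) (0 : Fin (k + 1))).continuous.measurable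
  have hmk : Measurable fun z : EuclideanSpace ℝ (Fin (k + 1)) => ENNReal.ofReal (z 0 ^ k) :=
    (hm0'.pow_const k).ennreal_ofReal
  have hmD : ∀ D : ℝ, Measurable fun z : EuclideanSpace ℝ (Fin (k + 1)) =>
      ENNReal.ofReal (D * (z 0 ^ (k + 1))⁻¹) := fun D =>
    ((hm0'.pow_const (k + 1)).inv.const_mul D).ennreal_ofReal
  have hmi : Measurable fun z : EuclideanSpace ℝ (Fin (k + 1)) => ENNReal.ofReal (z 0)⁻¹ :=
    hm0'.inv.ennreal_ofReal
  have hmul : ∀ D : ℝ, 0 ≤ D → ∀ z ∈ S, ENNReal.ofReal (D * (z 0 ^ (k + 1))⁻¹)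
      * ENNReal.ofReal (z 0 ^ k) = ENNReal.ofReal D * ENNReal.ofReal (z 0)⁻¹ := by
    intro D hD z hz
    have := hpos z hz
    rw [← ENNReal.ofReal_mul (by positivity), ← ENNReal.ofReal_mul hD]
    congr 1
    field_simp
    ring
  set I := ∫⁻ x in Ω, ENNReal.ofReal (|f x| ^ p) ∂(volumeMeasure h) with hI
  have hFm : Measurable fun x => ENNReal.ofReal (|f x| ^ p) :=
    ((hfs.continuous.abs).rpow_const fun _ => Or.inr hp.le).measurable.ennreal_ofReal
  -- lower bound for the denominator of the Rayleigh quotient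
  have hIge : ENNReal.ofReal D₁ * ∫⁻ w in S', ENNReal.ofReal (w 0)⁻¹ ≤ I := by
    have hle := le_lintegral_volumeMeasure h y₀ hΩm hS'c.measurableSet
      (fun z hz => hbd z (hSb (hS'S hz))) (fun z hz => ⟨z, hSb (hS'S hz), rfl⟩) hFm (hmD D₁) hmk
      (fun z hz => by
        rw [hfsymm z (hSb (hS'S hz)), abs_of_nonneg (hφ0 z), hφS' z hz])
      (fun z hz => by
        have h0 := hpos z (hS'S hz)
        refine ENNReal.ofReal_le_ofReal ?_
        rw [← div_eq_mul_inv, div_le_iff₀ (by positivity)]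
        exact (hdens z (hS'S hz)).1)
    rw [setLIntegral_congr_fun hS'c.measurableSet fun z hz => hmul D₁ hD₁.le z (hS'S hz),
      lintegral_const_mul _ hmi] at hle
    exact hle
  have hIpos : 0 < I := lt_of_lt_of_le
    (ENNReal.mul_pos (ENNReal.ofReal_pos.2 hD₁).ne' hmass0.ne') hIge
  -- the error term of the numerator
  classical
  set G : M → ENNReal := fun x => if extChartAt (𝓡∂ (k + 1)) y₀ x ∈ S then
    ENNReal.ofReal δ * ENNReal.ofReal (extChartAt (𝓡∂ (k + 1)) y₀ x 0 ^ k) else 0 with hG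
  have hGle : ∫⁻ x in Ω, G x ∂(volumeMeasure h) ≤ η * I := by
    have hle := lintegral_volumeMeasure_le h y₀ hΩm hΩs hSc.measurableSet (G := G)
      (g := fun z => ENNReal.ofReal δ * ENNReal.ofReal (z 0 ^ k)) (hmD D₂)
      (fun z hz => by
        simp only [hG, (extChartAt (𝓡∂ (k + 1)) y₀).right_inv hz.1]
        rw [indicator_apply])
      (fun z hz => by
        have h0 := hpos z hz
        refine ENNReal.ofReal_le_ofReal ?_
        rw [← div_eq_mul_inv, le_div_iff₀ (by positivity)]
        exact (hdens z hz).2)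
    refine hle.trans ?_
    rw [setLIntegral_congr_fun (g := fun z => (ENNReal.ofReal δ * ENNReal.ofReal D₂)
        * ENNReal.ofReal (z 0)⁻¹) hSc.measurableSet fun z hz => by
      dsimp only
      rw [mul_left_comm, hmul D₂ hD₂.le z hz, mul_assoc],
      lintegral_const_mul _ hmi]
    calc _ ≤ (ENNReal.ofReal δ * ENNReal.ofReal D₂) * (ENNReal.ofReal m
          * ∫⁻ w in S', ENNReal.ofReal (w 0)⁻¹) := by gcongr
      _ = ENNReal.ofReal (η : ℝ) * (ENNReal.ofReal D₁ * ∫⁻ w in S', ENNReal.ofReal (w 0)⁻¹) := by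
          rw [← mul_assoc, ← mul_assoc, ← ENNReal.ofReal_mul hδ0.le,
            ← ENNReal.ofReal_mul (by positivity), ← ENNReal.ofReal_mul hη'.le]
          congr 2
          rw [hδ]
          field_simp
      _ ≤ η * I := by
          rw [ENNReal.ofReal_coe_nnreal]
          gcongr
  have hpt : ∀ x ∈ Ω, ENNReal.ofReal (covectorNorm h x (differential f x) ^ p)
      ≤ ENNReal.ofReal ((κ * a) ^ p) * ENNReal.ofReal (|f x| ^ p) + G x := by
    rintro _ ⟨z, hz, rfl⟩
    rw [covectorNorm_differential h hfs (hbd z hz), hfsymm z hz, hfd z hz, abs_of_nonneg (hφ0 z)]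
    simp only [hG, (extChartAt (𝓡∂ (k + 1)) y₀).right_inv (hbd z hz).1]
    by_cases hzS : z ∈ S
    · have h0 := hpos z hzS
      have hφz := Real.rpow_nonneg (hφ0 z) p
      rw [if_pos hzS, ← ENNReal.ofReal_mul (by positivity), ← ENNReal.ofReal_mul hδ0.le,
        ← ENNReal.ofReal_add (by positivity) (by positivity)]
      exact ENNReal.ofReal_le_ofReal (hφle z hzS)
    · have h0 : fderiv ℝ φ z = 0 := by
        by_contra hne
        exact hzS (hφS (support_fderiv_subset ℝ (f := φ) hne))
      rw [h0]
      simp [Real.zero_rpow hp.ne']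
  have hN : ∫⁻ x in Ω, ENNReal.ofReal (covectorNorm h x (differential f x) ^ p) ∂(volumeMeasure h)
      ≤ (ENNReal.ofReal ((κ * a) ^ p) + η) * I := by
    refine (setLIntegral_mono' hΩm hpt).trans ?_
    rw [lintegral_add_left (hFm.const_mul _), lintegral_const_mul _ hFm, add_mul]
    gcongr
  have hne : ¬ f =ᵐ[(volumeMeasure h).restrict Ω] 0 := by
    intro h0
    refine hIpos.ne' ?_
    rw [hI, lintegral_congr_ae (g := 0) ?_]
    · simp
    · filter_upwards [h0] with x hx
      simp [hx, Real.zero_rpow hp.ne']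
  refine (iInf₂_le Ω hdom).trans ?_
  refine (iInf₂_le f (differential f)).trans ?_
  refine (iInf₂_le (hfT.memSobolevZero h p) hne).trans ?_
  exact ENNReal.div_le_of_le_mul hN

end Eigenvalue

/-! ### Functions that vanish on the boundary -/

section BoundaryFunctions

variable {d : ℕ} [NeZero d] {f : EuclideanSpace ℝ (Fin d) → ℝ} {z₀ : EuclideanSpace ℝ (Fin d)}

lemma convex_halfSpace : Convex ℝ (halfSpace d) := by
  have h : halfSpace d = (EuclideanSpace.proj (𝕜 := ℝ) (0 : Fin d)) ⁻¹' Ici 0 :=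
    Set.ext fun z => mem_halfSpace
  rw [h]
  exact (convex_Ici (0 : ℝ)).is_linear_preimage (EuclideanSpace.proj (𝕜 := ℝ) (0 : Fin d)).isLinear

/-- The derivatives along the boundary of a function that vanishes on the boundary are zero. -/
lemma fderivWithin_apply_of_zero (hf : DifferentiableWithinAt ℝ f (halfSpace d) z₀) (hz₀ : z₀ 0 = 0)
    (h0 : ∀ᶠ z in 𝓝[halfSpace d] z₀, z 0 = 0 → f z = 0) {v : EuclideanSpace ℝ (Fin d)}
    (hv : v 0 = 0) : fderivWithin ℝ f (halfSpace d) z₀ v = 0 := by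
  have hγ : HasDerivAt (fun t : ℝ => z₀ + t • v) v 0 := by
    simpa using ((hasDerivAt_id (0 : ℝ)).smul_const v).const_add z₀
  have hγ0 : ∀ t : ℝ, (z₀ + t • v) 0 = 0 := fun t => by simp [hz₀, hv]
  have hmem : ∀ t : ℝ, z₀ + t • v ∈ halfSpace d := fun t => mem_halfSpace.2 (hγ0 t).ge
  have hz : z₀ + (0 : ℝ) • v = z₀ := by simp
  have h1 : HasDerivAt (f ∘ fun t : ℝ => z₀ + t • v) (fderivWithin ℝ f (halfSpace d) z₀ v) 0 :=
    HasFDerivWithinAt.comp_hasDerivAt_of_eq 0 hf.hasFDerivWithinAt hγ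
      (Eventually.of_forall hmem) hz.symm
  have hγc : Tendsto (fun t : ℝ => z₀ + t • v) (𝓝 0) (𝓝[halfSpace d] z₀) := by
    refine tendsto_nhdsWithin_iff.2 ⟨?_, Eventually.of_forall hmem⟩
    have := hγ.continuousAt.tendsto
    rwa [hz] at this
  have h2 : (f ∘ fun t : ℝ => z₀ + t • v) =ᶠ[𝓝 0] fun _ => 0 := by
    filter_upwards [hγc.eventually h0] with t ht using ht (hγ0 t)
  exact h1.unique ((hasDerivAt_const (0 : ℝ) (0 : ℝ)).congr_of_eventuallyEq h2)

lemma fderivWithin_apply_eq (hf : DifferentiableWithinAt ℝ f (halfSpace d) z₀) (hz₀ : z₀ 0 = 0)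
    (h0 : ∀ᶠ z in 𝓝[halfSpace d] z₀, z 0 = 0 → f z = 0) (v : EuclideanSpace ℝ (Fin d)) :
    fderivWithin ℝ f (halfSpace d) z₀ v = v 0 * fderivWithin ℝ f (halfSpace d) z₀ (ev 0) := by
  have h := fderivWithin_apply_of_zero hf hz₀ h0 (v := v - v 0 • ev 0) (by simp [ev])
  rw [map_sub, map_smul, smul_eq_mul, sub_eq_zero] at h
  exact h

/-- A function that vanishes on the boundary is, near a boundary point, asymptotic to a multiple of
the coordinate `w₀`. -/
lemma tendsto_div_of_zero (hf : ContDiffWithinAt ℝ 1 f (halfSpace d) z₀) (hz₀ : z₀ 0 = 0)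
    (h0 : ∀ᶠ z in 𝓝[halfSpace d] z₀, z 0 = 0 → f z = 0) :
    Tendsto (fun z => f z / z 0) (𝓝[interior (halfSpace d)] z₀)
      (𝓝 (fderivWithin ℝ f (halfSpace d) z₀ (ev 0))) := by
  have hzs : z₀ ∈ halfSpace d := mem_halfSpace.2 hz₀.ge
  have hd := hf.differentiableWithinAt (by norm_num)
  have hc : ContinuousWithinAt (fderivWithin ℝ f (halfSpace d)) (halfSpace d) z₀ :=
    (hf.fderivWithin_right (m := 0) uniqueDiffOn_halfSpace (by simp) hzs).continuousWithinAt
  have hev := hf.eventually (by simp)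
  rw [insert_eq_of_mem hzs] at hev
  refine Metric.tendsto_nhds.2 fun ε hε => ?_
  obtain ⟨s, hs, hsb⟩ := Metric.mem_nhdsWithin_iff.1
    ((h0.and (hev.and (Metric.tendsto_nhds.1 hc (ε / 2) (by positivity)))))
  have hball : Metric.ball z₀ s ∈ 𝓝[interior (halfSpace d)] z₀ :=
    mem_nhdsWithin_of_mem_nhds (Metric.ball_mem_nhds z₀ hs)
  filter_upwards [hball, self_mem_nhdsWithin] with w hw hwi
  have hw0 : 0 < w 0 := mem_interior_halfSpace.1 hwi
  -- comparison with the boundary point below `w`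
  set w' : EuclideanSpace ℝ (Fin d) := w - w 0 • ev 0 with hw'
  have hw'0 : w' 0 = 0 := by simp [hw', ev]
  have hw'b : w' ∈ Metric.ball z₀ s ∩ halfSpace d := by
    refine ⟨?_, mem_halfSpace.2 hw'0.ge⟩
    rw [mem_ball_iff_norm] at hw ⊢
    refine lt_of_le_of_lt ?_ hw
    rw [EuclideanSpace.norm_eq, EuclideanSpace.norm_eq]
    refine Real.sqrt_le_sqrt (Finset.sum_le_sum fun i _ => ?_)
    by_cases hi : i = 0
    · subst hi
      rw [PiLp.sub_apply, hw'0, hz₀, sub_zero, norm_zero, zero_pow two_ne_zero]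
      positivity
    · have : (w' - z₀) i = (w - z₀) i := by simp [hw', ev, hi]
      rw [this]
  have hb := ((convex_ball z₀ s).inter convex_halfSpace).norm_image_sub_le_of_norm_hasFDerivWithin_le'
    (f := f) (f' := fderivWithin ℝ f (halfSpace d)) (φ := fderivWithin ℝ f (halfSpace d) z₀)
    (C := ε / 2)
    (fun x hx => (((hsb hx).2.1.differentiableWithinAt (by norm_num)).hasFDerivWithinAt).mono
      inter_subset_right)
    (fun x hx => by rw [← dist_eq_norm]; exact (hsb hx).2.2.le) hw'b ⟨hw, interior_subset hwi⟩
  have e1 : w - w' = w 0 • ev 0 := by rw [hw']; abel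
  have e2 : ‖(ev 0 : EuclideanSpace ℝ (Fin d))‖ = 1 := by simp [ev]
  rw [(hsb hw'b).1 hw'0, sub_zero, e1, map_smul, norm_smul, e2, mul_one, smul_eq_mul,
    Real.norm_eq_abs, Real.norm_eq_abs, abs_of_pos hw0] at hb
  rw [Real.dist_eq]
  have e3 : f w / w 0 - fderivWithin ℝ f (halfSpace d) z₀ (ev 0)
      = (f w - w 0 * fderivWithin ℝ f (halfSpace d) z₀ (ev 0)) / w 0 := by field_simp
  rw [e3, abs_div, abs_of_pos hw0, div_lt_iff₀ hw0]
  refine hb.trans_lt ?_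
  exact mul_lt_mul_of_pos_right (by linarith) hw0

end BoundaryFunctions

/-! ### The induced metric in charts -/

lemma posDef_gramOf {E : Type*} [NormedAddCommGroup E] [NormedSpace ℝ E] {e : ℕ} {G : Bil E}
    (hG : IsInner G) {L : EuclideanSpace ℝ (Fin e) →L[ℝ] E} (hL : Function.Injective L) :
    (gramOf G L).PosDef := by
  refine Matrix.PosDef.of_dotProduct_mulVec_pos ?_ fun x hx => ?_
  · rw [Matrix.IsHermitian, Matrix.conjTranspose_eq_transpose_of_trivial, gramOf_transpose hG]
  · rw [star_trivial, gramOf_mulVec]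
    refine hG.pos _ fun h => hx ?_
    have h1 := hL (h.trans (map_zero L).symm)
    exact congrArg WithLp.ofLp h1

section Submanifold

variable {d e : ℕ} [NeZero d] [NeZero e]
  {X : Type*} [TopologicalSpace X] [ChartedSpace (EuclideanHalfSpace d) X] [IsManifold (𝓡∂ d) ∞ X]
  {Y : Type*} [TopologicalSpace Y] [ChartedSpace (EuclideanHalfSpace e) Y] [IsManifold (𝓡∂ e) ∞ Y]
  {ι : Y → X}

/-- The induced metric in the charts at `a` and `ι a`. -/
lemma chartBil_pullback (g : MetricField d X) (hι : ContMDiff (𝓡∂ e) (𝓡∂ d) 2 ι) {a : Y}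
    {z : EuclideanSpace ℝ (Fin e)} (hz : z ∈ chartDomain e a)
    (hs : ι ((extChartAt (𝓡∂ e) a).symm z) ∈ (extChartAt (𝓡∂ d) (ι a)).source) :
    chartBil (pullback ι g : MetricField e Y) a z
      = pullBil (chartBil g (ι a) (coordMap d e ι a z)) (fderiv ℝ (coordMap d e ι a) z) := by
  set y := (extChartAt (𝓡∂ e) a).symm z with hy
  have hU : UniqueMDiffWithinAt 𝓘(ℝ, EuclideanSpace ℝ (Fin e)) (range (𝓡∂ e)) z :=
    (𝓡∂ e).uniqueMDiffOn _ (interior_subset hz.2)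
  let T : EuclideanSpace ℝ (Fin e) →L[ℝ] EuclideanSpace ℝ (Fin d) := mfderiv (𝓡∂ e) (𝓡∂ d) ι y
  let P : EuclideanSpace ℝ (Fin d) →L[ℝ] EuclideanSpace ℝ (Fin d) :=
    mfderiv (𝓡∂ d) 𝓘(ℝ, EuclideanSpace ℝ (Fin d)) (extChartAt (𝓡∂ d) (ι a)) (ι y)
  have hι1 : MDifferentiableAt (𝓡∂ e) (𝓡∂ d) ι y := (hι y).mdifferentiableAt (by norm_num)
  have hc1 : MDifferentiableAt (𝓡∂ d) 𝓘(ℝ, EuclideanSpace ℝ (Fin d)) (extChartAt (𝓡∂ d) (ι a))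
      (ι y) := mdifferentiableAt_extChartAt (by rwa [← extChartAt_source (I := 𝓡∂ d)])
  have hF : fderiv ℝ (coordMap d e ι a) z = P.comp (T.comp (frame e a z)) := by
    have h1 : (mfderiv (𝓡∂ e) 𝓘(ℝ, EuclideanSpace ℝ (Fin d)) (extChartAt (𝓡∂ d) (ι a) ∘ ι) y).comp
        (mfderivWithin 𝓘(ℝ, EuclideanSpace ℝ (Fin e)) (𝓡∂ e) (extChartAt (𝓡∂ e) a).symm
          (range (𝓡∂ e)) z) = fderiv ℝ (coordMap d e ι a) z := by
      rw [← mfderiv_comp_mfderivWithin z (hc1.comp y hι1)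
        (mdifferentiableWithinAt_extChartAt_symm hz.1) hU, mfderivWithin_eq_fderivWithin]
      exact fderivWithin_of_mem_interior hz.2
    rw [← h1, mfderiv_comp y hc1 hι1]
    rfl
  have h2 : (frame d (ι a) (coordMap d e ι a z)).comp P = ContinuousLinearMap.id ℝ _ :=
    mfderivWithin_extChartAt_symm_comp_mfderiv_extChartAt' (I := 𝓡∂ d) hs
  -- the coordinate frames intertwine the differential of `ι` and that of its coordinate expression
  have h3 : ∀ v, frame d (ι a) (coordMap d e ι a z) (fderiv ℝ (coordMap d e ι a) z v)
      = T (frame e a z v) := fun v => by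
    rw [hF]
    exact DFunLike.congr_fun h2 (T (frame e a z v))
  have h4 : (extChartAt (𝓡∂ d) (ι a)).symm (coordMap d e ι a z) = ι y :=
    (extChartAt (𝓡∂ d) (ι a)).left_inv hs
  ext1 v
  ext1 w
  change _ = chartBil g (ι a) (coordMap d e ι a z) (fderiv ℝ (coordMap d e ι a) z v)
    (fderiv ℝ (coordMap d e ι a) z w)
  rw [chartBil_apply, chartBil_apply, h3, h3, h4]
  rfl

end Submanifold

/-! ### A submanifold near a boundary point -/

section BoundaryPoint

variable {d e : ℕ} [NeZero d] [NeZero e]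
  {X : Type*} [TopologicalSpace X] [ChartedSpace (EuclideanHalfSpace d) X] [IsManifold (𝓡∂ d) ∞ X]
  {Y : Type*} [TopologicalSpace Y] [ChartedSpace (EuclideanHalfSpace e) Y] [IsManifold (𝓡∂ e) ∞ Y]
  {ι : Y → X} {g : MetricField d X} {r : X → ℝ} {y₀ : Y}

omit [IsManifold (𝓡∂ d) ∞ X] [IsManifold (𝓡∂ e) ∞ Y] in
lemma eventually_mem_source (hι : ContMDiff (𝓡∂ e) (𝓡∂ d) 2 ι) (y₀ : Y) :
    ∀ᶠ z in 𝓝 (extChartAt (𝓡∂ e) y₀ y₀),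
      ι ((extChartAt (𝓡∂ e) y₀).symm z) ∈ (extChartAt (𝓡∂ d) (ι y₀)).source := by
  have hc : ContinuousAt (ι ∘ (extChartAt (𝓡∂ e) y₀).symm) (extChartAt (𝓡∂ e) y₀ y₀) :=
    hι.continuous.continuousAt.comp (continuousAt_extChartAt_symm y₀)
  refine hc ?_
  rw [Function.comp_apply, extChartAt_to_inv]
  exact extChartAt_source_mem_nhds _

omit [IsManifold (𝓡∂ d) ∞ X] [IsManifold (𝓡∂ e) ∞ Y] in
lemma inChart_comp (hι : ContMDiff (𝓡∂ e) (𝓡∂ d) 2 ι) (r : X → ℝ) (y₀ : Y) :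
    inChart e (r ∘ ι) y₀ =ᶠ[𝓝 (extChartAt (𝓡∂ e) y₀ y₀)]
      inChart d r (ι y₀) ∘ coordMap d e ι y₀ := by
  filter_upwards [eventually_mem_source hι y₀] with z hz
  exact congrArg r ((extChartAt (𝓡∂ d) (ι y₀)).left_inv hz).symm

omit [IsManifold (𝓡∂ d) ∞ X] in
lemma self_mem_halfSpace (x : X) : extChartAt (𝓡∂ d) x x ∈ halfSpace d :=
  extChartAt_target_subset_range x (mem_extChartAt_target x)

/-- A function that vanishes on the boundary, in a chart. -/
lemma eventually_inChart_eq_zero {f : X → ℝ} (hf : ∀ x ∈ boundarySet d X, f x = 0) (a : X) :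
    ∀ᶠ z in 𝓝[halfSpace d] (extChartAt (𝓡∂ d) a a), z 0 = 0 → inChart d f a z = 0 := by
  filter_upwards [extChartAt_target_mem_nhdsWithin (I := 𝓡∂ d) a] with z hz h0
  refine hf _ ((mem_boundarySet_iff ((extChartAt (𝓡∂ d) a).map_target hz)).2 ?_)
  rwa [(extChartAt (𝓡∂ d) a).right_inv hz]

/-- Near `y₀` the submanifold stays in the domain of the chart at `ι y₀`, in the interior. -/
lemma eventually_coordMap_mem (hι : ContMDiff (𝓡∂ e) (𝓡∂ d) 2 ι)
    (hint : MapsTo ι (interiorSet e Y) (interiorSet d X)) (y₀ : Y) :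
    ∀ᶠ z in 𝓝[interior (halfSpace e)] (extChartAt (𝓡∂ e) y₀ y₀),
      z ∈ chartDomain e y₀ ∧
      ι ((extChartAt (𝓡∂ e) y₀).symm z) ∈ (extChartAt (𝓡∂ d) (ι y₀)).source ∧
      coordMap d e ι y₀ z ∈ chartDomain d (ι y₀) := by
  filter_upwards [eventually_mem_target y₀, nhdsWithin_le_nhds (eventually_mem_source hι y₀)]
    with z hz hs
  refine ⟨hz, hs, (extChartAt (𝓡∂ d) (ι y₀)).map_source hs, ?_⟩
  exact (mem_interiorSet_iff hs).1 (hint ((symm_mem_interiorSet_iff hz.1).2 hz.2))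

omit [IsManifold (𝓡∂ d) ∞ X] [IsManifold (𝓡∂ e) ∞ Y] in
lemma injective_fderivWithin_coordMap (hι : ContMDiff (𝓡∂ e) (𝓡∂ d) 2 ι)
    (himm : Function.Injective (tangentMap d e ι y₀)) : Function.Injective
      (fderivWithin ℝ (coordMap d e ι y₀) (halfSpace e) (extChartAt (𝓡∂ e) y₀ y₀)) := by
  intro u v huv
  refine himm (a₁ := (u : TangentSpace (𝓡∂ e) y₀)) (a₂ := (v : TangentSpace (𝓡∂ e) y₀)) ?_
  exact (tangentMap_eq hι y₀ u).trans (huv.trans (tangentMap_eq hι y₀ v).symm)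

omit [IsManifold (𝓡∂ d) ∞ X] [IsManifold (𝓡∂ e) ∞ Y] in
/-- The differential of `r ∘ ι`. -/
lemma fderivWithin_inChart_comp (hr : IsDefiningFunction d r) (hι : ContMDiff (𝓡∂ e) (𝓡∂ d) 2 ι)
    (y₀ : Y) :
    ContDiffWithinAt ℝ 1 (inChart e (r ∘ ι) y₀) (halfSpace e) (extChartAt (𝓡∂ e) y₀ y₀) ∧
    fderivWithin ℝ (inChart e (r ∘ ι) y₀) (halfSpace e) (extChartAt (𝓡∂ e) y₀ y₀)
      = (fderivWithin ℝ (inChart d r (ι y₀)) (halfSpace d) (extChartAt (𝓡∂ d) (ι y₀) (ι y₀))).comp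
        (fderivWithin ℝ (coordMap d e ι y₀) (halfSpace e) (extChartAt (𝓡∂ e) y₀ y₀)) := by
  have hrι : ContMDiff (𝓡∂ e) 𝓘(ℝ, ℝ) 2 (r ∘ ι) :=
    (hr.smooth.of_le (natCast_le_infty 2)).comp hι
  refine ⟨(contDiffWithinAt_inChart hrι y₀).of_le (by norm_num), ?_⟩
  have h1 : MDifferentiableAt (𝓡∂ d) 𝓘(ℝ, ℝ) r (ι y₀) := (hr.smooth _).mdifferentiableAt (by simp)
  have h2 : MDifferentiableAt (𝓡∂ e) (𝓡∂ d) ι y₀ := (hι y₀).mdifferentiableAt (by norm_num)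
  have h3 := mfderiv_comp y₀ h1 h2
  rw [(h1.comp y₀ h2).mfderiv, h1.mfderiv, h2.mfderiv] at h3
  exact h3

/-- Transversality: the normal derivative of `r ∘ ι` at a boundary point is positive. -/
lemma normal_derivative_pos (hr : IsDefiningFunction d r) (hι : ContMDiff (𝓡∂ e) (𝓡∂ d) 2 ι)
    (hint : MapsTo ι (interiorSet e Y) (interiorSet d X))
    (hbd : MapsTo ι (boundarySet e Y) (boundarySet d X)) (hy₀ : y₀ ∈ boundarySet e Y)
    (htr : LinearMap.range (tangentMap d e ι y₀) ⊔ boundaryTangent (ι y₀) = ⊤) :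
    0 < fderivWithin ℝ (inChart e (r ∘ ι) y₀) (halfSpace e) (extChartAt (𝓡∂ e) y₀ y₀) (ev 0) := by
  obtain ⟨hs, hcomp⟩ := fderivWithin_inChart_comp hr hι y₀
  have hz₀ : extChartAt (𝓡∂ e) y₀ y₀ 0 = 0 :=
    (mem_boundarySet_iff (mem_extChartAt_source y₀)).1 hy₀
  have hx₀ : extChartAt (𝓡∂ d) (ι y₀) (ι y₀) 0 = 0 :=
    (mem_boundarySet_iff (mem_extChartAt_source (ι y₀))).1 (hbd hy₀)
  have hzero := eventually_inChart_eq_zero (f := r ∘ ι) (fun y hy => hr.zero _ (hbd hy)) y₀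
  have hlim := tendsto_div_of_zero hs hz₀ hzero
  refine lt_of_le_of_ne (ge_of_tendsto hlim ?_) fun hb => ?_
  · filter_upwards [eventually_mem_target y₀] with z hz
    refine div_nonneg (hr.pos _ (hint ((symm_mem_interiorSet_iff hz.1).2 hz.2))).le ?_
    exact (mem_interior_halfSpace.1 hz.2).le
  · -- otherwise `dr` vanishes on `T_{y₀} Y` and on the tangent space of the boundary
    refine hr.deriv_ne (ι y₀) (hbd hy₀) ?_
    have h1 : MDifferentiableAt (𝓡∂ d) 𝓘(ℝ, ℝ) r (ι y₀) := (hr.smooth _).mdifferentiableAt (by simp)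
    have hη : mfderiv (𝓡∂ d) 𝓘(ℝ, ℝ) r (ι y₀)
      = fderivWithin ℝ (inChart d r (ι y₀)) (halfSpace d) (extChartAt (𝓡∂ d) (ι y₀) (ι y₀)) :=
      h1.mfderiv
    have hker : (⊤ : Submodule ℝ (TangentSpace (𝓡∂ d) (ι y₀)))
        ≤ LinearMap.ker (mfderiv (𝓡∂ d) 𝓘(ℝ, ℝ) r (ι y₀)).toLinearMap := by
      rw [← htr]
      refine sup_le ?_ fun v hv => ?_
      · rintro _ ⟨u, rfl⟩
        change mfderiv (𝓡∂ d) 𝓘(ℝ, ℝ) r (ι y₀) (tangentMap d e ι y₀ u) = 0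
        rw [hη]
        have h2 := fderivWithin_apply_eq (hs.differentiableWithinAt (by norm_num)) hz₀ hzero u
        rw [← hb, mul_zero, hcomp] at h2
        exact (congrArg _ (tangentMap_eq hι y₀ u)).trans h2
      · change mfderiv (𝓡∂ d) 𝓘(ℝ, ℝ) r (ι y₀) v = 0
        rw [hη]
        exact fderivWithin_apply_of_zero ((contDiffWithinAt_inChart hr.smooth
          (ι y₀)).differentiableWithinAt (by simp)) hx₀ (eventually_inChart_eq_zero hr.zero _) hv
    ext1 v
    exact hker (Submodule.mem_top (x := v))

variable {gb : Bundle.ContMDiffRiemannianMetric (𝓡∂ d) 3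
    (EuclideanSpace ℝ (Fin d)) (fun x : X => TangentSpace (𝓡∂ d) x)}

/-- The asymptotic mean curvature is determined by the angle at which the submanifold meets the
boundary. -/
lemma sq_asymptotic_meanCurvature (hr : IsDefiningFunction d r) (hg : IsExtension g r gb)
    {C : ℝ} (hC : IsAsymptoticallyCMC (e := e) g ι C) (hy₀ : y₀ ∈ boundarySet e Y) :
    let G := chartBil (metricFieldOf gb) (ι y₀) (extChartAt (𝓡∂ d) (ι y₀) (ι y₀))
    let η := fderivWithin ℝ (inChart d r (ι y₀)) (halfSpace d) (extChartAt (𝓡∂ d) (ι y₀) (ι y₀))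
    let L := fderivWithin ℝ (coordMap d e ι y₀) (halfSpace e) (extChartAt (𝓡∂ e) y₀ y₀)
    C ^ 2 = (e : ℝ) ^ 2 * (G (grad G η) (grad G η)
      - traceM (gramOf G L) fun α β => η (L (ev α)) * η (L (ev β))) := by
  intro G η L
  have hι := hC.submanifold.contMDiff
  have hint := hC.submanifold.mapsTo_interior
  have hF : ContDiffWithinAt ℝ 2 (coordMap d e ι y₀) (halfSpace e) (extChartAt (𝓡∂ e) y₀ y₀) :=
    contDiffWithinAt_coordMap hι y₀
  have hFz := coordMap_self (d := d) (e := e) (ι := ι) y₀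
  have hmem := eventually_coordMap_mem hι hint y₀
  have hinj := injective_fderivWithin_coordMap hι (hC.submanifold.immersion y₀)
  have hinj' : ∀ᶠ z in 𝓝[interior (halfSpace e)] (extChartAt (𝓡∂ e) y₀ y₀),
      Function.Injective (fderiv ℝ (coordMap d e ι y₀) z) :=
    ((hF.of_le (by norm_num)).tendsto_fderiv uniqueDiffOn_halfSpace (self_mem_halfSpace y₀)).eventually
      (ContinuousLinearMap.isOpen_injective.mem_nhds hinj)
  have tF : Tendsto (coordMap d e ι y₀) (𝓝[interior (halfSpace e)] (extChartAt (𝓡∂ e) y₀ y₀))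
      (𝓝[interior (halfSpace d)] (extChartAt (𝓡∂ d) (ι y₀) (ι y₀))) := by
    refine tendsto_nhdsWithin_iff.2 ⟨?_, hmem.mono fun z hz => hz.2.2.2⟩
    have := hF.tendsto_interior
    rwa [hFz] at this
  have lim := tendsto_mcSq_conformal (B := chartBil g (ι y₀)) (Bb := chartBil (metricFieldOf gb) (ι y₀))
    (r := inChart d r (ι y₀)) uniqueDiffOn_halfSpace
    uniqueDiffOn_halfSpace (self_mem_halfSpace y₀) hF
    (by rw [hFz]; exact self_mem_halfSpace _) (hmem.mono fun z hz => hz.2.2.2) hinj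
    (by rw [hFz]; exact (contDiffWithinAt_chartBil gb (ι y₀)).of_le (by norm_num))
    (by rw [hFz]; exact (contDiffWithinAt_inChart hr.smooth (ι y₀)).of_le (natCast_le_infty 1))
    (by
      rw [hFz]
      filter_upwards [extChartAt_target_mem_nhdsWithin (I := 𝓡∂ d) (ι y₀)] with z hz using
        isInner_chartBil gb hz)
    (by
      rw [hFz]
      simp only [inChart, Function.comp_apply, extChartAt_to_inv]
      exact hr.zero _ (hC.submanifold.mapsTo_boundary hy₀))
    (by
      rw [hFz]
      filter_upwards [eventually_mem_target (ι y₀)] with z hz using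
        ⟨inChart_pos hr hz, chartBil_eventuallyEq hr hg hz⟩) hinj'
  rw [hFz] at lim
  refine tendsto_nhds_unique ?_ lim
  have hnb := tendsto_symm_nearBoundary hy₀ (d := e)
  -- the squared mean curvature tends to `C²`
  have hrι : Tendsto (fun z => r (ι ((extChartAt (𝓡∂ e) y₀).symm z)))
      (𝓝[interior (halfSpace e)] (extChartAt (𝓡∂ e) y₀ y₀)) (𝓝 0) := by
    have h1 : ContinuousAt (fun z => r (ι ((extChartAt (𝓡∂ e) y₀).symm z)))
        (extChartAt (𝓡∂ e) y₀ y₀) :=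
      (hr.smooth.continuous.comp hι.continuous).continuousAt.comp (continuousAt_extChartAt_symm y₀)
    have h2 := h1.tendsto.mono_left (nhdsWithin_le_nhds (s := interior (halfSpace e)))
    rw [extChartAt_to_inv, hr.zero _ (hC.submanifold.mapsTo_boundary hy₀)] at h2
    exact h2
  have hO := ((hC.meanCurvature r hr).comp_tendsto hnb).trans_tendsto hrι
  have hC2 := hO.add_const (C ^ 2)
  rw [zero_add] at hC2
  refine hC2.congr' ?_
  filter_upwards [hmem, hF.eventually_contDiffAt (n := 2) (self_mem_halfSpace y₀), hinj',
    tF.eventually (eventually_contDiffAt_chartBil (n := 1) hr hg (by norm_num) (ι y₀))]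
    with z h1 h2 h3 h4
  have h5 := meanCurvature_sq_eq_mcSq hr hg hι hint h1.1 rfl h1.2.1 h2 h3 h4
  simp only [Function.comp_apply, h5, sub_add_cancel]

end BoundaryPoint

/-! ### The eigenvalue bound -/

section Bound

variable {k : ℕ} {M : Type*} [TopologicalSpace M] [ChartedSpace (EuclideanHalfSpace (k + 1)) M]
  [T2Space M] [CompactSpace M] [IsManifold (𝓡∂ (k + 1)) ∞ M] [MeasurableSpace M] [BorelSpace M]

/-- The first eigenvalue of a metric that is asymptotic to `w₀⁻² A` at a boundary point. -/
lemma firstEigenvalue_le_of_tendsto (h : MetricField (k + 1) M) {y₀ : M}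
    (hy₀ : y₀ ∈ boundarySet (k + 1) M) {A : Matrix (Fin (k + 1)) (Fin (k + 1)) ℝ} (hA : A.PosDef)
    (hlim : Tendsto (fun w => w 0 ^ 2 • metricInChart h y₀ w)
      (𝓝[interior (halfSpace (k + 1))] (extChartAt (𝓡∂ (k + 1)) y₀ y₀)) (𝓝 A))
    {p : ℝ} (hp : 0 < p) :
    firstEigenvalue h p ≤ ENNReal.ofReal ((k / p * Real.sqrt (A⁻¹ 0 0)) ^ p) := by
  have hpos : ∀ᶠ w in 𝓝[interior (halfSpace (k + 1))] (extChartAt (𝓡∂ (k + 1)) y₀ y₀),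
      0 < w 0 := by
    filter_upwards [self_mem_nhdsWithin] with w hw using mem_interior_halfSpace.1 hw
  have hA00 : 0 < A⁻¹ 0 0 := hA.inv.diag_pos
  have hinv := Matrix.tendsto_inv hlim hA.det_pos.ne'.isUnit
  have hent : ∀ i j, Tendsto (fun w => (w 0 ^ 2 • metricInChart h y₀ w)⁻¹ i j)
      (𝓝[interior (halfSpace (k + 1))] (extChartAt (𝓡∂ (k + 1)) y₀ y₀)) (𝓝 (A⁻¹ i j)) :=
    fun i j => tendsto_pi_nhds.1 (tendsto_pi_nhds.1 hinv i) j
  have hmul : ∀ w : EuclideanSpace ℝ (Fin (k + 1)), 0 < w 0 → ∀ i j,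
      (metricInChart h y₀ w)⁻¹ i j = w 0 ^ 2 * (w 0 ^ 2 • metricInChart h y₀ w)⁻¹ i j := by
    intro w hw i j
    rw [Matrix.inv_smul_of_ne_zero _ (by positivity), Matrix.smul_apply, smul_eq_mul,
      mul_inv_cancel_left₀ (by positivity)]
  have hdet := ((Real.continuous_sqrt.comp continuous_id.matrix_det).tendsto A).comp hlim
  have hD : 0 < Real.sqrt A.det := Real.sqrt_pos.2 hA.det_pos
  refine firstEigenvalue_le h hy₀ (D₁ := Real.sqrt A.det / 2) (D₂ := Real.sqrt A.det + 1)
    (K := ∑ i, ∑ j, (|A⁻¹ i j| + 1)) hp (div_mul_cancel₀ _ hp.ne')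
    (by positivity) (Real.sqrt_nonneg _) (by positivity) (fun ε hε => ?_) ?_ ?_
  · rw [Real.sq_sqrt hA00.le]
    filter_upwards [hpos, (hent 0 0).eventually_le_const (lt_add_of_pos_right _ hε)] with w h0 hw
    rw [hmul w h0]
    gcongr
  · have hb : ∀ᶠ w in 𝓝[interior (halfSpace (k + 1))] (extChartAt (𝓡∂ (k + 1)) y₀ y₀), ∀ i j,
        |(w 0 ^ 2 • metricInChart h y₀ w)⁻¹ i j| ≤ |A⁻¹ i j| + 1 :=
      eventually_all.2 fun i => eventually_all.2 fun j =>
        (hent i j).abs.eventually_le_const (lt_add_one _)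
    filter_upwards [hpos, hb] with w h0 hw i j
    rw [hmul w h0, abs_mul, abs_of_pos (by positivity : 0 < w 0 ^ 2), mul_comm]
    gcongr
    refine (hw i j).trans ?_
    refine (Finset.single_le_sum (f := fun j => |A⁻¹ i j| + 1) (fun _ _ => by positivity)
      (Finset.mem_univ j)).trans ?_
    exact Finset.single_le_sum (f := fun i => ∑ j, (|A⁻¹ i j| + 1)) (fun _ _ => by positivity)
      (Finset.mem_univ i)
  · filter_upwards [hpos, hdet.eventually_const_le (half_lt_self hD),
      hdet.eventually_le_const (lt_add_one _)] with w h0 h1 h2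
    have e : Real.sqrt (metricInChart h y₀ w).det * w 0 ^ (k + 1)
        = Real.sqrt (w 0 ^ 2 • metricInChart h y₀ w).det := by
      rw [Matrix.det_smul, Fintype.card_fin, ← pow_mul, mul_comm 2, pow_mul,
        Real.sqrt_mul (by positivity), Real.sqrt_sq (by positivity), mul_comm]
    rw [e]
    exact ⟨h1, h2⟩

end Bound

section Submanifold

variable {d e : ℕ} [NeZero d] [NeZero e]
  {X : Type*} [TopologicalSpace X] [ChartedSpace (EuclideanHalfSpace d) X] [IsManifold (𝓡∂ d) ∞ X]
  {Y : Type*} [TopologicalSpace Y] [ChartedSpace (EuclideanHalfSpace e) Y] [IsManifold (𝓡∂ e) ∞ Y]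
  {ι : Y → X} {g : MetricField d X} {r : X → ℝ} {y₀ : Y}
  {gb : Bundle.ContMDiffRiemannianMetric (𝓡∂ d) 3
    (EuclideanSpace ℝ (Fin d)) (fun x : X => TangentSpace (𝓡∂ d) x)}

/-- The induced metric is asymptotic to `w₀⁻² A` at a boundary point, where `A` is the metric induced
by the extension of `r² g`, divided by the square of the normal derivative of `r ∘ ι`. -/
lemma tendsto_metricInChart_pullback (hr : IsDefiningFunction d r) (hg : IsExtension g r gb)
    (hι : IsConformallyCompactSubmanifold (e := e) g ι) (hy₀ : y₀ ∈ boundarySet e Y) :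
    Tendsto (fun w => w 0 ^ 2 • metricInChart (pullback ι g : MetricField e Y) y₀ w)
      (𝓝[interior (halfSpace e)] (extChartAt (𝓡∂ e) y₀ y₀))
      (𝓝 ((fderivWithin ℝ (inChart e (r ∘ ι) y₀) (halfSpace e) (extChartAt (𝓡∂ e) y₀ y₀)
          (ev 0) ^ 2)⁻¹ •
        gramOf (chartBil (metricFieldOf gb) (ι y₀) (extChartAt (𝓡∂ d) (ι y₀) (ι y₀)))
          (fderivWithin ℝ (coordMap d e ι y₀) (halfSpace e) (extChartAt (𝓡∂ e) y₀ y₀)))) := by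
  have hF : ContDiffWithinAt ℝ 2 (coordMap d e ι y₀) (halfSpace e) (extChartAt (𝓡∂ e) y₀ y₀) :=
    contDiffWithinAt_coordMap hι.contMDiff y₀
  have hFz := coordMap_self (d := d) (e := e) (ι := ι) y₀
  have hmem := eventually_coordMap_mem hι.contMDiff hι.mapsTo_interior y₀
  have tF : Tendsto (coordMap d e ι y₀) (𝓝[interior (halfSpace e)] (extChartAt (𝓡∂ e) y₀ y₀))
      (𝓝[halfSpace d] (extChartAt (𝓡∂ d) (ι y₀) (ι y₀))) := by
    refine tendsto_nhdsWithin_iff.2 ⟨?_, hmem.mono fun z hz => interior_subset hz.2.2.2⟩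
    have := hF.tendsto_interior
    rwa [hFz] at this
  have hz₀ : extChartAt (𝓡∂ e) y₀ y₀ 0 = 0 :=
    (mem_boundarySet_iff (mem_extChartAt_source y₀)).1 hy₀
  obtain ⟨hs, -⟩ := fderivWithin_inChart_comp hr hι.contMDiff y₀
  have hb := normal_derivative_pos hr hι.contMDiff hι.mapsTo_interior hι.mapsTo_boundary hy₀
    (hι.transverse y₀ (hι.mapsTo_boundary hy₀))
  have t1 := tendsto_div_of_zero hs hz₀ (eventually_inChart_eq_zero (f := r ∘ ι)
    (fun y hy => hr.zero _ (hι.mapsTo_boundary hy)) y₀)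
  have t2 := tendsto_gramOf
    ((contDiffWithinAt_chartBil gb (ι y₀)).continuousWithinAt.tendsto.comp tF)
    ((hF.of_le (by norm_num)).tendsto_fderiv uniqueDiffOn_halfSpace (self_mem_halfSpace y₀))
  refine (((t1.pow 2).inv₀ (by positivity)).smul t2).congr' ?_
  filter_upwards [hmem, nhdsWithin_le_nhds (inChart_comp hι.contMDiff r y₀)] with w hw hrw
  have hw0 : 0 < w 0 := mem_interior_halfSpace.1 hw.1.2
  have hrp : 0 < inChart e (r ∘ ι) y₀ w := by
    rw [hrw]
    exact inChart_pos hr hw.2.2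
  have hM : metricInChart (pullback ι g : MetricField e Y) y₀ w
      = (inChart e (r ∘ ι) y₀ w ^ 2)⁻¹ • gramOf (chartBil (metricFieldOf gb) (ι y₀)
        (coordMap d e ι y₀ w)) (fderiv ℝ (coordMap d e ι y₀) w) := by
    rw [← gramOf_smul, hrw, Function.comp_apply, ← chartBil_eq hr hg hw.2.2]
    ext i j
    rw [isMatrixOf_metricInChart, chartBil_pullback g hι.contMDiff hw.1 hw.2.1]
    rfl
  rw [hM, smul_smul, Function.comp_apply]
  congr 1
  field_simp

end Submanifold

lemma nproj_eq_zero_of_bijective {E : Type*} [NormedAddCommGroup E] [NormedSpace ℝ E] {e : ℕ}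
    {G : Bil E} (hG : IsInner G) {L : EuclideanSpace ℝ (Fin e) →L[ℝ] E}
    (hL : Function.Bijective L) (x : E) : nproj G L x = 0 := by
  obtain ⟨u, rfl⟩ := hL.2 x
  exact nproj_range hG hL.1 u

end AHSub

end

theorem mainTheorem5 (n k : ℕ)
    {X : Type*} [TopologicalSpace X] [T2Space X] [CompactSpace X]
    [ChartedSpace (EuclideanHalfSpace (n + 1)) X] [IsManifold (𝓡∂ (n + 1)) ∞ X]
    {Y : Type*} [TopologicalSpace Y] [T2Space Y] [CompactSpace Y]
    [ChartedSpace (EuclideanHalfSpace (k + 1)) Y] [IsManifold (𝓡∂ (k + 1)) ∞ Y]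
    [MeasurableSpace Y] [BorelSpace Y]
    (hY : (AHSub.boundarySet (k + 1) Y).Nonempty)
    (g : AHSub.MetricField (n + 1) X) (hg : AHSub.IsAsymptoticallyHyperbolic g)
    (ι : Y → X) (C : ℝ) (hι : AHSub.IsAsymptoticallyCMC (e := k + 1) g ι C)
    (p : ℝ) (hp : 1 < p) :
    C < k + 1 ∧
    AHSub.firstEigenvalue (AHSub.pullback ι g : AHSub.MetricField (k + 1) Y) p
      ≤ ENNReal.ofReal (((k : ℝ) / p) ^ p * (1 - C ^ 2 / ((k : ℝ) + 1) ^ 2) ^ (p / 2)) ∧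
    (C = 0 →
      AHSub.firstEigenvalue (AHSub.pullback ι g : AHSub.MetricField (k + 1) Y) p
        ≤ ENNReal.ofReal (((k : ℝ) / p) ^ p)) := by
  open AHSub in
  have hp0 : 0 < p := by linarith
  suffices h : C < k + 1 ∧
      AHSub.firstEigenvalue (AHSub.pullback ι g : AHSub.MetricField (k + 1) Y) p
      ≤ ENNReal.ofReal (((k : ℝ) / p) ^ p * (1 - C ^ 2 / ((k : ℝ) + 1) ^ 2) ^ (p / 2)) by
    refine ⟨h.1, h.2, fun hC => ?_⟩
    simpa [hC] using h.2
  obtain ⟨y₀, hy₀⟩ := hY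
  obtain ⟨r, gb, hr, hext⟩ := hg.conformallyCompact
  have hsub := hι.submanifold
  have hx₀ := hsub.mapsTo_boundary hy₀
  have hC2 := sq_asymptotic_meanCurvature hr hext hι hy₀
  have hlim := tendsto_metricInChart_pullback hr hext hsub hy₀
  have hnorm := fun hd : 2 ≤ n + 1 => inner_grad_of_hyperbolic hd hr hext hg.curvature hx₀
  have hcomp := (fderivWithin_inChart_comp hr hsub.contMDiff y₀).2
  have hz₀ : extChartAt (𝓡∂ (k + 1)) y₀ y₀ 0 = 0 :=
    (mem_boundarySet_iff (mem_extChartAt_source y₀)).1 hy₀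
  have hη := fderivWithin_apply_eq ((fderivWithin_inChart_comp hr hsub.contMDiff
    y₀).1.differentiableWithinAt (by norm_num)) hz₀ (eventually_inChart_eq_zero (f := r ∘ ι)
    (fun y hy => hr.zero _ (hsub.mapsTo_boundary hy)) y₀)
  have hb := normal_derivative_pos hr hsub.contMDiff hsub.mapsTo_interior hsub.mapsTo_boundary hy₀
    (hsub.transverse y₀ hx₀)
  have hinj := injective_fderivWithin_coordMap hsub.contMDiff (hsub.immersion y₀)
  have hG := isInner_chartBil gb (mem_extChartAt_target (I := 𝓡∂ (n + 1)) (ι y₀))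
  dsimp only at hC2 hnorm
  -- `dr` restricted to the submanifold is `b` times the coordinate covector `dw₀`
  have hsum := fun v => (congrArg (fun T => T v) hcomp).symm.trans (hη v)
  simp only [ContinuousLinearMap.comp_apply] at hsum
  set b := fderivWithin ℝ (inChart (k + 1) (r ∘ ι) y₀) (halfSpace (k + 1))
    (extChartAt (𝓡∂ (k + 1)) y₀ y₀) (ev 0)
  set G := chartBil (metricFieldOf gb) (ι y₀) (extChartAt (𝓡∂ (n + 1)) (ι y₀) (ι y₀))
  set η := fderivWithin ℝ (inChart (n + 1) r (ι y₀)) (halfSpace (n + 1))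
    (extChartAt (𝓡∂ (n + 1)) (ι y₀) (ι y₀))
  set L := fderivWithin ℝ (coordMap (n + 1) (k + 1) ι y₀) (halfSpace (k + 1))
    (extChartAt (𝓡∂ (k + 1)) y₀ y₀)
  have hA : (gramOf G L).PosDef := posDef_gramOf hG hinj
  have hA' : ((b ^ 2)⁻¹ • gramOf G L).PosDef := hA.smul (by positivity)
  have hle := firstEigenvalue_le_of_tendsto _ hy₀ hA' hlim hp0
  -- the squared length of the restriction of `dr` to the submanifold
  have htr : traceM (gramOf G L) (fun α β => η (L (ev α)) * η (L (ev β)))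
      = ((b ^ 2)⁻¹ • gramOf G L)⁻¹ 0 0 := by
    rw [Matrix.inv_smul_of_ne_zero _ (by positivity), inv_inv, Matrix.smul_apply, traceM,
      Finset.sum_eq_single 0, Finset.sum_eq_single 0]
    · rw [hsum]
      simp
      ring
    · intro β _ hβ
      rw [hsum (ev β)]
      simp [hβ.symm]
    · simp
    · intro α _ hα
      refine Finset.sum_eq_zero fun β _ => ?_
      rw [hsum (ev α)]
      simp [hα.symm]
    · simp
  rw [htr] at hC2
  have ha : 0 < ((b ^ 2)⁻¹ • gramOf G L)⁻¹ 0 0 := hA'.inv.diag_pos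
  set a := ((b ^ 2)⁻¹ • gramOf G L)⁻¹ 0 0
  push_cast at hC2
  have hk : (0 : ℝ) < (k : ℝ) + 1 := by positivity
  rcases Nat.eq_zero_or_pos n with hn | hn
  · -- if `X` has dimension one, so does `Y`, and the mean curvature is zero
    have hfr := LinearMap.finrank_le_finrank_of_injective (f := L.toLinearMap) hinj
    simp only [finrank_euclideanSpace_fin] at hfr
    have hkn : k = n := by omega
    have hk0 : k = 0 := by omega
    have hbij : Function.Bijective L :=
      ⟨hinj, (LinearMap.injective_iff_surjective_of_finrank_eq_finrank (f := L.toLinearMap)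
        (by simp [hkn])).1 hinj⟩
    have h0 := inner_nproj_self hG hinj (grad G η)
    rw [nproj_eq_zero_of_bijective hG hbij] at h0
    simp only [hG.grad_spec, htr] at h0
    rw [hG.grad_spec] at hC2
    simp only [map_zero] at h0
    rw [← h0, mul_zero] at hC2
    have hC0 : C = 0 := by simpa using hC2
    refine ⟨by rw [hC0]; exact hk, hle.trans (le_of_eq ?_)⟩
    simp [hk0, Real.zero_rpow hp0.ne']
  · rw [hnorm (by omega)] at hC2
    -- `|dr| = 1`, so that `C² = (k + 1)² (1 - a)`
    have hC3 : 1 - C ^ 2 / ((k : ℝ) + 1) ^ 2 = a := by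
      rw [hC2]
      field_simp
      ring
    refine ⟨lt_of_pow_lt_pow_left₀ 2 hk.le ?_, hle.trans (le_of_eq ?_)⟩
    · rw [hC2]
      nlinarith [mul_pos (pow_pos hk 2) ha]
    · rw [hC3, Real.mul_rpow (by positivity) (Real.sqrt_nonneg _), Real.sqrt_eq_rpow,
        ← Real.rpow_mul ha.le]
      congr 3
      ring
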